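/- **Conventions.** Let $P=\mathbb{Z}[x_1,\dots,x_n]$, let $\mathbb{T}^n$ be the set of terms $x_1^{e_1}\cdots x_n^{e_n}$, and let $\sigma$ be a term ordering on $\mathbb{T}^n$. A monomial is an integer times a term. For $f\in P\setminus\{0\}$ let $\mathrm{LT}_\sigma(f)$ be the $\sigma$-largest term of $f$, $\mathrm{LC}_\sigma(f)$ its coefficient, and $\mathrm{LM}_\sigma(f)=\mathrm{LC}_\sigma(f)\,\mathrm{LT}_\sigma(f)$. For an ideal $I$ of $P$ put $\mathrm{LM}_\sigma(I)=\{\mathrm{LM}_\sigma(f)\mid f\in I\setminus\{0\}\}$. A finite set $G\subseteq I$ is a *strong $\sigma$-Gröbner basis* of $I$ if for every $f\in I\setminus\{0\}$ there is $g\in G$ such that $\mathrm{LM}_\sigma(g)$ divides $\mathrm{LM}_\sigma(f)$; it is *minimal* if $0\notin G$ and $\mathrm{LM}_\sigma(g)\nmid \mathrm{LM}_\sigma(h)$ for distinct $g,h\in G$. A *normal form* of $f\in P$ modulo $I$ is a polynomial $r$ with $f-r\in I$ none of whose monomials lies in $\mathrm{LM}_\sigma(I)$. Polynomials are given as lists of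 monomials (coefficient and exponent vector), in $\sigma$-decreasing order. The bit complexity of $G$ is the sum, over all monomials $a\,x_1^{e_1}\cdots x_n^{e_n}$ that occur in the elements of $G$, of $1+(\text{number of binary digits of }|a|)+e_1+\dots+e_n$. **Statement.** There is a deterministic algorithm (it uses $n$, but not $\sigma$, beyond the order in which the monomials of the input are listed), whose running time in bit operations is, for each fixed $n$, bounded by a polynomial in the bit complexity of the input $G$ that depends only on $n$, such that the following holds for every $n\ge 0$, every term ordering $\sigma$ on $\mathbb{T}^n$, every ideal $I\subseteq P$ such that $P/I$ is a finitely generated $\mathbb{Z}$-module, and every minimal strong $\sigma$-Gröbner basis $G$ of $I$. On input $n$ and $G$ the algorithm returns terms $t_1,\dots,t_k$, a list $U$ of vectors in $\mathbb{Z}^k$, and integers $c_{ij\ell}$ $(1\le i,j,\ell\le k)$ with the following properties. 1. $t_1,\dots,t_k$ are the distinct elements of $\mathbb{T}^n\setminus L$, where $L=\mathbb{T}^n\cap \mathrm{LM}_\sigma(I)$ is the set of monic leading monomials of $I$. 2. $U$ is a possible result of the following procedure. Start with $U=[\;]$ and $\mathcal{O}=\{t_1,\dots,t_k\}$. As long as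 $\mathcal{O}$ is not empty, remove some $t$ from $\mathcal{O}$; if there are integers $\ell>1$ such that $\ell s$ or $-\ell s$ is the leading monomial of an element of $G$ for some term $s$ dividing $t$, take the smallest such $\ell$ and append $c-d$ to $U$, where $c,d\in\mathbb{Z}^k$ are the coefficient vectors of $\ell t$ and of a normal form of $\ell t$ modulo $I$ with respect to $(t_1,\dots,t_k)$. 3. For all $i,j$, the polynomial $\sum_{\ell=1}^k c_{ij\ell}t_\ell$ is a normal form of $t_it_j$ modulo $I$. 4. These data are an explicit representation of $P/I$: the residue classes $\bar t_1,\dots,\bar t_k$ generate the $\mathbb{Z}$-module $P/I$; the vectors in $U$ generate the kernel of $\mathbb{Z}^k\to P/I$, $(a_1,\dots,a_k)\mapsto\sum_i a_i\bar t_i$ (so $P/I\cong\mathbb{Z}^k/\langle U\rangle$); and $\bar t_i\bar t_j=\sum_{\ell=1}^k c_{ij\ell}\bar t_\ell$ for all $i,j$. -/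

import Mathlib

open MvPolynomial

/-! ## A machine model with bit costs -/

/-- Data: binary trees whose leaves are integers. -/
inductive Val : Type
  | int : ℤ → Val
  | pair : Val → Val → Val

namespace Val

/-- Bit size: every node counts `1`, an integer leaf counts in addition its number of binary
digits. -/
def size : Val → ℕ
  | int z => 1 + Nat.size z.natAbs
  | pair a b => 1 + a.size + b.size

/-- A list as a right-nested sequence of pairs, ended by the leaf `0`. -/
def ofList : List Val → Val
  | [] => int 0
  | a :: l => pair a (ofList l)

end Val

/-- Primitive operations. Comparison and the test `isPair` return the leaf `1` (true) or `0`
(false). -/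
inductive Prim : Type
  | id
  | const (z : ℤ)
  | fst
  | snd
  | isPair
  | add
  | sub
  | mul
  | div
  | le

/-- The value of a primitive operation. An operation that is applied to data of the wrong shape
returns the leaf `0`. Division is Euclidean division of integers. -/
def Prim.eval : Prim → Val → Val
  | .id, v => v
  | .const z, _ => .int z
  | .fst, .pair a _ => a
  | .snd, .pair _ b => b
  | .isPair, .pair _ _ => .int 1
  | .add, .pair (.int a) (.int b) => .int (a + b)
  | .sub, .pair (.int a) (.int b) => .int (a - b)
  | .mul, .pair (.int a) (.int b) => .int (a * b)
  | .div, .pair (.int a) (.int b) => .int (a / b)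
  | .le, .pair (.int a) (.int b) => .int (if a ≤ b then 1 else 0)
  | _, _ => .int 0

/-- Programs: primitive operations, sequential composition, pairing, branching and while loops. -/
inductive Prog : Type
  | prim (p : Prim)
  /-- first `f`, then `g` -/
  | seq (f g : Prog)
  /-- run `f` and `g` on the same input and pair the results -/
  | pair (f g : Prog)
  /-- run `f` if the test `c` does not return the leaf `0`, otherwise `g` -/
  | ite (c f g : Prog)
  /-- repeat `f` as long as the test `c` does not return the leaf `0` -/
  | loop (c f : Prog)

/-- `Runs P x y t`: the program `P`, started on `x`, halts with result `y` after `t` bit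
operations. Each elementary step is charged with the full bit size of the data that it reads and
of the data that it writes (there is no free copying or sharing of data); the time of a run is
the sum of these charges. Up to a polynomial this is the running time of a multitape
Turing machine. -/
inductive Runs : Prog → Val → Val → ℕ → Prop
  | prim (p : Prim) (x : Val) : Runs (.prim p) x (p.eval x) (1 + x.size + (p.eval x).size)
  | seq {f g : Prog} {x y z : Val} {s t : ℕ} :
      Runs f x y s → Runs g y z t → Runs (.seq f g) x z (1 + s + t)
  | pair {f g : Prog} {x y z : Val} {s t : ℕ} :
      Runs f x y s → Runs g x z t →
      Runs (.pair f g) x (.pair y z) (1 + x.size + s + t + (Val.pair y z).size)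
  | iteTrue {c f g : Prog} {x b y : Val} {s t : ℕ} :
      Runs c x b s → b ≠ .int 0 → Runs f x y t → Runs (.ite c f g) x y (1 + x.size + s + t)
  | iteFalse {c f g : Prog} {x y : Val} {s t : ℕ} :
      Runs c x (.int 0) s → Runs g x y t → Runs (.ite c f g) x y (1 + x.size + s + t)
  | loopDone {c f : Prog} {x : Val} {s : ℕ} :
      Runs c x (.int 0) s → Runs (.loop c f) x x (1 + x.size + s)
  | loopStep {c f : Prog} {x b y z : Val} {s t u : ℕ} :
      Runs c x b s → b ≠ .int 0 → Runs f x y t → Runs (.loop c f) y z u →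
      Runs (.loop c f) x z (1 + x.size + s + t + u)

/-! ## Encoding of the input and the output -/

/-- The term `x₁^e₁ ⋯ xₙ^eₙ` as the list of its exponents. -/
def encTerm {n : ℕ} (e : Fin n →₀ ℕ) : Val :=
  .ofList (List.ofFn fun i => .int (e i))

/-- An integer vector as the list of its entries. -/
def encVec {k : ℕ} (v : Fin k → ℤ) : Val :=
  .ofList (List.ofFn fun i => .int (v i))

/-- The terms in the support of a polynomial, in decreasing order. -/
noncomputable def sortedTerms {n : ℕ} (m : MonomialOrder (Fin n)) (f : MvPolynomial (Fin n) ℤ) :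
    List (Fin n →₀ ℕ) :=
  ((f.support.map m.toSyn.toEquiv.toEmbedding).sort (· ≥ ·)).map m.toSyn.symm

/-- A polynomial as the list of its monomials (pairs of a coefficient and a term), the leading
monomial first. -/
noncomputable def encPoly {n : ℕ} (m : MonomialOrder (Fin n)) (f : MvPolynomial (Fin n) ℤ) :
    Val :=
  .ofList ((sortedTerms m f).map fun e => .pair (.int (f.coeff e)) (encTerm e))

/-- The input: the number of indeterminates and the list of polynomials. -/
noncomputable def encInput {n : ℕ} (m : MonomialOrder (Fin n))
    (G : List (MvPolynomial (Fin n) ℤ)) : Val :=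
  .pair (.int n) (.ofList (G.map (encPoly m)))

/-- The output: terms `t₁, …, tₖ`, a list of relation vectors, and structure constants. -/
def encOutput {n k : ℕ} (t : Fin k → (Fin n →₀ ℕ)) (U : List (Fin k → ℤ))
    (c : Fin k → Fin k → Fin k → ℤ) : Val :=
  .pair (.ofList (List.ofFn fun i => encTerm (t i)))
    (.pair (.ofList (U.map encVec))
      (.ofList (List.ofFn fun i => .ofList (List.ofFn fun j => encVec (c i j)))))

/-- The bit complexity of a list of polynomials: every monomial contributes the number of binary
digits of its coefficient, its degree, and `1`. -/
noncomputable def bitComplexity {n : ℕ} (G : List (MvPolynomial (Fin n) ℤ)) : ℕ :=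
  (G.map fun f => ∑ e ∈ f.support, (1 + Nat.size (f.coeff e).natAbs + ∑ i, e i)).sum

/-! ## Strong Gröbner bases over the integers

Terms are power products of the indeterminates, given by their exponent vectors. A monomial is an
integer times a term, and the leading monomial of a polynomial `f` includes the leading
coefficient: in Mathlib it is called `m.leadingTerm f`. -/

/-- `LM(I)`: the leading monomials of the nonzero elements of `I`. -/
def leadingMonomials {n : ℕ} (m : MonomialOrder (Fin n)) (I : Ideal (MvPolynomial (Fin n) ℤ)) :
    Set (MvPolynomial (Fin n) ℤ) :=
  {q | ∃ f ∈ I, f ≠ 0 ∧ m.leadingTerm f = q}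

/-- `L`: the terms that are (monic) leading monomials of `I`. -/
def monicLeadingTerms {n : ℕ} (m : MonomialOrder (Fin n)) (I : Ideal (MvPolynomial (Fin n) ℤ)) :
    Set (Fin n →₀ ℕ) :=
  {e | monomial e (1 : ℤ) ∈ leadingMonomials m I}

/-- `G` is a strong Gröbner basis of `I`: it lies in `I`, and the leading monomial of each nonzero
element of `I` is a multiple of the leading monomial of an element of `G`. -/
def IsStrongGroebnerBasis {n : ℕ} (m : MonomialOrder (Fin n))
    (I : Ideal (MvPolynomial (Fin n) ℤ)) (G : List (MvPolynomial (Fin n) ℤ)) : Prop :=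
  (∀ g ∈ G, g ∈ I) ∧ ∀ f ∈ I, f ≠ 0 → ∃ g ∈ G, m.leadingTerm g ∣ m.leadingTerm f

/-- A minimal strong Gröbner basis: its elements are nonzero, and none of their leading monomials
divides another one. -/
def IsMinimalStrongGroebnerBasis {n : ℕ} (m : MonomialOrder (Fin n))
    (I : Ideal (MvPolynomial (Fin n) ℤ)) (G : List (MvPolynomial (Fin n) ℤ)) : Prop :=
  IsStrongGroebnerBasis m I G ∧ (∀ g ∈ G, g ≠ 0) ∧
    G.Pairwise fun g h => ¬ m.leadingTerm g ∣ m.leadingTerm h ∧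
      ¬ m.leadingTerm h ∣ m.leadingTerm g

/-- `r` is a normal form of `f` modulo `I`: it is congruent to `f`, and none of its monomials is
a leading monomial of `I`. -/
def IsNormalForm {n : ℕ} (m : MonomialOrder (Fin n)) (I : Ideal (MvPolynomial (Fin n) ℤ))
    (f r : MvPolynomial (Fin n) ℤ) : Prop :=
  f - r ∈ I ∧ ∀ e ∈ r.support, monomial e (r.coeff e) ∉ leadingMonomials m I

/-- The polynomial `d₁ t₁ + ⋯ + dₖ tₖ`. -/
noncomputable def combination {n k : ℕ} (t : Fin k → (Fin n →₀ ℕ)) (d : Fin k → ℤ) :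
    MvPolynomial (Fin n) ℤ :=
  ∑ i, monomial (t i) (d i)

/-- The integers `ℓ > 1` such that `ℓ s` is, up to sign, the leading monomial of an element of `G`
for a term `s` that divides the term `e`. -/
def torsionCoefficients {n : ℕ} (m : MonomialOrder (Fin n)) (G : List (MvPolynomial (Fin n) ℤ))
    (e : Fin n →₀ ℕ) : Set ℤ :=
  {l | 1 < l ∧ ∃ g ∈ G, m.degree g ≤ e ∧ |m.leadingCoeff g| = l}

/-- `ModulePresentationRun m I G t O U`: the following procedure, started with the set `O` of
(indices of) terms, can return the list `U`. As long as `O` is not empty, remove some `i` from `O`;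
if there is a smallest integer `ℓ > 1` such that `ℓ s` is the leading monomial of an element of `G`
for some term `s` dividing `tᵢ`, append to `U` the vector `c - d`, where `c` represents `ℓ tᵢ` and
`d` represents a normal form of `ℓ tᵢ` with respect to `t₁, …, tₖ`. -/
inductive ModulePresentationRun {n k : ℕ} (m : MonomialOrder (Fin n))
    (I : Ideal (MvPolynomial (Fin n) ℤ)) (G : List (MvPolynomial (Fin n) ℤ))
    (t : Fin k → (Fin n →₀ ℕ)) : Finset (Fin k) → List (Fin k → ℤ) → Prop
  | done : ModulePresentationRun m I G t ∅ []
  | skip {i : Fin k} {O : Finset (Fin k)} {U : List (Fin k → ℤ)} :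
      i ∈ O → torsionCoefficients m G (t i) = ∅ →
      ModulePresentationRun m I G t (O.erase i) U →
      ModulePresentationRun m I G t O U
  | append {i : Fin k} {O : Finset (Fin k)} {U : List (Fin k → ℤ)} {l : ℤ} {d : Fin k → ℤ} :
      i ∈ O → IsLeast (torsionCoefficients m G (t i)) l →
      IsNormalForm m I (monomial (t i) l) (combination t d) →
      ModulePresentationRun m I G t (O.erase i) U →
      ModulePresentationRun m I G t O ((Pi.single i l - d) :: U)

/-! ## Explicitly given algebras -/

/-- An explicit representation of a ring `R`, as an algebra over the integers: generators
`g₁, …, gₖ` of the additive group, a list of vectors that generates their module of linear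
relations, and structure constants `c` with `gᵢ gⱼ = ∑ₗ cᵢⱼₗ gₗ`. -/
structure IsExplicitRepresentation {R : Type*} [CommRing R] {k : ℕ} (g : Fin k → R)
    (U : List (Fin k → ℤ)) (c : Fin k → Fin k → Fin k → ℤ) : Prop where
  generators : Submodule.span ℤ (Set.range g) = ⊤
  relations : Submodule.span ℤ {u | u ∈ U} = LinearMap.ker (Fintype.linearCombination ℤ g)
  products : ∀ i j, g i * g j = ∑ l, c i j l • g l

namespace PolyTime

/-! ## Polynomial bounds -/

/-- Instances of a problem, with a parameter that is considered fixed and with a length. -/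
class Scale (α : Type) where
  par : α → ℕ
  len : α → ℕ

variable {α β γ τ σ : Type} [Scale α] [Scale β]

instance {P : α × γ → Prop} : Scale {p : α × γ // P p} where
  par p := Scale.par p.1.1
  len p := Scale.len p.1.1

/-- For each value of the parameter, `f` is bounded by a polynomial in the length. -/
def PolyBdd (f : α → ℕ) : Prop :=
  ∀ n, ∃ c, ∀ a, Scale.par a = n → f a ≤ (Scale.len a + 2) ^ c

/-- The map `π` preserves parameter and length. -/
structure Over (π : β → α) : Prop where
  par : ∀ b, Scale.par (π b) = Scale.par b
  len : ∀ b, Scale.len (π b) = Scale.len b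

namespace PolyBdd

theorem mono {f g : α → ℕ} (hg : PolyBdd g) (h : ∀ a, f a ≤ g a) : PolyBdd f := fun n => by
  obtain ⟨c, hc⟩ := hg n
  exact ⟨c, fun a ha => (h a).trans (hc a ha)⟩

theorem of_par (f : ℕ → ℕ) : PolyBdd fun a : α => f (Scale.par a) := fun n =>
  ⟨f n, fun a ha => by
    subst ha
    exact (Nat.lt_two_pow_self).le.trans (Nat.pow_le_pow_left (by omega) _)⟩

theorem const (k : ℕ) : PolyBdd fun _ : α => k := of_par fun _ => k

theorem len : PolyBdd fun a : α => Scale.len a := fun _ => ⟨1, fun a _ => by simp⟩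

theorem add {f g : α → ℕ} (hf : PolyBdd f) (hg : PolyBdd g) : PolyBdd fun a => f a + g a :=
  fun n => by
    obtain ⟨c, hc⟩ := hf n
    obtain ⟨d, hd⟩ := hg n
    refine ⟨c + d + 1, fun a ha => ?_⟩
    have h1 : (Scale.len a + 2) ^ c ≤ (Scale.len a + 2) ^ (c + d) :=
      Nat.pow_le_pow_right (by omega) (by omega)
    have h2 : (Scale.len a + 2) ^ d ≤ (Scale.len a + 2) ^ (c + d) :=
      Nat.pow_le_pow_right (by omega) (by omega)
    have h3 := hc a ha
    have h4 := hd a ha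
    rw [pow_succ]
    nlinarith

theorem mul {f g : α → ℕ} (hf : PolyBdd f) (hg : PolyBdd g) : PolyBdd fun a => f a * g a :=
  fun n => by
    obtain ⟨c, hc⟩ := hf n
    obtain ⟨d, hd⟩ := hg n
    refine ⟨c + d, fun a ha => ?_⟩
    rw [pow_add]
    exact Nat.mul_le_mul (hc a ha) (hd a ha)

theorem pow {f : α → ℕ} (hf : PolyBdd f) (g : ℕ → ℕ) :
    PolyBdd fun a => f a ^ g (Scale.par a) := fun n => by
  obtain ⟨c, hc⟩ := hf n
  refine ⟨c * g n, fun a ha => ?_⟩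
  subst ha
  rw [pow_mul]
  exact Nat.pow_le_pow_left (hc a rfl) _

theorem pull {f : α → ℕ} (hf : PolyBdd f) {π : β → α} (hπ : Over π) :
    PolyBdd fun b => f (π b) := fun n => by
  obtain ⟨c, hc⟩ := hf n
  refine ⟨c, fun b hb => ?_⟩
  have := hc (π b) (by rw [hπ.par, hb])
  rwa [hπ.len] at this

theorem uniform {f : β → ℕ} (hf : PolyBdd f) {π : β → α} (hπ : Over π) :
    ∃ T : α → ℕ, PolyBdd T ∧ ∀ b, f b ≤ T (π b) := by
  choose c hc using hf
  refine ⟨fun a => (Scale.len a + 2) ^ c (Scale.par a), fun n => ⟨c n, fun a ha => ?_⟩,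
    fun b => ?_⟩
  · subst ha
    exact le_rfl
  · dsimp only
    rw [hπ.len, hπ.par]
    exact hc _ b rfl

end PolyBdd

/-! ## Sizes -/

theorem natSize_add_le (a b : ℕ) : Nat.size (a + b) ≤ Nat.size a + Nat.size b := by
  rcases Nat.eq_zero_or_pos a with rfl | ha
  · simp
  rcases Nat.eq_zero_or_pos b with rfl | hb
  · simp
  rw [Nat.size_le]
  have h1 := Nat.lt_size_self a
  have h2 := Nat.lt_size_self b
  rw [pow_add]
  nlinarith

theorem natSize_mul_le (a b : ℕ) : Nat.size (a * b) ≤ Nat.size a + Nat.size b := by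
  rw [Nat.size_le, pow_add]
  exact Nat.mul_lt_mul'' (Nat.lt_size_self a) (Nat.lt_size_self b)

theorem natSize_le_self (a : ℕ) : Nat.size a ≤ a := by
  rw [Nat.size_le]
  exact Nat.lt_two_pow_self

theorem Prim.exists_size_eval_le (p : Prim) : ∃ c, ∀ v, (p.eval v).size ≤ v.size + c := by
  have h0 : (Val.int 0).size = 1 := by simp [Val.size]
  have h1 : (Val.int 1).size = 2 := by simp [Val.size]
  have hpos : ∀ v : Val, 1 ≤ v.size := fun v => by cases v <;> simp [Val.size, add_assoc]
  have hadd : ∀ a b : ℤ, Nat.size (a + b).natAbs ≤ Nat.size a.natAbs + Nat.size b.natAbs :=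
    fun a b => (Nat.size_le_size (Int.natAbs_add_le a b)).trans (natSize_add_le _ _)
  cases p with
  | id => exact ⟨0, fun v => le_rfl⟩
  | const z => exact ⟨(Val.int z).size, fun v => by simp [Prim.eval]⟩
  | fst =>
    refine ⟨1, fun v => ?_⟩
    rcases v with _ | ⟨a, b⟩ <;> simp only [Prim.eval, h0, Val.size] <;> omega
  | snd =>
    refine ⟨1, fun v => ?_⟩
    rcases v with _ | ⟨a, b⟩ <;> simp only [Prim.eval, h0, Val.size] <;> omega
  | isPair =>
    refine ⟨2, fun v => ?_⟩
    rcases v with _ | ⟨a, b⟩ <;> simp only [Prim.eval, h0, h1, Val.size] <;> omega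
  | add =>
    refine ⟨1, fun v => ?_⟩
    rcases v with _ | ⟨_ | _, _ | _⟩ <;> simp only [Prim.eval, h0, Val.size] <;> try omega
    rename_i a b
    have := hadd a b
    omega
  | sub =>
    refine ⟨1, fun v => ?_⟩
    rcases v with _ | ⟨_ | _, _ | _⟩ <;> simp only [Prim.eval, h0, Val.size] <;> try omega
    rename_i a b
    have := hadd a (-b)
    rw [Int.natAbs_neg, ← sub_eq_add_neg] at this
    omega
  | mul =>
    refine ⟨1, fun v => ?_⟩
    rcases v with _ | ⟨_ | _, _ | _⟩ <;> simp only [Prim.eval, h0, Val.size] <;> try omega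
    rename_i a b
    have := natSize_mul_le a.natAbs b.natAbs
    rw [Int.natAbs_mul]
    omega
  | div =>
    refine ⟨1, fun v => ?_⟩
    rcases v with _ | ⟨_ | _, _ | _⟩ <;> simp only [Prim.eval, h0, Val.size] <;> try omega
    rename_i a b
    have := Nat.size_le_size (Int.natAbs_ediv_le_natAbs a b)
    omega
  | le =>
    refine ⟨2, fun v => ?_⟩
    rcases v with _ | ⟨_ | _, _ | _⟩ <;> simp only [Prim.eval, h0, Val.size] <;> try omega
    split_ifs <;> simp

theorem Runs.size_le {P : Prog} {x y : Val} {t : ℕ} (h : Runs P x y t) :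
    x.size ≤ t ∧ y.size ≤ t := by
  induction h with
  | pair _ _ ih₁ ih₂ => exact ⟨by omega, by omega⟩
  | _ => omega

/-! ## Encodings -/

/-- Types whose elements are represented by data of the machine. -/
class Enc (τ : Type) where
  enc : τ → Val

open Enc (enc)

instance : Enc Val := ⟨fun v => v⟩
instance : Enc ℤ := ⟨Val.int⟩
instance : Enc ℕ := ⟨fun k => Val.int k⟩
instance : Enc Bool := ⟨fun b => Val.int (if b then 1 else 0)⟩
instance [Enc τ] [Enc σ] : Enc (τ × σ) := ⟨fun p => Val.pair (enc p.1) (enc p.2)⟩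
instance [Enc τ] : Enc (List τ) := ⟨fun l => Val.ofList (l.map enc)⟩

end PolyTime


namespace PolyTime
open Enc (enc)
variable {α β γ τ σ : Type} [Scale α] [Scale β] [Enc τ] [Enc σ]

/-! ## Polynomial time computability in context -/

/-- One program computes `y a` from the environment `e a`, in polynomial time for each value of the
parameter. -/
def PTime (e : α → Val) (y : α → τ) : Prop :=
  ∃ (P : Prog) (T : α → ℕ), PolyBdd T ∧ ∀ a, ∃ t ≤ T a, Runs P (e a) (enc (y a)) t

/-- The environment `env` refines the environment `e`, along a map of index types. -/
structure Sub (env : β → Val) (e : α → Val) (π : β → α) : Prop where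
  map : Over π
  time : PTime env fun b => e (π b)

variable {e : α → Val}

theorem enc_val (v : Val) : enc v = v := rfl

namespace PTime

theorem size_env {y : α → τ} (h : PTime e y) : PolyBdd fun a => (e a).size := by
  obtain ⟨P, T, hT, h⟩ := h
  exact hT.mono fun a => by
    obtain ⟨t, ht, hr⟩ := h a
    exact (Runs.size_le hr).1.trans ht

theorem size {y : α → τ} (h : PTime e y) : PolyBdd fun a => (enc (y a)).size := by
  obtain ⟨P, T, hT, h⟩ := h
  exact hT.mono fun a => by
    obtain ⟨t, ht, hr⟩ := h a
    exact (Runs.size_le hr).2.trans ht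

theorem congr_enc {τ' : Type} [Enc τ'] {y : α → τ} {y' : α → τ'} (h : PTime e y)
    (hy : ∀ a, enc (y' a) = enc (y a)) : PTime e y' := by
  obtain ⟨P, T, hT, h⟩ := h
  exact ⟨P, T, hT, fun a => by rw [hy]; exact h a⟩

theorem congr {y y' : α → τ} (h : PTime e y) (hy : ∀ a, y' a = y a) : PTime e y' :=
  h.congr_enc fun a => by rw [hy]

theorem comp {x : α → Val} {y : α → τ} (hx : PTime e x) (hy : PTime x y) : PTime e y := by
  obtain ⟨P, T, hT, h⟩ := hx
  obtain ⟨Q, S, hS, h'⟩ := hy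
  refine ⟨.seq P Q, fun a => 1 + T a + S a, ((PolyBdd.const 1).add hT).add hS, fun a => ?_⟩
  obtain ⟨t, ht, hr⟩ := h a
  obtain ⟨s, hs, hr'⟩ := h' a
  exact ⟨1 + t + s, by dsimp only; omega, .seq hr hr'⟩

theorem pull {y : α → τ} (h : PTime e y) {π : β → α} (hπ : Over π) :
    PTime (fun b => e (π b)) fun b => y (π b) := by
  obtain ⟨P, T, hT, h⟩ := h
  exact ⟨P, fun b => T (π b), hT.pull hπ, fun b => h (π b)⟩

theorem at' {y : α → τ} (h : PTime e y) {env : β → Val} {π : β → α} (hs : Sub env e π) :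
    PTime env fun b => y (π b) :=
  hs.time.comp (h.pull hs.map)

theorem prim_env (p : Prim) (he : PolyBdd fun a => (e a).size) :
    PTime e fun a => p.eval (e a) := by
  obtain ⟨c, hc⟩ := Prim.exists_size_eval_le p
  refine ⟨.prim p, fun a => 1 + (e a).size + ((e a).size + c),
    ((PolyBdd.const 1).add he).add (he.add (PolyBdd.const c)), fun a =>
    ⟨1 + (e a).size + (p.eval (e a)).size, ?_, .prim p (e a)⟩⟩
  have := hc (e a)
  dsimp only
  omega

theorem env (he : PolyBdd fun a => (e a).size) : PTime e e :=
  (prim_env .id he).congr fun _ => rfl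

theorem prim {y : α → τ} (p : Prim) (h : PTime e y) : PTime e fun a => p.eval (enc (y a)) :=
  PTime.comp (x := fun a => enc (y a)) (h.congr_enc fun _ => rfl) (prim_env p h.size)

theorem const_int (z : ℤ) (he : PolyBdd fun a => (e a).size) : PTime e fun _ => z :=
  (prim_env (.const z) he).congr_enc fun _ => rfl

theorem pair {y : α → τ} {z : α → σ} (hy : PTime e y) (hz : PTime e z) :
    PTime e fun a => (y a, z a) := by
  have he := hy.size_env
  have hsy := hy.size
  have hsz := hz.size
  obtain ⟨P, T, hT, h⟩ := hy
  obtain ⟨Q, S, hS, h'⟩ := hz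
  refine ⟨.pair P Q, fun a => 1 + (e a).size + T a + S a +
    (1 + (enc (y a)).size + (enc (z a)).size),
    ((((PolyBdd.const 1).add he).add hT).add hS).add (((PolyBdd.const 1).add hsy).add hsz),
    fun a => ?_⟩
  obtain ⟨t, ht, hr⟩ := h a
  obtain ⟨s, hs, hr'⟩ := h' a
  refine ⟨_, ?_, .pair hr hr'⟩
  simp only [Val.size]
  omega

theorem fst {y : α → τ × σ} (h : PTime e y) : PTime e fun a => (y a).1 :=
  (h.prim .fst).congr_enc fun _ => rfl

theorem snd {y : α → τ × σ} (h : PTime e y) : PTime e fun a => (y a).2 :=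
  (h.prim .snd).congr_enc fun _ => rfl

/-- Branching, where each branch has to be computable only on its own instances. -/
theorem ite' {b : α → Bool} {y z : α → τ} (hb : PTime e b)
    (hy : ∀ (β : Type) [Scale β] (env : β → Val) (π : β → α), Sub env e π →
      (∀ x, b (π x) = true) → PTime env fun x => y (π x))
    (hz : ∀ (β : Type) [Scale β] (env : β → Val) (π : β → α), Sub env e π →
      (∀ x, b (π x) = false) → PTime env fun x => z (π x)) :
    PTime e fun a => if b a then y a else z a := by
  have he := hb.size_env
  let β₁ := {p : α × Unit // b p.1 = true}
  let β₂ := {p : α × Unit // b p.1 = false}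
  have o₁ : Over (fun p : β₁ => p.1.1) := ⟨fun _ => rfl, fun _ => rfl⟩
  have o₂ : Over (fun p : β₂ => p.1.1) := ⟨fun _ => rfl, fun _ => rfl⟩
  have hy := hy β₁ (fun p => e p.1.1) (fun p => p.1.1) ⟨o₁, (env he).pull o₁⟩ fun x => x.2
  have hz := hz β₂ (fun p => e p.1.1) (fun p => p.1.1) ⟨o₂, (env he).pull o₂⟩ fun x => x.2
  obtain ⟨C, T, hT, h⟩ := hb
  obtain ⟨P, T₁, hT₁, h₁⟩ := hy
  obtain ⟨Q, T₂, hT₂, h₂⟩ := hz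
  obtain ⟨S₁, hS₁, hb₁⟩ := hT₁.uniform o₁
  obtain ⟨S₂, hS₂, hb₂⟩ := hT₂.uniform o₂
  refine ⟨.ite C P Q, fun a => 1 + (e a).size + T a + (S₁ a + S₂ a),
    (((PolyBdd.const 1).add he).add hT).add (hS₁.add hS₂), fun a => ?_⟩
  obtain ⟨t, ht, hr⟩ := h a
  cases hba : b a with
  | true =>
    obtain ⟨s, hs, hr'⟩ := h₁ ⟨(a, ()), hba⟩
    have := hb₁ ⟨(a, ()), hba⟩
    simp only [hba, if_true]
    refine ⟨_, ?_, .iteTrue hr ?_ hr'⟩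
    · dsimp only at this
      omega
    · simp [enc, hba]
  | false =>
    obtain ⟨s, hs, hr'⟩ := h₂ ⟨(a, ()), hba⟩
    have := hb₂ ⟨(a, ()), hba⟩
    rw [hba] at hr
    simp only [hba, Bool.false_eq_true, if_false]
    refine ⟨_, ?_, .iteFalse hr hr'⟩
    dsimp only at this
    omega

theorem ite {b : α → Bool} {y z : α → τ} (hb : PTime e b) (hy : PTime e y) (hz : PTime e z) :
    PTime e fun a => if b a then y a else z a :=
  hb.ite' (fun _ _ _ _ h _ => hy.at' h) fun _ _ _ _ h _ => hz.at' h

end PTime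

theorem runs_loop {c f : Prog} (s : ℕ → Val) (N T : ℕ)
    (hc : ∀ i < N, ∃ b, ∃ t ≤ T, b ≠ .int 0 ∧ Runs c (s i) b t)
    (hf : ∀ i < N, ∃ t ≤ T, Runs f (s i) (s (i + 1)) t)
    (hend : ∃ t ≤ T, Runs c (s N) (.int 0) t) (hs : ∀ i ≤ N, (s i).size ≤ T) :
    ∃ t ≤ (N + 1) * (1 + 3 * T), Runs (.loop c f) (s 0) (s N) t := by
  suffices ∀ j ≤ N, ∃ t ≤ (j + 1) * (1 + 3 * T), Runs (.loop c f) (s (N - j)) (s N) t by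
    simpa using this N le_rfl
  intro j
  induction j with
  | zero =>
    intro _
    obtain ⟨t, ht, hr⟩ := hend
    have := hs N le_rfl
    exact ⟨1 + (s N).size + t, by omega, .loopDone hr⟩
  | succ j ih =>
    intro hj
    obtain ⟨u, hu, hru⟩ := ih (by omega)
    obtain ⟨b, t, ht, hb, hr⟩ := hc (N - (j + 1)) (by omega)
    obtain ⟨t', ht', hr'⟩ := hf (N - (j + 1)) (by omega)
    have h := hs (N - (j + 1)) (by omega)
    rw [show N - (j + 1) + 1 = N - j by omega] at hr'
    refine ⟨_, ?_, .loopStep hr hb hr' hru⟩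
    rw [add_mul, one_mul (1 + 3 * T)]
    omega

namespace PTime

/-- A loop that runs through the states `s a 0, …, s a (N a)`. -/
theorem loop {N : α → ℕ} {s : α → ℕ → Val} (hN : PolyBdd N) (h0 : PTime e fun a => s a 0)
    (hsz : PolyBdd fun p : {p : α × ℕ // p.2 ≤ N p.1} => (s p.1.1 p.1.2).size)
    (hc : ∀ (β : Type) [Scale β] (π : β → α) (i : β → ℕ), Over π → (∀ b, i b ≤ N (π b)) →
      PTime (fun b => s (π b) (i b)) (fun b => s (π b) (i b)) →
      PTime (fun b => s (π b) (i b)) fun b => decide (i b < N (π b)))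
    (hf : ∀ (β : Type) [Scale β] (π : β → α) (i : β → ℕ), Over π → (∀ b, i b < N (π b)) →
      PTime (fun b => s (π b) (i b)) (fun b => s (π b) (i b)) →
      PTime (fun b => s (π b) (i b)) fun b => s (π b) (i b + 1)) :
    PTime e fun a => s a (N a) := by
  let β₁ := {p : α × ℕ // p.2 ≤ N p.1}
  let β₂ := {p : α × ℕ // p.2 < N p.1}
  have o₁ : Over (fun p : β₁ => p.1.1) := ⟨fun _ => rfl, fun _ => rfl⟩
  have o₂ : Over (fun p : β₂ => p.1.1) := ⟨fun _ => rfl, fun _ => rfl⟩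
  have o₁₂ : Over (fun p : β₂ => (⟨p.1, p.2.le⟩ : β₁)) := ⟨fun _ => rfl, fun _ => rfl⟩
  have hc := hc β₁ (fun p => p.1.1) (fun p => p.1.2) o₁ (fun p => p.2) (env hsz)
  have hf := hf β₂ (fun p => p.1.1) (fun p => p.1.2) o₂ (fun p => p.2) (env (hsz.pull o₁₂))
  refine h0.comp ?_
  obtain ⟨C, T₁, hT₁, h₁⟩ := hc
  obtain ⟨P, T₂, hT₂, h₂⟩ := hf
  obtain ⟨S₁, hS₁, hb₁⟩ := hT₁.uniform o₁
  obtain ⟨S₂, hS₂, hb₂⟩ := hT₂.uniform o₂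
  obtain ⟨S₃, hS₃, hb₃⟩ := hsz.uniform o₁
  refine ⟨.loop C P, fun a => (N a + 1) * (1 + 3 * (S₁ a + S₂ a + S₃ a)),
    (hN.add (PolyBdd.const 1)).mul ((PolyBdd.const 1).add
      ((PolyBdd.const 3).mul ((hS₁.add hS₂).add hS₃))), fun a => ?_⟩
  refine runs_loop (s a) (N a) _ (fun i hi => ?_) (fun i hi => ?_) ?_ (fun i hi => ?_)
  · obtain ⟨t, ht, hr⟩ := h₁ ⟨(a, i), hi.le⟩
    have := hb₁ ⟨(a, i), hi.le⟩
    refine ⟨_, t, ?_, ?_, hr⟩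
    · dsimp only at this
      omega
    · simp [enc, hi]
  · obtain ⟨t, ht, hr⟩ := h₂ ⟨(a, i), hi⟩
    have := hb₂ ⟨(a, i), hi⟩
    refine ⟨t, ?_, hr⟩
    dsimp only at this
    omega
  · obtain ⟨t, ht, hr⟩ := h₁ ⟨(a, N a), le_rfl⟩
    have := hb₁ ⟨(a, N a), le_rfl⟩
    refine ⟨t, ?_, ?_⟩
    · dsimp only at this
      omega
    · simpa [enc] using hr
  · have := hb₃ ⟨(a, i), hi⟩
    dsimp only at this
    omega

/-! ### Arithmetic and Boolean operations -/

theorem natCast {x : α → ℕ} (h : PTime e x) : PTime e fun a => (x a : ℤ) :=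
  h.congr_enc fun _ => rfl

theorem const_nat (k : ℕ) (he : PolyBdd fun a => (e a).size) : PTime e fun _ => k :=
  (const_int k he).congr_enc fun _ => rfl

theorem const_bool (b : Bool) (he : PolyBdd fun a => (e a).size) : PTime e fun _ => b :=
  (const_int (if b then 1 else 0) he).congr_enc fun _ => rfl

theorem add {x y : α → ℤ} (hx : PTime e x) (hy : PTime e y) : PTime e fun a => x a + y a :=
  ((hx.pair hy).prim .add).congr_enc fun _ => rfl

theorem sub {x y : α → ℤ} (hx : PTime e x) (hy : PTime e y) : PTime e fun a => x a - y a :=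
  ((hx.pair hy).prim .sub).congr_enc fun _ => rfl

theorem mul {x y : α → ℤ} (hx : PTime e x) (hy : PTime e y) : PTime e fun a => x a * y a :=
  ((hx.pair hy).prim .mul).congr_enc fun _ => rfl

theorem div {x y : α → ℤ} (hx : PTime e x) (hy : PTime e y) : PTime e fun a => x a / y a :=
  ((hx.pair hy).prim .div).congr_enc fun _ => rfl

theorem neg {x : α → ℤ} (hx : PTime e x) : PTime e fun a => -x a :=
  ((const_int 0 hx.size_env).sub hx).congr fun _ => by simp

theorem le {x y : α → ℤ} (hx : PTime e x) (hy : PTime e y) :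
    PTime e fun a => decide (x a ≤ y a) :=
  ((hx.pair hy).prim .le).congr_enc fun _ => by simp [enc, Prim.eval]

theorem and {b c : α → Bool} (hb : PTime e b) (hc : PTime e c) : PTime e fun a => b a && c a :=
  (hb.ite hc (const_bool false hb.size_env)).congr fun a => by cases b a <;> simp

theorem or {b c : α → Bool} (hb : PTime e b) (hc : PTime e c) : PTime e fun a => b a || c a :=
  (hb.ite (const_bool true hb.size_env) hc).congr fun a => by cases b a <;> simp

theorem not {b : α → Bool} (hb : PTime e b) : PTime e fun a => !b a :=
  (hb.ite (const_bool false hb.size_env) (const_bool true hb.size_env)).congr fun a => by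
    cases b a <;> simp

theorem eq {x y : α → ℤ} (hx : PTime e x) (hy : PTime e y) :
    PTime e fun a => decide (x a = y a) :=
  ((hx.le hy).and (hy.le hx)).congr fun a => by
    rw [← Bool.decide_and]
    exact decide_eq_decide.2 le_antisymm_iff

theorem lt {x y : α → ℤ} (hx : PTime e x) (hy : PTime e y) :
    PTime e fun a => decide (x a < y a) :=
  (hy.le hx).not.congr fun a => by
    rw [← decide_not]
    exact decide_eq_decide.2 not_le.symm

theorem abs {x : α → ℤ} (hx : PTime e x) : PTime e fun a => |x a| :=
  (((const_int 0 hx.size_env).le hx).ite hx hx.neg).congr fun a => by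
    by_cases h : 0 ≤ x a
    · simp [h, abs_of_nonneg]
    · simp [h, abs_of_neg (not_le.1 h)]

theorem nat_le {x y : α → ℕ} (hx : PTime e x) (hy : PTime e y) :
    PTime e fun a => decide (x a ≤ y a) :=
  (hx.natCast.le hy.natCast).congr fun a => by simp

theorem nat_add {x y : α → ℕ} (hx : PTime e x) (hy : PTime e y) : PTime e fun a => x a + y a :=
  (hx.natCast.add hy.natCast).congr_enc fun a => by simp [enc]

theorem nat_mul {x y : α → ℕ} (hx : PTime e x) (hy : PTime e y) : PTime e fun a => x a * y a :=
  (hx.natCast.mul hy.natCast).congr_enc fun a => by simp [enc]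

theorem nat_sub {x y : α → ℕ} (hx : PTime e x) (hy : PTime e y) : PTime e fun a => x a - y a :=
  ((hx.natCast.le hy.natCast).ite (const_int 0 hx.size_env)
    (hx.natCast.sub hy.natCast)).congr_enc fun a => by
    simp only [enc]
    congr 1
    split_ifs with h <;> simp at h <;> omega

end PTime
end PolyTime


namespace PolyTime
open Enc (enc)
variable {α β γ τ σ ρ : Type} [Scale α] [Scale β] [Enc τ] [Enc σ] [Enc ρ] {e : α → Val}

/-! ### Lists -/

theorem enc_nil : enc ([] : List τ) = .int 0 := rfl

theorem size_cons (x : τ) (l : List τ) :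
    (enc (x :: l)).size = 1 + (enc x).size + (enc l).size := rfl

theorem size_nil : (enc ([] : List τ)).size = 1 := by simp [enc_nil, Val.size]

theorem size_le_of_mem {x : τ} {l : List τ} (h : x ∈ l) : (enc x).size ≤ (enc l).size := by
  induction l with
  | nil => simp at h
  | cons y l ih =>
    rw [size_cons]
    rcases List.mem_cons.1 h with rfl | h
    · omega
    · have := ih h
      omega

theorem length_le_size (l : List τ) : l.length ≤ (enc l).size := by
  induction l with
  | nil => simp
  | cons y l ih =>
    rw [size_cons, List.length_cons]
    omega

theorem size_le_of_forall {l : List τ} {T : ℕ} (h : ∀ x ∈ l, (enc x).size ≤ T) :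
    (enc l).size ≤ 1 + l.length * (1 + T) := by
  induction l with
  | nil => simp [size_nil]
  | cons y l ih =>
    have h1 := ih fun x hx => h x (List.mem_cons_of_mem _ hx)
    have h2 := h y List.mem_cons_self
    rw [size_cons, List.length_cons, Nat.succ_mul]
    omega

theorem size_prod (x : τ × σ) : (enc x).size = 1 + (enc x.1).size + (enc x.2).size := rfl

theorem size_bool (b : Bool) : (enc b).size ≤ 2 := by
  cases b <;> simp [enc, Val.size]

namespace PTime

theorem nil (he : PolyBdd fun a => (e a).size) : PTime e fun _ => ([] : List τ) :=
  (const_int 0 he).congr_enc fun _ => rfl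

theorem cons {x : α → τ} {l : α → List τ} (hx : PTime e x) (hl : PTime e l) :
    PTime e fun a => x a :: l a :=
  (hx.pair hl).congr_enc fun _ => rfl

theorem tail {l : α → List τ} (hl : PTime e l) : PTime e fun a => (l a).tail :=
  (hl.prim .snd).congr_enc fun a => by rcases l a with _ | ⟨x, l⟩ <;> rfl

theorem head' {l : α → List τ} {x : α → τ} (hl : PTime e l) (h : ∀ a, (l a).head? = some (x a)) :
    PTime e x :=
  (hl.prim .fst).congr_enc fun a => by
    have := h a
    rcases hla : l a with _ | ⟨y, l⟩
    · simp [hla] at this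
    · simp only [hla, List.head?_cons, Option.some.injEq] at this
      subst this
      rfl

theorem isCons {l : α → List τ} (hl : PTime e l) : PTime e fun a => !(l a).isEmpty :=
  (hl.prim .isPair).congr_enc fun a => by rcases l a with _ | ⟨x, l⟩ <;> rfl

theorem length_bdd {l : α → List τ} (hl : PTime e l) : PolyBdd fun a => (l a).length :=
  hl.size.mono fun a => length_le_size (l a)

/-- Folding over a list, with an invariant that bounds the size of the state. -/
theorem foldl {l : α → List τ} {s₀ : α → σ} {f : α → σ → τ → σ} {T : α → ℕ} (hT : PolyBdd T)
    (Inv : α → ℕ → σ → Prop) (hl : PTime e l) (hs : PTime e s₀) (h0 : ∀ a, Inv a 0 (s₀ a))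
    (hI : ∀ a i s x, x ∈ l a → i < (l a).length → Inv a i s → Inv a (i + 1) (f a s x))
    (hsz : ∀ a i s, i ≤ (l a).length → Inv a i s → (enc s).size ≤ T a)
    (hstep : ∀ (β : Type) [Scale β] (env : β → Val) (π : β → α) (s : β → σ) (x : β → τ),
      Sub env e π → PTime env s → PTime env x → (∀ b, x b ∈ l (π b)) →
      (∀ b, ∃ i < (l (π b)).length, Inv (π b) i (s b)) →
      PTime env fun b => f (π b) (s b) (x b)) :
    PTime e fun a => (l a).foldl (f a) (s₀ a) := by
  have he := hl.size_env
  let st : α → ℕ → σ := fun a i => ((l a).take i).foldl (f a) (s₀ a)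
  have hst : ∀ a, ∀ i ≤ (l a).length, Inv a i (st a i) := by
    intro a i
    induction i with
    | zero => exact fun _ => h0 a
    | succ i ih =>
      intro hi
      have : st a (i + 1) = f a (st a i) (l a)[i] := by
        simp only [st, List.take_succ_eq_append_getElem (show i < (l a).length by omega),
          List.foldl_append, List.foldl_cons, List.foldl_nil]
      rw [this]
      exact hI a i _ _ (List.getElem_mem _) (by omega) (ih (by omega))
  have key : PTime e fun a => (e a, ((l a).drop (l a).length, st a (l a).length)) := by
    refine PTime.congr_enc (loop (N := fun a => (l a).length)
      (s := fun a i => enc (e a, ((l a).drop i, st a i))) hl.length_bdd ?_ ?_ ?_ ?_) fun _ => rfl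
    · exact ((env he).pair (hl.pair hs)).congr_enc fun _ => rfl
    · have o : Over (fun p : {p : α × ℕ // p.2 ≤ (l p.1).length} => p.1.1) :=
        ⟨fun _ => rfl, fun _ => rfl⟩
      refine ((((PolyBdd.const 2).add he).add hl.size).add hT).pull o |>.mono fun p => ?_
      have h1 : (enc ((l p.1.1).drop p.1.2)).size ≤ (enc (l p.1.1)).size := by
        generalize p.1.2 = i
        generalize l p.1.1 = m
        induction m generalizing i with
        | nil => simp
        | cons y m ih =>
          cases i with
          | zero => simp
          | succ i =>
            have := ih i
            rw [List.drop_succ_cons, size_cons]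
            omega
      have h2 := hsz _ _ _ p.2 (hst _ _ p.2)
      simp only [size_prod, enc_val] at *
      omega
    · intro β _ π i _ hi hE
      have hE : PTime (fun b => enc (e (π b), ((l (π b)).drop (i b), st (π b) (i b))))
          (fun b => (e (π b), ((l (π b)).drop (i b), st (π b) (i b)))) :=
        hE.congr_enc fun _ => rfl
      refine hE.snd.fst.isCons.congr fun b => ?_
      rw [Bool.eq_iff_iff]
      simp
    · intro β _ π i hπ hi hE
      have hE : PTime (fun b => enc (e (π b), ((l (π b)).drop (i b), st (π b) (i b))))
          (fun b => (e (π b), ((l (π b)).drop (i b), st (π b) (i b)))) :=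
        hE.congr_enc fun _ => rfl
      have hx : PTime (fun b => enc (e (π b), ((l (π b)).drop (i b), st (π b) (i b))))
          (fun b => (l (π b))[i b]'(hi b)) := hE.snd.fst.head' fun b => by simp [hi b]
      have hstep := hstep β _ π (fun b => st (π b) (i b)) (fun b => (l (π b))[i b]'(hi b))
        ⟨hπ, hE.fst⟩ hE.snd.snd hx (fun b => List.getElem_mem _)
        fun b => ⟨i b, hi b, hst _ _ (hi b).le⟩
      refine (hE.fst.pair (hE.snd.fst.tail.pair hstep)).congr_enc fun b => ?_
      have : st (π b) (i b + 1) = f (π b) (st (π b) (i b)) ((l (π b))[i b]'(hi b)) := by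
        simp only [st, List.take_succ_eq_append_getElem (hi b),
          List.foldl_append, List.foldl_cons, List.foldl_nil]
      rw [this, List.tail_drop]
      rfl
  exact key.snd.snd.congr fun a => by simp [st]

/-- Folding over a list, where each step adds a bounded amount to the size of the state. -/
theorem foldl_add {l : α → List τ} {s₀ : α → σ} {f : α → σ → τ → σ} {T : α → ℕ} (hT : PolyBdd T)
    (hl : PTime e l) (hs : PTime e s₀)
    (hadd : ∀ a s x, x ∈ l a → (enc (f a s x)).size ≤ (enc s).size + T a)
    (hstep : ∀ (β : Type) [Scale β] (env : β → Val) (π : β → α) (s : β → σ) (x : β → τ),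
      Sub env e π → PTime env s → PTime env x → (∀ b, x b ∈ l (π b)) →
      PTime env fun b => f (π b) (s b) (x b)) :
    PTime e fun a => (l a).foldl (f a) (s₀ a) :=
  foldl (T := fun a => (enc (s₀ a)).size + (l a).length * T a)
    (hs.size.add (hl.length_bdd.mul hT))
    (fun a i s => (enc s).size ≤ (enc (s₀ a)).size + i * T a) hl hs (fun a => by simp)
    (fun a i s x hx _ h => by
      have := hadd a s x hx
      rw [Nat.succ_mul]
      omega)
    (fun a i s hi h => by
      have := Nat.mul_le_mul_right (T a) hi
      omega)
    fun β _ env π s x h hs hx hm _ => hstep β env π s x h hs hx hm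

/-- A uniform bound for the size of a function that is computed on the members of a list. -/
theorem uniform_mem {l : α → List τ} {g : α → τ → σ} (hl : PTime e l)
    (hg : ∀ (β : Type) [Scale β] (env : β → Val) (π : β → α) (x : β → τ),
      Sub env e π → PTime env x → (∀ b, x b ∈ l (π b)) → PTime env fun b => g (π b) (x b)) :
    ∃ T : α → ℕ, PolyBdd T ∧ ∀ a, ∀ x ∈ l a, (enc (g a x)).size ≤ T a := by
  have he := hl.size_env
  let β := {p : α × τ // p.2 ∈ l p.1}
  have o : Over (fun p : β => p.1.1) := ⟨fun _ => rfl, fun _ => rfl⟩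
  have hE : PTime (fun p : β => enc (e p.1.1, p.1.2)) fun p : β => (e p.1.1, p.1.2) := by
    refine (env ?_).congr_enc fun _ => rfl
    refine (((PolyBdd.const 1).add he).add hl.size).pull o |>.mono fun p => ?_
    have := size_le_of_mem p.2
    simp only [size_prod, enc_val] at *
    omega
  obtain ⟨T, hT, h⟩ := (hg β _ (fun p => p.1.1) (fun p => p.1.2) ⟨o, hE.fst⟩ hE.snd
    fun p => p.2).size.uniform o
  exact ⟨T, hT, fun a x hx => h ⟨(a, x), hx⟩⟩

theorem reverse {l : α → List τ} (hl : PTime e l) : PTime e fun a => (l a).reverse :=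
  (foldl_add (f := fun _ s x => x :: s) (T := fun a => 1 + (enc (l a)).size)
    ((PolyBdd.const 1).add hl.size) hl (nil hl.size_env)
    (fun a s x hx => by
      have := size_le_of_mem hx
      rw [size_cons]
      omega)
    fun _ _ _ _ _ _ _ hs hx _ => hx.cons hs).congr fun a => by
      simp

theorem append {l l' : α → List τ} (hl : PTime e l) (hl' : PTime e l') :
    PTime e fun a => l a ++ l' a :=
  (foldl_add (f := fun _ s x => x :: s) (T := fun a => 1 + (enc (l a)).size)
    ((PolyBdd.const 1).add hl.size) hl.reverse hl'
    (fun a s x hx => by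
      have := size_le_of_mem (List.mem_reverse.1 hx)
      rw [size_cons]
      omega)
    fun _ _ _ _ _ _ _ hs hx _ => hx.cons hs).congr fun a => by
      simp

theorem map {l : α → List τ} {g : α → τ → σ} (hl : PTime e l)
    (hg : ∀ (β : Type) [Scale β] (env : β → Val) (π : β → α) (x : β → τ),
      Sub env e π → PTime env x → (∀ b, x b ∈ l (π b)) → PTime env fun b => g (π b) (x b)) :
    PTime e fun a => (l a).map (g a) := by
  obtain ⟨T, hT, h⟩ := uniform_mem hl hg
  refine (foldl_add (f := fun a s x => g a x :: s) (T := fun a => 1 + T a)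
    ((PolyBdd.const 1).add hT) hl (nil hl.size_env)
    (fun a s x hx => by
      have := h a x hx
      rw [size_cons]
      omega)
    fun β _ env π _ x hE hs hx hm => (hg β env π x hE hx hm).cons hs).reverse.congr fun a => ?_
  have : ∀ (m : List τ) (s : List σ),
      m.foldl (fun s x => g a x :: s) s = (m.map (g a)).reverse ++ s := by
    intro m
    induction m with
    | nil => simp
    | cons y m ih =>
      intro s
      simp [ih]
  simp [this]

theorem filter {l : α → List τ} {g : α → τ → Bool} (hl : PTime e l)
    (hg : ∀ (β : Type) [Scale β] (env : β → Val) (π : β → α) (x : β → τ),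
      Sub env e π → PTime env x → (∀ b, x b ∈ l (π b)) → PTime env fun b => g (π b) (x b)) :
    PTime e fun a => (l a).filter (g a) := by
  refine (foldl_add (f := fun a s x => if g a x then x :: s else s)
    (T := fun a => 1 + (enc (l a)).size)
    ((PolyBdd.const 1).add hl.size) hl (nil hl.size_env)
    (fun a s x hx => by
      have := size_le_of_mem hx
      split_ifs
      · rw [size_cons]
        omega
      · omega)
    fun β _ env π _ x hE hs hx hm =>
      (hg β env π x hE hx hm).ite (hx.cons hs) hs).reverse.congr fun a => ?_
  have : ∀ (m : List τ) (s : List τ), m.foldl (fun s x => if g a x then x :: s else s) s =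
      (m.filter (g a)).reverse ++ s := by
    intro m
    induction m with
    | nil => simp
    | cons y m ih =>
      intro s
      by_cases h : g a y <;> simp [ih, h]
  simp [this]

theorem all {l : α → List τ} {g : α → τ → Bool} (hl : PTime e l)
    (hg : ∀ (β : Type) [Scale β] (env : β → Val) (π : β → α) (x : β → τ),
      Sub env e π → PTime env x → (∀ b, x b ∈ l (π b)) → PTime env fun b => g (π b) (x b)) :
    PTime e fun a => (l a).all (g a) := by
  refine (foldl_add (f := fun a s x => s && g a x) (T := fun _ => 2) (PolyBdd.const 2) hl
    (const_bool true hl.size_env) (fun a s x _ => (size_bool _).trans (by omega))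
    fun β _ env π _ x hE hs hx hm => hs.and (hg β env π x hE hx hm)).congr fun a => ?_
  have : ∀ (m : List τ) (s : Bool), m.foldl (fun s x => s && g a x) s = (s && m.all (g a)) := by
    intro m
    induction m with
    | nil => simp
    | cons y m ih =>
      intro s
      simp [ih, Bool.and_assoc]
  simp [this]

theorem any {l : α → List τ} {g : α → τ → Bool} (hl : PTime e l)
    (hg : ∀ (β : Type) [Scale β] (env : β → Val) (π : β → α) (x : β → τ),
      Sub env e π → PTime env x → (∀ b, x b ∈ l (π b)) → PTime env fun b => g (π b) (x b)) :
    PTime e fun a => (l a).any (g a) :=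
  (hl.all (g := fun a x => !g a x)
    fun β _ env π x hE hx hm => (hg β env π x hE hx hm).not).not.congr fun a => by
    simp [List.any_eq_not_all_not]

theorem flatten {l : α → List (List τ)} (hl : PTime e l) : PTime e fun a => (l a).flatten := by
  have hsz : ∀ x y : List τ, (enc (x ++ y)).size ≤ (enc x).size + (enc y).size := by
    intro x y
    induction x with
    | nil => simp
    | cons z x ih =>
      rw [List.cons_append, size_cons, size_cons]
      omega
  refine (foldl_add (f := fun _ s x => x ++ s) (T := fun a => (enc (l a)).size) hl.size
    hl.reverse (nil hl.size_env)
    (fun a s x hx => by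
      have := size_le_of_mem (List.mem_reverse.1 hx)
      have := hsz x s
      omega)
    fun _ _ _ _ _ _ _ hs hx _ => hx.append hs).congr fun a => ?_
  rw [List.foldl_reverse]
  induction l a with
  | nil => rfl
  | cons x m ih => simp [ih]

theorem flatMap {l : α → List τ} {g : α → τ → List σ} (hl : PTime e l)
    (hg : ∀ (β : Type) [Scale β] (env : β → Val) (π : β → α) (x : β → τ),
      Sub env e π → PTime env x → (∀ b, x b ∈ l (π b)) → PTime env fun b => g (π b) (x b)) :
    PTime e fun a => (l a).flatMap (g a) :=
  (hl.map hg).flatten.congr fun _ => List.flatMap_def ..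

theorem zip {l : α → List τ} {l' : α → List σ} (hl : PTime e l) (hl' : PTime e l') :
    PTime e fun a => (l a).zip (l' a) := by
  let f : List σ × List (τ × σ) → τ → List σ × List (τ × σ) := fun s x =>
    if !s.1.isEmpty then (s.1.tail, (s.1.head?.map fun y => (x, y)).toList ++ s.2) else s
  have hf : ∀ x y s u, f (y :: s, u) x = (s, (x, y) :: u) := fun _ _ _ _ => rfl
  have hf' : ∀ x u, f ([], u) x = ([], u) := fun _ _ => rfl
  have : PTime e fun a => (l a).foldl f (l' a, []) := by
    refine foldl_add (f := fun _ => f) (T := fun a => 1 + (enc (l a)).size)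
      ((PolyBdd.const 1).add hl.size) hl (hl'.pair (nil hl.size_env)) ?_ ?_
    · rintro a ⟨_ | ⟨y, s⟩, u⟩ x hx
      · rw [hf']
        omega
      · have := size_le_of_mem hx
        rw [hf]
        simp only [size_prod, size_cons]
        omega
    · intro β _ env π s x hE hs hx _
      refine ite' hs.fst.isCons (fun γ _ env' π' hE' hne => ?_) fun γ _ env' π' hE' _ =>
        hs.at' hE'
      have hs' := hs.at' hE'
      have hne' : ∀ c, (s (π' c)).1 ≠ [] := fun c => by simpa using hne c
      have hy : PTime env' fun c => (s (π' c)).1.head (hne' c) :=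
        hs'.fst.head' fun c => List.head?_eq_some_head (hne' c)
      refine (hs'.fst.tail.pair (((hx.at' hE').pair hy).cons hs'.snd)).congr fun c => ?_
      rw [List.head?_eq_some_head (hne' c)]
      rfl
  refine this.snd.reverse.congr fun a => ?_
  have : ∀ (m : List τ) (s : List σ) u, (m.foldl f (s, u)).2 = (m.zip s).reverse ++ u := by
    intro m
    induction m with
    | nil => simp
    | cons x m ih =>
      rintro (_ | ⟨y, s⟩) u
      · simp [hf', ih]
      · simp [hf, ih]
  simp [this]

theorem zipWith {g : α → τ → σ → ρ} {l : α → List τ} {l' : α → List σ} (hl : PTime e l)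
    (hl' : PTime e l')
    (hg : ∀ (β : Type) [Scale β] (env : β → Val) (π : β → α) (x : β → τ) (y : β → σ),
      Sub env e π → PTime env x → PTime env y → PTime env fun b => g (π b) (x b) (y b)) :
    PTime e fun a => List.zipWith (g a) (l a) (l' a) :=
  ((hl.zip hl').map (g := fun a p => g a p.1 p.2) fun β _ env π x hE hx _ =>
    hg β env π _ _ hE hx.fst hx.snd).congr fun a => by
      rw [← List.map_uncurry_zip_eq_zipWith]
      rfl

theorem range {k : α → ℕ} (hk : PTime e k) (hk' : PolyBdd k) :
    PTime e fun a => List.range (k a) := by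
  have he := hk.size_env
  have hsz : ∀ i d, (enc ((List.range i).map (· + d))).size ≤ 1 + i * (2 + (i + d)) := by
    intro i d
    refine (size_le_of_forall (T := 1 + (i + d)) fun x hx => ?_).trans (by simp; ring_nf; rfl)
    obtain ⟨j, hj, rfl⟩ := List.mem_map.1 hx
    rw [List.mem_range] at hj
    have := natSize_le_self (j + d)
    simp only [enc, Val.size, Int.natAbs_natCast]
    omega
  let s : α → ℕ → ℕ × List ℕ := fun a i => (k a - i, (List.range i).map (· + (k a - i)))
  have key : PTime e fun a => enc (s a (k a)) := by
    refine loop (N := k) (s := fun a i => enc (s a i)) hk' ?_ ?_ ?_ ?_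
    · exact (hk.pair (nil he)).congr_enc fun _ => rfl
    · have o : Over (fun p : {p : α × ℕ // p.2 ≤ k p.1} => p.1.1) :=
        ⟨fun _ => rfl, fun _ => rfl⟩
      refine (((PolyBdd.const 1).add ((PolyBdd.const 1).add hk')).add
        ((PolyBdd.const 1).add (hk'.mul ((PolyBdd.const 2).add hk')))).pull o |>.mono ?_
      rintro ⟨⟨a, i⟩, hi⟩
      dsimp only at hi ⊢
      have h1 := hsz i (k a - i)
      have h2 := natSize_le_self (k a - i)
      rw [Nat.add_sub_cancel' hi] at h1
      have h3 := Nat.mul_le_mul_right (2 + k a) hi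
      have h4 : (enc (k a - i)).size = 1 + Nat.size (k a - i) := by
        simp only [enc, Val.size, Int.natAbs_natCast]
      simp only [s, size_prod, h4]
      omega
    · intro β _ π i _ hi hE
      have hE : PTime (fun b => enc (s (π b) (i b))) (fun b => s (π b) (i b)) :=
        hE.congr_enc fun _ => rfl
      refine ((const_nat 1 hE.size_env).nat_le hE.fst).congr fun b => ?_
      simp only [s]
      exact decide_eq_decide.2 (by omega)
    · intro β _ π i _ hi hE
      have hE : PTime (fun b => enc (s (π b) (i b))) (fun b => s (π b) (i b)) :=
        hE.congr_enc fun _ => rfl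
      have h1 := hE.fst.nat_sub (const_nat 1 hE.size_env)
      refine (h1.pair (h1.cons hE.snd)).congr_enc fun b => ?_
      have hib := hi b
      rw [enc_val]
      congr 1
      simp only [s, List.range_succ_eq_map, List.map_cons, List.map_map]
      have : k (π b) - (i b + 1) + 1 = k (π b) - i b := by omega
      refine Prod.ext (by dsimp only; omega) ?_
      simp only [zero_add, List.cons.injEq]
      refine ⟨by omega, List.map_congr_left fun j _ => ?_⟩
      simp only [Function.comp]
      omega
  have key : PTime e fun a => s a (k a) := key.congr_enc fun _ => rfl
  exact key.snd.congr fun a => by simp [s]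

end PTime
end PolyTime


namespace PolyTime
open Enc (enc)
variable {α β γ τ σ ρ : Type} [Scale α] [Scale β] [Enc τ] [Enc σ] [Enc ρ] {e : α → Val}

/-! ## The algorithm -/

/-- A polynomial as the list of its monomials. -/
abbrev RawPoly := List (ℤ × List ℕ)

/-- Divisibility of terms. -/
def tle (u v : List ℕ) : Bool := (u.zip v).all fun p => decide (p.1 ≤ p.2)

/-- Equality of terms. -/
def teq (u v : List ℕ) : Bool := tle u v && tle v u

/-- Product of terms. -/
def tadd (u v : List ℕ) : List ℕ := List.zipWith (fun a b => a + b) u v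

/-- Quotient of terms. -/
def tsub (u v : List ℕ) : List ℕ := List.zipWith (fun a b => a - b) u v

def vadd (u v : List ℤ) : List ℤ := List.zipWith (fun a b => a + b) u v

def vsmul (c : ℤ) (v : List ℤ) : List ℤ := v.map fun z => c * z

def dot (u v : List ℤ) : ℤ := (List.zipWith (fun a b => a * b) u v).sum

/-- The leading coefficient. -/
def lcoeff (g : RawPoly) : ℤ := (g.head?.getD (0, [])).1

/-- The leading term. -/
def lterm (g : RawPoly) : List ℕ := (g.head?.getD (0, [])).2

/-- All exponent vectors of length `n` with entries at most `M`. -/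
def box (n M : ℕ) : List (List ℕ) :=
  (List.range n).foldl
    (fun s _ => s.flatMap fun v => (List.range (M + 1)).map fun i => i :: v) [[]]

/-- A bound for the exponents in `G`. -/
def expBound (n : ℕ) (G : List RawPoly) : ℕ := n + 2 + (G.flatten.flatMap fun μ => μ.2).sum

/-- A bound for the exponents of the terms that are needed for reductions. -/
def boxBound (n : ℕ) (G : List RawPoly) : ℕ :=
  (List.range (1 + n * (2 * n + 2))).foldl (fun M _ => M * M) (expBound n G)

/-- The members of `B` that are not divisible by the leading term of a monic element of `G`. -/
def standardTerms (G : List RawPoly) (B : List (List ℕ)) : List (List ℕ) :=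
  B.filter fun e => !(G.any fun g => decide (|lcoeff g| = 1) && tle (lterm g) e)

def unitVec (O : List (List ℕ)) (t : List ℕ) : List ℤ := O.map fun s => if teq s t then 1 else 0

def zeroVec (O : List (List ℕ)) : List ℤ := O.map fun _ => 0

/-- A table of terms together with their representations by standard terms. -/
abbrev Table := List (List ℕ × List ℤ)

def known (tbl : Table) (t : List ℕ) : Bool := tbl.any fun p => teq p.1 t

def lookup (z : List ℤ) (tbl : Table) (t : List ℕ) : List ℤ :=
  tbl.foldl (fun s p => if teq p.1 t then p.2 else s) z

/-- The representation of `s * q`, read off from the table. -/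
def evalTable (z : List ℤ) (tbl : Table) (s : List ℕ) (q : RawPoly) : List ℤ :=
  q.foldl (fun acc μ => vadd acc (vsmul μ.1 (lookup z tbl (tadd s μ.2)))) z

/-- Extend the table by the term `p.1`, if it can be reduced by the monic polynomial `p.2` to terms
in the table. -/
def tableStep (z : List ℤ) (tbl : Table) (p : List ℕ × RawPoly) : Table :=
  if decide (|lcoeff p.2| = 1) && tle (lterm p.2) p.1 &&
      p.2.tail.all (fun μ => known tbl (tadd (tsub p.1 (lterm p.2)) μ.2)) then
    (p.1, vsmul (-lcoeff p.2) (evalTable z tbl (tsub p.1 (lterm p.2)) p.2.tail)) :: tbl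
  else tbl

def table (G : List RawPoly) (B O : List (List ℕ)) : Table :=
  (B.flatMap fun _ => B.flatMap fun t => G.map fun g => (t, g)).foldl (tableStep (zeroVec O))
    (O.map fun t => (t, unitVec O t))

/-- An element of `G` with minimal leading coefficient among those whose leading term divides
`t`. -/
def bestPoly (G : List RawPoly) (t : List ℕ) : RawPoly :=
  G.foldl (fun b g => if tle (lterm g) t && (decide (lcoeff b = 0) || decide (|lcoeff g| < |lcoeff b|))
    then g else b) []

/-- The reduction rule for the standard term `t`: its unit vector, its coefficient in the rule, and
the rule. -/
def reductionRow (G : List RawPoly) (O : List (List ℕ)) (tbl : Table) (t : List ℕ) :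
    List ℤ × ℤ × List ℤ :=
  (unitVec O t, lcoeff (bestPoly G t), vadd (vsmul (lcoeff (bestPoly G t)) (unitVec O t))
    (evalTable (zeroVec O) tbl (tsub t (lterm (bestPoly G t))) (bestPoly G t).tail))

def reduceStep (v : List ℤ) (r : List ℤ × ℤ × List ℤ) : List ℤ :=
  vadd v (vsmul (-(dot v r.1 / r.2.1)) r.2.2)

def reduce (O : List (List ℕ)) (rows : List (List ℤ × ℤ × List ℤ)) (v : List ℤ) : List ℤ :=
  (O.flatMap fun _ => rows).foldl reduceStep v

/-- The relation that belongs to a reduction rule. -/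
def relation (O : List (List ℕ)) (rows : List (List ℤ × ℤ × List ℤ))
    (r : List ℤ × ℤ × List ℤ) : List ℤ :=
  vadd (vsmul |r.2.1| r.1) (vsmul (-1) (reduce O rows (vsmul |r.2.1| r.1)))

/-- The explicit representation, from the standard terms and a table. -/
def presentation (G : List RawPoly) (O : List (List ℕ)) (tbl : Table) :
    List (List ℕ) × List (List ℤ) × List (List (List ℤ)) :=
  (O, ((O.map (reductionRow G O tbl)).filter fun r => !decide (r.2.1 = 0)).map
      (relation O (O.map (reductionRow G O tbl))),
    O.map fun t => O.map fun u =>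
      reduce O (O.map (reductionRow G O tbl)) (lookup (zeroVec O) tbl (tadd t u)))

def algorithm (p : ℕ × List RawPoly) : List (List ℕ) × List (List ℤ) × List (List (List ℤ)) :=
  presentation p.2 (standardTerms p.2 (box p.1 (boxBound p.1 p.2)))
    (table p.2 (box p.1 (boxBound p.1 p.2)) (standardTerms p.2 (box p.1 (boxBound p.1 p.2))))

/-! ## Its running time -/

namespace PTime

theorem tle {u v : α → List ℕ} (hu : PTime e u) (hv : PTime e v) :
    PTime e fun a => tle (u a) (v a) :=
  (hu.zip hv).all (g := fun _ (p : ℕ × ℕ) => decide (p.1 ≤ p.2)) fun _ _ _ _ _ _ hx _ => hx.fst.nat_le hx.snd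

theorem teq {u v : α → List ℕ} (hu : PTime e u) (hv : PTime e v) :
    PTime e fun a => teq (u a) (v a) :=
  (hu.tle hv).and (hv.tle hu)

theorem tadd {u v : α → List ℕ} (hu : PTime e u) (hv : PTime e v) :
    PTime e fun a => tadd (u a) (v a) :=
  hu.zipWith (g := fun _ a b => a + b) hv fun _ _ _ _ _ _ _ hx hy => hx.nat_add hy

theorem tsub {u v : α → List ℕ} (hu : PTime e u) (hv : PTime e v) :
    PTime e fun a => tsub (u a) (v a) :=
  hu.zipWith (g := fun _ a b => a - b) hv fun _ _ _ _ _ _ _ hx hy => hx.nat_sub hy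

theorem vadd {u v : α → List ℤ} (hu : PTime e u) (hv : PTime e v) :
    PTime e fun a => vadd (u a) (v a) :=
  hu.zipWith (g := fun _ a b => a + b) hv fun _ _ _ _ _ _ _ hx hy => hx.add hy

theorem vsmul {c : α → ℤ} {v : α → List ℤ} (hc : PTime e c) (hv : PTime e v) :
    PTime e fun a => vsmul (c a) (v a) :=
  hv.map (g := fun a z => c a * z) fun _ _ _ _ _ hE hx _ => (hc.at' hE).mul hx

theorem sum {l : α → List ℤ} (hl : PTime e l) : PTime e fun a => (l a).sum := by
  refine (foldl_add (f := fun _ s x => s + x) (T := fun a => (enc (l a)).size) hl.size hl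
    (const_int 0 hl.size_env) (fun a s x hx => ?_) fun _ _ _ _ _ _ _ hs hx _ => hs.add hx).congr
    fun a => List.sum_eq_foldl
  have h1 := size_le_of_mem hx
  have h2 := (Nat.size_le_size (Int.natAbs_add_le s x)).trans (natSize_add_le _ _)
  simp only [enc, Val.size] at h1 h2 ⊢
  omega

theorem nat_sum {l : α → List ℕ} (hl : PTime e l) : PTime e fun a => (l a).sum :=
  (hl.map (g := fun _ (x : ℕ) => (x : ℤ)) fun _ _ _ _ _ _ hx _ => hx.natCast).sum.congr_enc fun a => by
    simp [enc, Nat.cast_list_sum]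

theorem dot {u v : α → List ℤ} (hu : PTime e u) (hv : PTime e v) :
    PTime e fun a => dot (u a) (v a) :=
  (hu.zipWith (g := fun _ a b => a * b) hv fun _ _ _ _ _ _ _ hx hy => hx.mul hy).sum

theorem lcoeff {g : α → RawPoly} (hg : PTime e g) : PTime e fun a => lcoeff (g a) :=
  ((hg.prim .fst).prim .fst).congr_enc fun a => by rcases g a with _ | ⟨x, l⟩ <;> rfl

theorem lterm {g : α → RawPoly} (hg : PTime e g) : PTime e fun a => lterm (g a) :=
  ((hg.prim .fst).prim .snd).congr_enc fun a => by rcases g a with _ | ⟨x, l⟩ <;> rfl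

theorem expBound {n : α → ℕ} {G : α → List RawPoly} (hn : PTime e n) (hG : PTime e G) :
    PTime e fun a => expBound (n a) (G a) :=
  (hn.nat_add (const_nat 2 hn.size_env)).nat_add
    (hG.flatten.flatMap (g := fun _ (μ : ℤ × List ℕ) => μ.2) fun _ _ _ _ _ _ hx _ => hx.snd).nat_sum

theorem standardTerms {G : α → List RawPoly} {B : α → List (List ℕ)} (hG : PTime e G)
    (hB : PTime e B) : PTime e fun a => standardTerms (G a) (B a) :=
  hB.filter (g := fun a t =>
      !((G a).any fun g : RawPoly => decide (|PolyTime.lcoeff g| = 1) && PolyTime.tle (PolyTime.lterm g) t))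
    fun _ _ _ _ _ hE hx _ =>
      ((hG.at' hE).any (g := fun _ (g : RawPoly) => decide (|PolyTime.lcoeff g| = 1) && PolyTime.tle (PolyTime.lterm g) _)
        fun _ _ _ _ _ hE' hg _ =>
          (hg.lcoeff.abs.eq (const_int 1 hg.size_env)).and (hg.lterm.tle (hx.at' hE'))).not

theorem unitVec {O : α → List (List ℕ)} {t : α → List ℕ} (hO : PTime e O) (ht : PTime e t) :
    PTime e fun a => unitVec (O a) (t a) :=
  hO.map (g := fun a s => if PolyTime.teq s (t a) then 1 else 0) fun _ _ _ _ _ hE hx _ =>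
    (hx.teq (ht.at' hE)).ite (const_int 1 hx.size_env) (const_int 0 hx.size_env)

theorem zeroVec {O : α → List (List ℕ)} (hO : PTime e O) : PTime e fun a => zeroVec (O a) :=
  hO.map (g := fun _ _ => 0) fun _ _ _ _ _ _ hx _ => const_int 0 hx.size_env

theorem known {tbl : α → Table} {t : α → List ℕ} (htbl : PTime e tbl) (ht : PTime e t) :
    PTime e fun a => known (tbl a) (t a) :=
  htbl.any (g := fun a (p : List ℕ × List ℤ) => PolyTime.teq p.1 (t a)) fun _ _ _ _ _ hE hx _ =>
    hx.fst.teq (ht.at' hE)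

theorem lookup {z : α → List ℤ} {tbl : α → Table} {t : α → List ℕ} (hz : PTime e z)
    (htbl : PTime e tbl) (ht : PTime e t) : PTime e fun a => lookup (z a) (tbl a) (t a) :=
  foldl_add (f := fun a s (p : List ℕ × List ℤ) => if PolyTime.teq p.1 (t a) then p.2 else s)
    (T := fun a => (enc (tbl a)).size) htbl.size htbl hz
    (fun a s p hp => by
      have := size_le_of_mem hp
      rw [size_prod] at this
      split_ifs <;> omega)
    fun _ _ _ _ _ _ hE hs hx _ => (hx.fst.teq (ht.at' hE)).ite hx.snd hs

theorem size_vadd_le (u v : List ℤ) :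
    (enc (PolyTime.vadd u v)).size ≤ (enc u).size + (enc v).size := by
  induction u generalizing v with
  | nil => simp [PolyTime.vadd, size_nil]
  | cons x u ih =>
    cases v with
    | nil => simp [PolyTime.vadd, size_nil]
    | cons y v =>
      have h1 := ih v
      have h2 := (Nat.size_le_size (Int.natAbs_add_le x y)).trans (natSize_add_le _ _)
      simp only [PolyTime.vadd, List.zipWith_cons_cons, size_cons] at h1 ⊢
      simp only [enc, Val.size] at h1 h2 ⊢
      omega

theorem evalTable {z : α → List ℤ} {tbl : α → Table} {s : α → List ℕ} {q : α → RawPoly}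
    (hz : PTime e z) (htbl : PTime e tbl) (hs : PTime e s) (hq : PTime e q) :
    PTime e fun a => evalTable (z a) (tbl a) (s a) (q a) := by
  have hg : ∀ (β : Type) [Scale β] (env : β → Val) (π : β → α) (x : β → ℤ × List ℕ),
      Sub env e π → PTime env x → PTime env fun b => PolyTime.vsmul (x b).1
        (PolyTime.lookup (z (π b)) (tbl (π b)) (PolyTime.tadd (s (π b)) (x b).2)) :=
    fun β _ env π x hE hx =>
      hx.fst.vsmul ((hz.at' hE).lookup (htbl.at' hE) ((hs.at' hE).tadd hx.snd))
  obtain ⟨T, hT, h⟩ := uniform_mem (g := fun a (x : ℤ × List ℕ) => PolyTime.vsmul x.1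
    (PolyTime.lookup (z a) (tbl a) (PolyTime.tadd (s a) x.2))) hq
    fun β _ env π x hE hx _ => hg β env π x hE hx
  exact foldl_add (f := fun a acc (μ : ℤ × List ℕ) => PolyTime.vadd acc (PolyTime.vsmul μ.1
    (PolyTime.lookup (z a) (tbl a) (PolyTime.tadd (s a) μ.2)))) hT hq hz
    (fun a s x hx => (size_vadd_le _ _).trans (Nat.add_le_add_left (h a x hx) _))
    fun β _ env π _ x hE hs hx _ => hs.vadd (hg β env π x hE hx)

theorem tableStep {z : α → List ℤ} {tbl : α → Table} {p : α → List ℕ × RawPoly}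
    (hz : PTime e z) (htbl : PTime e tbl) (hp : PTime e p) :
    PTime e fun a => tableStep (z a) (tbl a) (p a) := by
  have hs := hp.fst.tsub hp.snd.lterm
  refine ite ((hp.snd.lcoeff.abs.eq (const_int 1 hp.size_env)).and (hp.snd.lterm.tle hp.fst) |>.and
    (hp.snd.tail.all (g := fun a (μ : ℤ × List ℕ) => PolyTime.known (tbl a)
      (PolyTime.tadd (PolyTime.tsub (p a).1 (PolyTime.lterm (p a).2)) μ.2))
      fun _ _ _ _ _ hE hx _ => (htbl.at' hE).known ((hs.at' hE).tadd hx.snd))) ?_ htbl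
  exact (hp.fst.pair (hp.snd.lcoeff.neg.vsmul (hz.evalTable htbl hs hp.snd.tail))).cons htbl

theorem bestPoly {G : α → List RawPoly} {t : α → List ℕ} (hG : PTime e G) (ht : PTime e t) :
    PTime e fun a => bestPoly (G a) (t a) :=
  foldl_add (f := fun a (b g : RawPoly) => if PolyTime.tle (PolyTime.lterm g) (t a) && (decide (PolyTime.lcoeff b = 0) ||
      decide (|PolyTime.lcoeff g| < |PolyTime.lcoeff b|)) then g else b)
    (T := fun a => (enc (G a)).size) hG.size hG (nil hG.size_env)
    (fun a s p hp => by
      have := size_le_of_mem hp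
      split_ifs <;> omega)
    fun _ _ _ _ _ _ hE hs hx _ => ((hx.lterm.tle (ht.at' hE)).and
      ((hs.lcoeff.eq (const_int 0 hs.size_env)).or (hx.lcoeff.abs.lt hs.lcoeff.abs))).ite hx hs

theorem reductionRow {G : α → List RawPoly} {O : α → List (List ℕ)} {tbl : α → Table}
    {t : α → List ℕ} (hG : PTime e G) (hO : PTime e O) (htbl : PTime e tbl) (ht : PTime e t) :
    PTime e fun a => reductionRow (G a) (O a) (tbl a) (t a) := by
  have hg := hG.bestPoly ht
  have hu := hO.unitVec ht
  exact hu.pair (hg.lcoeff.pair ((hg.lcoeff.vsmul hu).vadd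
    (hO.zeroVec.evalTable htbl (ht.tsub hg.lterm) hg.tail)))

theorem reduceStep {v : α → List ℤ} {r : α → List ℤ × ℤ × List ℤ} (hv : PTime e v)
    (hr : PTime e r) : PTime e fun a => reduceStep (v a) (r a) :=
  hv.vadd (((hv.dot hr.fst).div hr.snd.fst).neg.vsmul hr.snd.snd)

end PTime
end PolyTime


namespace PolyTime
open Enc (enc)
variable {α β γ τ σ ρ : Type} [Scale α] [Scale β] [Enc τ] [Enc σ] [Enc ρ] {e : α → Val}

/-- The vector has at most `k` entries, of absolute value at most `2 ^ b`. -/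
def VecBound (k b : ℕ) (v : List ℤ) : Prop := v.length ≤ k ∧ ∀ x ∈ v, x.natAbs ≤ 2 ^ b

theorem VecBound.mono {k b b' : ℕ} {v : List ℤ} (h : VecBound k b v) (hb : b ≤ b') :
    VecBound k b' v :=
  ⟨h.1, fun x hx => (h.2 x hx).trans (Nat.pow_le_pow_right (by omega) hb)⟩

theorem VecBound.size_le {k b : ℕ} {v : List ℤ} (h : VecBound k b v) :
    (enc v).size ≤ 1 + k * (3 + b) := by
  refine (size_le_of_forall (T := 2 + b) fun x hx => ?_).trans ?_
  · have : Nat.size x.natAbs ≤ b + 1 := by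
      rw [Nat.size_le]
      have := h.2 x hx
      rw [pow_succ]
      have := Nat.two_pow_pos b
      omega
    simp only [enc, Val.size]
    omega
  · have := Nat.mul_le_mul_right (3 + b) h.1
    rw [show 1 + (2 + b) = 3 + b by omega]
    omega

theorem vecBound_of_size (v : List ℤ) : VecBound (enc v).size (enc v).size v :=
  ⟨length_le_size v, fun x hx => by
    have h1 := size_le_of_mem hx
    have h2 := Nat.lt_size_self x.natAbs
    simp only [enc, Val.size] at h1
    exact h2.le.trans (Nat.pow_le_pow_right (by omega) (by simp only [enc]; omega))⟩

theorem natAbs_le_of_size (x : ℤ) : x.natAbs ≤ 2 ^ (enc x).size := by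
  have h2 := Nat.lt_size_self x.natAbs
  exact h2.le.trans (Nat.pow_le_pow_right (by omega) (by simp only [enc, Val.size]; omega))

theorem VecBound.vsmul {k b d : ℕ} {v : List ℤ} {c : ℤ} (h : VecBound k b v)
    (hc : c.natAbs ≤ 2 ^ d) : VecBound k (d + b) (vsmul c v) := by
  refine ⟨by simpa [PolyTime.vsmul] using h.1, fun x hx => ?_⟩
  obtain ⟨y, hy, rfl⟩ := List.mem_map.1 hx
  rw [Int.natAbs_mul, pow_add]
  exact Nat.mul_le_mul hc (h.2 y hy)

theorem mem_zipWith {X Y Z : Type} {f : X → Y → Z} {l : List X} {l' : List Y} {z : Z}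
    (h : z ∈ List.zipWith f l l') : ∃ x ∈ l, ∃ y ∈ l', z = f x y := by
  induction l generalizing l' with
  | nil => simp at h
  | cons x l ih =>
    cases l' with
    | nil => simp at h
    | cons y l' =>
      rw [List.zipWith_cons_cons, List.mem_cons] at h
      rcases h with rfl | h
      · exact ⟨x, by simp, y, by simp, rfl⟩
      · obtain ⟨a, ha, b, hb, rfl⟩ := ih h
        exact ⟨a, by simp [ha], b, by simp [hb], rfl⟩

theorem natAbs_vadd {u v : List ℤ} {A B : ℕ} (hu : ∀ x ∈ u, x.natAbs ≤ A)
    (hv : ∀ x ∈ v, x.natAbs ≤ B) : ∀ x ∈ vadd u v, x.natAbs ≤ A + B := by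
  intro z hz
  obtain ⟨x, hx, y, hy, rfl⟩ := mem_zipWith hz
  have := hu x hx
  have := hv y hy
  omega

theorem length_vadd_le (u v : List ℤ) : (vadd u v).length ≤ u.length := by
  simp [vadd]

theorem natAbs_sum_le {l : List ℤ} {A : ℕ} (h : ∀ x ∈ l, x.natAbs ≤ A) :
    l.sum.natAbs ≤ l.length * A := by
  induction l with
  | nil => simp
  | cons x l ih =>
    have h1 := ih fun y hy => h y (List.mem_cons_of_mem _ hy)
    have h2 := h x List.mem_cons_self
    rw [List.sum_cons, List.length_cons, Nat.succ_mul]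
    omega

theorem natAbs_dot_le {u v : List ℤ} {k b d : ℕ} (hu : VecBound k b u)
    (hv : ∀ x ∈ v, x.natAbs ≤ 2 ^ d) : (dot u v).natAbs ≤ 2 ^ (k + b + d) := by
  refine (natAbs_sum_le (A := 2 ^ b * 2 ^ d) fun z hz => ?_).trans ?_
  · obtain ⟨x, hx, y, hy, rfl⟩ := mem_zipWith hz
    rw [Int.natAbs_mul]
    exact Nat.mul_le_mul (hu.2 x hx) (hv y hy)
  · rw [add_assoc, pow_add, pow_add]
    refine Nat.mul_le_mul_right _ ?_
    rw [List.length_zipWith]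
    exact (min_le_left _ _).trans (hu.1.trans Nat.lt_two_pow_self.le)

theorem VecBound.reduceStep {k b d : ℕ} {v : List ℤ} {r : List ℤ × ℤ × List ℤ}
    (hv : VecBound k b v) (hr : (enc r).size ≤ d) :
    VecBound k (b + (k + 2 * d + 1)) (reduceStep v r) := by
  obtain ⟨u, c, w⟩ := r
  simp only [size_prod] at hr
  refine ⟨(length_vadd_le _ _).trans hv.1, ?_⟩
  have hu : ∀ x ∈ u, x.natAbs ≤ 2 ^ d := ((vecBound_of_size u).mono (by omega)).2
  have hw := (vecBound_of_size w).mono (b' := d) (by omega)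
  have h1 := (Int.natAbs_ediv_le_natAbs (dot v u) c).trans (natAbs_dot_le hv hu)
  have h2 := (hw.vsmul (c := -(dot v u / c)) (by rwa [Int.natAbs_neg])).2
  intro x hx
  refine (natAbs_vadd hv.2 h2 x hx).trans ?_
  rw [← add_assoc, pow_succ]
  have e1 : 2 ^ b ≤ 2 ^ (b + (k + 2 * d)) := Nat.pow_le_pow_right (by omega) (by omega)
  have e2 : 2 ^ (k + b + d + d) ≤ 2 ^ (b + (k + 2 * d)) :=
    Nat.pow_le_pow_right (by omega) (by omega)
  omega

theorem VecBound.lookup {k b : ℕ} {z : List ℤ} {tbl : Table} (t : List ℕ) (hz : VecBound k b z)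
    (h : ∀ p ∈ tbl, VecBound k b p.2) : VecBound k b (lookup z tbl t) := by
  unfold PolyTime.lookup
  induction tbl generalizing z with
  | nil => exact hz
  | cons p tbl ih =>
    rw [List.foldl_cons]
    refine ih ?_ fun q hq => h q (List.mem_cons_of_mem _ hq)
    split_ifs
    · exact h p List.mem_cons_self
    · exact hz

theorem VecBound.evalTable {k b d : ℕ} {z : List ℤ} {tbl : Table} (s : List ℕ) {q : RawPoly}
    (hz : VecBound k b z) (h : ∀ p ∈ tbl, VecBound k b p.2) (hq : (enc q).size ≤ d) :
    VecBound k (2 * d + b + 1) (evalTable z tbl s q) := by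
  have key : ∀ (q : RawPoly) (acc : List ℤ), (∀ μ ∈ q, μ.1.natAbs ≤ 2 ^ d) → acc.length ≤ k →
      ∀ A, (∀ x ∈ acc, x.natAbs ≤ A) →
      (q.foldl (fun acc μ => vadd acc (PolyTime.vsmul μ.1
        (PolyTime.lookup z tbl (tadd s μ.2)))) acc).length ≤ k ∧
      ∀ x ∈ q.foldl (fun acc μ => vadd acc (PolyTime.vsmul μ.1
        (PolyTime.lookup z tbl (tadd s μ.2)))) acc, x.natAbs ≤ A + q.length * 2 ^ (d + b) := by
    intro q
    induction q with
    | nil => intro acc _ hk A hA; simpa using ⟨hk, hA⟩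
    | cons μ q ih =>
      intro acc hc hk A hA
      have h1 := (VecBound.lookup (tadd s μ.2) hz h).vsmul (hc μ List.mem_cons_self)
      have := ih (vadd acc (PolyTime.vsmul μ.1 (PolyTime.lookup z tbl (tadd s μ.2))))
        (fun ν hν => hc ν (List.mem_cons_of_mem _ hν)) ((length_vadd_le _ _).trans hk)
        (A + 2 ^ (d + b)) (natAbs_vadd hA h1.2)
      rw [List.foldl_cons, List.length_cons, Nat.succ_mul]
      exact ⟨this.1, fun x hx => (this.2 x hx).trans (by omega)⟩
  have := key q z (fun μ hμ => ?_) hz.1 _ hz.2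
  · refine ⟨this.1, fun x hx => (this.2 x hx).trans ?_⟩
    have h1 : q.length ≤ 2 ^ d := ((length_le_size q).trans hq).trans Nat.lt_two_pow_self.le
    have h2 := Nat.mul_le_mul_right (2 ^ (d + b)) h1
    rw [← pow_add] at h2
    have e1 : 2 ^ b ≤ 2 ^ (2 * d + b) := Nat.pow_le_pow_right (by omega) (by omega)
    rw [show d + (d + b) = 2 * d + b by omega] at h2
    rw [pow_succ]
    omega
  · have h1 := size_le_of_mem hμ
    rw [size_prod] at h1
    exact (natAbs_le_of_size _).trans (Nat.pow_le_pow_right (by omega) (by omega))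

namespace PTime

theorem box {n M : α → ℕ} (hn : PTime e n) (hn' : ∀ a, n a = Scale.par a) (hM : PTime e M)
    (hM' : PolyBdd M) : PTime e fun a => box (n a) (M a) := by
  have hnb : PolyBdd n := (PolyBdd.of_par fun k => k).mono fun a => (hn' a).le
  have hM1 : PolyBdd fun a => M a + 1 := hM'.add (PolyBdd.const 1)
  refine foldl (l := fun a => List.range (n a)) (s₀ := fun _ => [[]])
    (f := fun a s _ => s.flatMap fun v => (List.range (M a + 1)).map fun i => i :: v)
    (T := fun a => 1 + (M a + 1) ^ Scale.par a * (1 + (1 + n a * (1 + (1 + M a)))))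
    ((PolyBdd.const 1).add ((hM1.pow fun k => k).mul ((PolyBdd.const 1).add
      ((PolyBdd.const 1).add (hnb.mul ((PolyBdd.const 1).add ((PolyBdd.const 1).add hM')))))))
    (fun a i s => s.length = (M a + 1) ^ i ∧ ∀ v ∈ s, v.length = i ∧ ∀ x ∈ v, x ≤ M a)
    (hn.range hnb) ((nil hn.size_env).cons (nil hn.size_env)) ?_ ?_ ?_ ?_
  · simp
  · rintro a i s x - - ⟨h1, h2⟩
    refine ⟨?_, ?_⟩
    · simp [List.length_flatMap, h1, pow_succ]
    · intro v hv
      simp only [List.mem_flatMap, List.mem_map, List.mem_range] at hv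
      obtain ⟨w, hw, j, hj, rfl⟩ := hv
      obtain ⟨h3, h4⟩ := h2 w hw
      refine ⟨by simp [h3], fun x hx => ?_⟩
      rcases List.mem_cons.1 hx with rfl | hx
      · omega
      · exact h4 x hx
  · rintro a i s hi ⟨h1, h2⟩
    rw [List.length_range] at hi
    refine (size_le_of_forall (T := 1 + n a * (1 + (1 + M a))) fun v hv => ?_).trans ?_
    · obtain ⟨h3, h4⟩ := h2 v hv
      refine (size_le_of_forall (T := 1 + M a) fun x hx => ?_).trans ?_
      · have := h4 x hx
        have := natSize_le_self x
        simp only [enc, Val.size, Int.natAbs_natCast]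
        omega
      · rw [h3]
        have := Nat.mul_le_mul_right (1 + (1 + M a)) hi
        omega
    · rw [h1]
      refine Nat.add_le_add_left (Nat.mul_le_mul_right _ ?_) _
      exact Nat.pow_le_pow_right (by omega) (by rw [← hn' a]; exact hi)
  · intro β _ env π s _ hE hs _ _ _
    refine hs.flatMap (g := fun b v => (List.range (M (π b) + 1)).map fun i => i :: v) ?_
    intro γ _ env' π' v hE' hv _
    refine ((((hM.at' hE).nat_add (const_nat 1 hs.size_env)).range (hM1.pull hE.map)).at'
      hE').map (g := fun b i => i :: v b) ?_
    intro δ _ env'' π'' i hE'' hi _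
    exact hi.cons (hv.at' hE'')

theorem foldl_mul_self (X h : ℕ) : (List.range h).foldl (fun M _ => M * M) X = X ^ 2 ^ h := by
  induction h with
  | zero => simp
  | succ h ih =>
    rw [List.range_succ, List.foldl_append, ih, List.foldl_cons, List.foldl_nil, ← pow_add,
      pow_succ, mul_two]

theorem boxBound_eq (n : ℕ) (G : List RawPoly) :
    boxBound n G = PolyTime.expBound n G ^ 2 ^ (1 + n * (2 * n + 2)) :=
  foldl_mul_self _ _

theorem boxBound_bdd {n : α → ℕ} {G : α → List RawPoly} (hn' : ∀ a, n a = Scale.par a)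
    (hX : PolyBdd fun a => PolyTime.expBound (n a) (G a)) :
    PolyBdd fun a => boxBound (n a) (G a) :=
  (hX.pow fun n => 2 ^ (1 + n * (2 * n + 2))).mono fun a => by rw [boxBound_eq, hn' a]

theorem boxBound {n : α → ℕ} {G : α → List RawPoly} (hn : PTime e n) (hG : PTime e G)
    (hn' : ∀ a, n a = Scale.par a) (hX : PolyBdd fun a => PolyTime.expBound (n a) (G a)) :
    PTime e fun a => boxBound (n a) (G a) := by
  have hh : PTime e fun a => 1 + n a * (2 * n a + 2) :=
    (const_nat 1 hn.size_env).nat_add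
      (hn.nat_mul (((const_nat 2 hn.size_env).nat_mul hn).nat_add (const_nat 2 hn.size_env)))
  have hh' : PolyBdd fun a => 1 + n a * (2 * n a + 2) :=
    (PolyBdd.of_par fun k => 1 + k * (2 * k + 2)).mono fun a => by rw [hn' a]
  refine foldl (f := fun _ M _ => M * M) (T := fun a => 1 + PolyTime.boxBound (n a) (G a))
    ((PolyBdd.const 1).add (boxBound_bdd hn' hX))
    (fun a i M => M = PolyTime.expBound (n a) (G a) ^ 2 ^ i) (hh.range hh') (hn.expBound hG)
    (fun a => by simp) ?_ ?_ fun _ _ _ _ _ _ _ hs _ _ _ => hs.nat_mul hs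
  · rintro a i s x - - rfl
    rw [← pow_add, pow_succ, mul_two]
  · rintro a i s hi rfl
    rw [List.length_range] at hi
    have h1 := natSize_le_self (PolyTime.expBound (n a) (G a) ^ 2 ^ i)
    have h2 : PolyTime.expBound (n a) (G a) ^ 2 ^ i ≤ PolyTime.boxBound (n a) (G a) := by
      rw [boxBound_eq]
      exact Nat.pow_le_pow_right (by simp [PolyTime.expBound])
        (Nat.pow_le_pow_right (by omega) hi)
    simp only [enc, Val.size, Int.natAbs_natCast]
    omega

theorem table {G : α → List RawPoly} {B O : α → List (List ℕ)} (hG : PTime e G) (hB : PTime e B)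
    (hO : PTime e O) : PTime e fun a => table (G a) (B a) (O a) := by
  have hW : PTime e fun a =>
      (B a).flatMap fun _ => (B a).flatMap fun t => (G a).map fun g => (t, g) := by
    refine hB.flatMap (g := fun a _ => (B a).flatMap fun t => (G a).map fun g => (t, g)) ?_
    intro β _ env π _ hE _ _
    refine (hB.at' hE).flatMap (g := fun b t => (G (π b)).map fun g => (t, g)) ?_
    intro γ _ env' π' t hE' ht _
    refine ((hG.at' hE).at' hE').map (g := fun b g => (t b, g)) ?_
    intro δ _ env'' π'' g hE'' hg _
    exact (ht.at' hE'').pair hg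
  have hO' : PTime e fun a => (O a).map fun t => (t, PolyTime.unitVec (O a) t) :=
    hO.map (g := fun a t => (t, PolyTime.unitVec (O a) t)) fun _ _ _ _ _ hE hx _ =>
      hx.pair ((hO.at' hE).unitVec hx)
  have hz := hO.zeroVec
  unfold PolyTime.table
  generalize hWd : (fun a => (B a).flatMap fun _ => (B a).flatMap fun t =>
    (G a).map fun g => (t, g)) = W at hW
  let S : α → ℕ := fun a => (enc (W a)).size
  let S' : α → ℕ := fun a => (enc (O a)).size
  let D : α → ℕ := fun a => 3 * S a + 1
  have hS : PolyBdd S := hW.size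
  have hS' : PolyBdd S' := hO.size
  have hD : PolyBdd D := ((PolyBdd.const 3).mul hS).add (PolyBdd.const 1)
  suffices PTime e fun a => (W a).foldl (PolyTime.tableStep (PolyTime.zeroVec (O a)))
      ((O a).map fun t => (t, PolyTime.unitVec (O a) t)) from this.congr fun a => by rw [← hWd]
  refine foldl (f := fun a => PolyTime.tableStep (PolyTime.zeroVec (O a)))
    (T := fun a => 1 + ((O a).length + (W a).length) *
      (1 + (1 + (S a + S' a) + (1 + (O a).length * (3 + (W a).length * D a)))))
    ?_ (fun a i tbl => tbl.length ≤ (O a).length + i ∧ ∀ p ∈ tbl,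
      (enc p.1).size ≤ S a + S' a ∧ VecBound (O a).length (i * D a) p.2) hW hO' ?_ ?_ ?_ ?_
  · have hOl := hO.length_bdd
    have hWl := hW.length_bdd
    exact (PolyBdd.const 1).add ((hOl.add hWl).mul ((PolyBdd.const 1).add
      (((PolyBdd.const 1).add (hS.add hS')).add ((PolyBdd.const 1).add
        (hOl.mul ((PolyBdd.const 3).add (hWl.mul hD)))))))
  · intro a
    refine ⟨by simp, fun p hp => ?_⟩
    obtain ⟨t, ht, rfl⟩ := List.mem_map.1 hp
    refine ⟨(size_le_of_mem ht).trans (Nat.le_add_left _ _), by simp [PolyTime.unitVec], fun x hx => ?_⟩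
    obtain ⟨s, _, rfl⟩ := List.mem_map.1 hx
    split_ifs <;> simp
  · rintro a i tbl p hp - ⟨h1, h2⟩
    unfold PolyTime.tableStep
    have hsz : (enc p).size ≤ S a := size_le_of_mem hp
    have hi : i * D a ≤ (i + 1) * D a := Nat.mul_le_mul_right _ (by omega)
    split_ifs with hc
    · refine ⟨by simp only [List.length_cons]; omega, fun q hq => ?_⟩
      rcases List.mem_cons.1 hq with rfl | hq
      · rw [size_prod] at hsz
        refine ⟨by dsimp only; omega, ?_⟩
        have hz : VecBound (O a).length (i * D a) (PolyTime.zeroVec (O a)) := by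
          refine ⟨by simp [PolyTime.zeroVec], fun x hx => ?_⟩
          obtain ⟨s, _, rfl⟩ := List.mem_map.1 hx
          simp
        have htl : (enc p.2.tail).size ≤ S a := by
          have : (enc p.2.tail).size ≤ (enc p.2).size := by
            rcases p.2 with _ | ⟨x, l⟩
            · simp
            · rw [size_cons]
              simp
          omega
        have hc1 : |PolyTime.lcoeff p.2| = 1 := by
          simp only [Bool.and_eq_true, decide_eq_true_eq] at hc
          exact hc.1.1
        have := (hz.evalTable (PolyTime.tsub p.1 (PolyTime.lterm p.2))
          (fun q hq => (h2 q hq).2) htl).vsmul (c := -PolyTime.lcoeff p.2) (d := 0)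
          (by rw [Int.abs_eq_natAbs] at hc1; rw [Int.natAbs_neg, pow_zero]; omega)
        refine this.mono ?_
        have h3 : (i + 1) * D a = i * D a + D a := Nat.succ_mul _ _
        have h4 : D a = 3 * S a + 1 := rfl
        omega
      · exact ⟨(h2 q hq).1, (h2 q hq).2.mono hi⟩
    · exact ⟨by omega, fun q hq => ⟨(h2 q hq).1, (h2 q hq).2.mono hi⟩⟩
  · rintro a i tbl hi ⟨h1, h2⟩
    refine (size_le_of_forall (T := 1 + (S a + S' a) +
      (1 + (O a).length * (3 + (W a).length * D a))) fun p hp => ?_).trans ?_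
    · obtain ⟨h3, h4⟩ := h2 p hp
      have := (h4.mono (Nat.mul_le_mul_right (D a) hi)).size_le
      rw [size_prod]
      omega
    · exact Nat.add_le_add_left (Nat.mul_le_mul_right _ (by omega)) _
  · intro β _ env π s x hE hs hx _ _
    exact (hz.at' hE).tableStep hs hx

theorem reduce {O : α → List (List ℕ)} {rows : α → List (List ℤ × ℤ × List ℤ)}
    {v : α → List ℤ} (hO : PTime e O) (hrows : PTime e rows) (hv : PTime e v) :
    PTime e fun a => reduce (O a) (rows a) (v a) := by
  have hW : PTime e fun a => (O a).flatMap fun _ => rows a :=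
    hO.flatMap (g := fun a _ => rows a) fun _ _ _ _ _ hE _ _ => hrows.at' hE
  let W := fun a => (O a).flatMap fun _ => rows a
  let D : α → ℕ := fun a => (enc (v a)).size + 2 * (enc (W a)).size + 1
  have hD : PolyBdd D := (hv.size.add ((PolyBdd.const 2).mul hW.size)).add (PolyBdd.const 1)
  refine foldl (f := fun _ => PolyTime.reduceStep)
    (T := fun a => 1 + (enc (v a)).size * (3 + ((enc (v a)).size + (W a).length * D a)))
    ((PolyBdd.const 1).add (hv.size.mul ((PolyBdd.const 3).add
      (hv.size.add (hW.length_bdd.mul hD)))))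
    (fun a i u => VecBound (enc (v a)).size ((enc (v a)).size + i * D a) u) hW hv
    (fun a => by simpa using vecBound_of_size (v a)) ?_ ?_
    fun _ _ _ _ _ _ _ hs hx _ _ => hs.reduceStep hx
  · intro a i u r hr _ hu
    refine (hu.reduceStep (size_le_of_mem hr)).mono ?_
    have h3 : (i + 1) * D a = i * D a + D a := Nat.succ_mul _ _
    have h4 : D a = (enc (v a)).size + 2 * (enc (W a)).size + 1 := rfl
    have h5 : (enc (W a)).size = (enc ((O a).flatMap fun _ => rows a)).size := rfl
    omega
  · intro a i u hi hu
    refine (hu.mono ?_).size_le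
    exact Nat.add_le_add_left (Nat.mul_le_mul_right _ hi) _

theorem presentation {G : α → List RawPoly} {O : α → List (List ℕ)} {tbl : α → Table}
    (hG : PTime e G) (hO : PTime e O) (htbl : PTime e tbl) :
    PTime e fun a => presentation (G a) (O a) (tbl a) := by
  have hrows : PTime e fun a => (O a).map (PolyTime.reductionRow (G a) (O a) (tbl a)) :=
    hO.map (g := fun a t => PolyTime.reductionRow (G a) (O a) (tbl a) t) fun _ _ _ _ _ hE hx _ =>
      (hG.at' hE).reductionRow (hO.at' hE) (htbl.at' hE) hx
  refine hO.pair (pair ?_ ?_)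
  · refine (hrows.filter (g := fun _ (r : List ℤ × ℤ × List ℤ) => !decide (r.2.1 = 0))
      fun _ _ _ _ _ hE hx _ => (hx.snd.fst.eq (const_int 0 hx.size_env)).not).map
      (g := fun a r => PolyTime.relation (O a)
        ((O a).map (PolyTime.reductionRow (G a) (O a) (tbl a))) r) fun _ _ _ _ _ hE hx _ => ?_
    have h := hx.snd.fst.abs.vsmul hx.fst
    exact h.vadd ((const_int (-1) hx.size_env).vsmul
      ((hO.at' hE).reduce (hrows.at' hE) h))
  · refine hO.map (g := fun a t => (O a).map fun u => PolyTime.reduce (O a)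
      ((O a).map (PolyTime.reductionRow (G a) (O a) (tbl a)))
      (PolyTime.lookup (PolyTime.zeroVec (O a)) (tbl a) (PolyTime.tadd t u)))
      fun _ _ _ _ t hE ht _ => ?_
    refine (hO.at' hE).map (g := fun b u => PolyTime.reduce (O _)
      ((O _).map (PolyTime.reductionRow (G _) (O _) (tbl _)))
      (PolyTime.lookup (PolyTime.zeroVec (O _)) (tbl _) (PolyTime.tadd (t b) u)))
      fun _ _ _ _ u hE' hu _ => ?_
    exact ((hO.at' hE).at' hE').reduce ((hrows.at' hE).at' hE')
      (((hO.zeroVec.at' hE).at' hE').lookup ((htbl.at' hE).at' hE') ((ht.at' hE').tadd hu))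

end PTime

instance : Scale (ℕ × List RawPoly) where
  par p := p.1
  len p := (enc p).size + expBound p.1 p.2

/-- One program performs the algorithm, in polynomial time for each number of indeterminates. -/
theorem exists_prog : ∃ P : Prog, ∀ n, ∃ c, ∀ G : List RawPoly,
    ∃ t ≤ ((enc (n, G)).size + expBound n G + 2) ^ c,
      Runs P (enc (n, G)) (enc (algorithm (n, G))) t := by
  have he : PTime (fun p : ℕ × List RawPoly => enc p) fun p => p :=
    (PTime.env (PolyBdd.len.mono fun p => Nat.le_add_right _ _)).congr_enc fun _ => rfl
  have hX : PolyBdd fun p : ℕ × List RawPoly => expBound p.1 p.2 :=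
    PolyBdd.len.mono fun p => Nat.le_add_left _ _
  have hM := he.fst.boxBound he.snd (fun _ => rfl) hX
  have hB := he.fst.box (fun _ => rfl) hM (PTime.boxBound_bdd (fun _ => rfl) hX)
  have hO := he.snd.standardTerms hB
  obtain ⟨P, T, hT, h⟩ := he.snd.presentation hO (he.snd.table hB hO)
  refine ⟨P, fun n => ?_⟩
  obtain ⟨c, hc⟩ := hT n
  refine ⟨c, fun G => ?_⟩
  obtain ⟨t, ht, hr⟩ := h (n, G)
  exact ⟨t, ht.trans (hc (n, G) rfl), hr⟩

end PolyTime


namespace MonomialOrder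

variable {n : ℕ} (m : MonomialOrder (Fin n))

theorem toSyn_single_mul (i : Fin n) (a b : ℕ) :
    m.toSyn (Finsupp.single i (a * b)) = a • m.toSyn (Finsupp.single i b) := by
  rw [← map_nsmul, Finsupp.smul_single, smul_eq_mul]

theorem toSyn_single (i : Fin n) (a : ℕ) :
    m.toSyn (Finsupp.single i a) = a • m.toSyn (Finsupp.single i 1) := by
  rw [← toSyn_single_mul, mul_one]

theorem toSyn_single_pos (i : Fin n) : 0 < m.toSyn (Finsupp.single i 1) := by
  rw [toSyn_lt_iff_ne_zero, Ne, toSyn_eq_zero_iff]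
  simp

theorem le_of_toSyn_single_le {i : Fin n} {a b : ℕ}
    (h : m.toSyn (Finsupp.single i a) ≤ m.toSyn (Finsupp.single i b)) : a ≤ b := by
  rw [toSyn_single, toSyn_single m i b] at h
  exact (nsmul_le_nsmul_iff_left (m.toSyn_single_pos i)).1 h

theorem toSyn_filter_le (C : Finset (Fin n)) {i₀ : Fin n} {e : Fin n →₀ ℕ} {E : ℕ}
    (hC : ∀ j ∈ C, m.toSyn (Finsupp.single j 1) ≤ m.toSyn (Finsupp.single i₀ 1))
    (he : ∀ j, e j ≤ E) :
    m.toSyn (e.filter (· ∈ C)) ≤ m.toSyn (Finsupp.single i₀ (n * E)) := by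
  have h1 : e.filter (· ∈ C) = ∑ j ∈ C, Finsupp.single j (e j) := by
    ext k
    rw [Finsupp.finsetSum_apply, Finsupp.filter_apply]
    simp [Finsupp.single_apply]
  rw [h1, map_sum, toSyn_single_mul]
  refine (Finset.sum_le_card_nsmul C _ (m.toSyn (Finsupp.single i₀ E)) fun j hj => ?_).trans ?_
  · rw [toSyn_single, toSyn_single m i₀ E]
    exact (nsmul_le_nsmul_right (hC j hj) _).trans
      (nsmul_le_nsmul_left (m.toSyn_single_pos i₀).le (he j))
  · refine nsmul_le_nsmul_left (m.zero_le _) ?_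
    simpa using Finset.card_le_univ C

end MonomialOrder

theorem exists_eq_succ_of_monotone {n : ℕ} {C : ℕ → Finset (Fin n)} (hC : Monotone C) :
    ∃ s ≤ n, C s = C (s + 1) := by
  by_contra! h
  have : ∀ s ≤ n + 1, s ≤ (C s).card := by
    intro s
    induction s with
    | zero => simp
    | succ s ih =>
      intro hs
      have h1 := ih (by omega)
      have h2 := Finset.card_lt_card ((hC (Nat.le_succ s)).lt_of_ne (h s (by omega)))
      have : s.succ = s + 1 := rfl
      rw [this] at h2
      omega
  have h1 := this (n + 1) le_rfl
  have h2 := Finset.card_le_univ (C (n + 1))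
  rw [Fintype.card_fin] at h2
  omega

theorem exponent_bound (n a : ℕ) (ha : 1 ≤ a) :
    a + (1 + n * (n + 2 + a)) + 1 ≤ a * 2 ^ (2 * n + 2) := by
  have h : n * n + 3 * n + 3 ≤ 2 ^ (2 * n + 2) := by
    induction n with
    | zero => norm_num
    | succ n ih =>
      rw [show 2 * (n + 1) + 2 = (2 * n + 2) + 2 by ring, pow_add]
      nlinarith
  calc a + (1 + n * (n + 2 + a)) + 1 ≤ a * (n * n + 3 * n + 3) := by
        obtain ⟨b, rfl⟩ := Nat.exists_eq_add_of_le ha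
        ring_nf
        nlinarith [Nat.zero_le (b * n), Nat.zero_le (b * n * n), Nat.zero_le (b * n^2)]
    _ ≤ _ := Nat.mul_le_mul_left _ h

theorem box_growth {n B X R s : ℕ} (hBX : B ≤ X) (hX : n + 2 ≤ X) (hR : R ≤ X ^ n) :
    n * X ^ 2 ^ s * R ≤ X ^ 2 ^ (s + (2 * n + 2)) ∧
    X ^ 2 ^ s + B * (n * X ^ 2 ^ s * R + 1) ^ n ≤ X ^ 2 ^ (s + (2 * n + 2)) := by
  have hX0 : 0 < X := by omega
  have hL : n * X ^ 2 ^ s * R + 1 ≤ X ^ (n + 2 + 2 ^ s) := by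
    have h1 : n * X ^ 2 ^ s * R ≤ X ^ (n + 1 + 2 ^ s) := by
      calc n * X ^ 2 ^ s * R ≤ X * X ^ 2 ^ s * X ^ n :=
            Nat.mul_le_mul (Nat.mul_le_mul_right _ (by omega)) hR
        _ = X ^ (n + 1 + 2 ^ s) := by ring
    have h2 : 1 ≤ X ^ (n + 1 + 2 ^ s) := Nat.one_le_pow _ _ hX0
    have h3 : X ^ (n + 2 + 2 ^ s) = X * X ^ (n + 1 + 2 ^ s) := by ring
    rw [h3]
    nlinarith
  have hs : 1 ≤ 2 ^ s := Nat.one_le_two_pow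
  have hexp := exponent_bound n (2 ^ s) hs
  rw [← pow_add] at hexp
  constructor
  · refine (Nat.le_succ _).trans (hL.trans (Nat.pow_le_pow_right hX0 ?_))
    rcases Nat.eq_zero_or_pos n with rfl | hn
    · rw [pow_add]
      omega
    · have : 1 * (n + 2 + 2 ^ s) ≤ n * (n + 2 + 2 ^ s) := Nat.mul_le_mul_right _ hn
      omega
  · calc X ^ 2 ^ s + B * (n * X ^ 2 ^ s * R + 1) ^ n
        ≤ X ^ 2 ^ s + X * (X ^ (n + 2 + 2 ^ s)) ^ n :=
          Nat.add_le_add_left (Nat.mul_le_mul hBX (Nat.pow_le_pow_left hL n)) _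
      _ = X ^ 2 ^ s + X ^ (1 + n * (n + 2 + 2 ^ s)) := by
          rw [← pow_mul, pow_add, pow_one, mul_comm n]
      _ ≤ X ^ (2 ^ s + (1 + n * (n + 2 + 2 ^ s))) + X ^ (2 ^ s + (1 + n * (n + 2 + 2 ^ s))) :=
          Nat.add_le_add (Nat.pow_le_pow_right hX0 (by omega))
            (Nat.pow_le_pow_right hX0 (by omega))
      _ ≤ X ^ (2 ^ s + (1 + n * (n + 2 + 2 ^ s)) + 1) := by
          rw [pow_succ]
          nlinarith [Nat.zero_le (X ^ (2 ^ s + (1 + n * (n + 2 + 2 ^ s))))]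
      _ ≤ X ^ 2 ^ (s + (2 * n + 2)) := Nat.pow_le_pow_right hX0 hexp

/-- Given reductions of `xᵢ ^ dᵢ` to smaller terms, a box is contained in a set that is closed under
certain reductions and lies in a box that is only polynomially larger. The variables in `V` are
those that are already reduced, and the reduction of other variables does not affect them. -/
theorem exists_closed_set {n : ℕ} (m : MonomialOrder (Fin n)) {B X : ℕ} (hB : 1 ≤ B)
    (hBX : B ≤ X) (hX : n + 2 ≤ X) {d : Fin n → ℕ} (hd : ∀ i, d i ≤ B) {A : Fin n → Set (Fin n →₀ ℕ)}
    (hA : ∀ i, ∀ a ∈ A i, m.toSyn a < m.toSyn (Finsupp.single i (d i)))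
    (hAB : ∀ i, ∀ a ∈ A i, ∀ j, a j ≤ B) (c : ℕ) :
    ∀ V : Finset (Fin n), Vᶜ.card ≤ c →
      (∀ i ∉ V, ∀ j ∈ V, m.toSyn (Finsupp.single i B) < m.toSyn (Finsupp.single j 1)) →
      ∀ s, ∃ T : Set (Fin n →₀ ℕ),
        (∀ e ∈ T, ∀ j, e j ≤ X ^ 2 ^ (s + c * (2 * n + 2))) ∧
        (∀ e, (∀ j, e j ≤ X ^ 2 ^ s) → (∀ j ∈ V, e j < d j) → e ∈ T) ∧
        ∀ e ∈ T, (∀ i, e i < d i) ∨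
          ∃ i, d i ≤ e i ∧ ∀ a ∈ A i, e - Finsupp.single i (d i) + a ∈ T := by
  have hX0 : 0 < X := by omega
  induction c with
  | zero =>
    intro V hV _ s
    have hV : ∀ j, j ∈ V := fun j => by
      have := Finset.card_eq_zero.1 (Nat.le_zero.1 hV)
      rw [Finset.compl_eq_empty_iff, Finset.eq_univ_iff_forall] at this
      exact this j
    refine ⟨{e | (∀ j, e j ≤ X ^ 2 ^ s) ∧ ∀ j, e j < d j}, fun e he => by simpa using he.1,
      fun e h1 h2 => ⟨h1, fun j => h2 j (hV j)⟩, fun e he => .inl he.2⟩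
  | succ c ih =>
    intro V hVc hV s
    rcases Finset.eq_empty_or_nonempty Vᶜ with h0 | hne
    · obtain ⟨T, h1, h2, h3⟩ := ih V (by simp [h0]) hV s
      refine ⟨T, fun e he j => (h1 e he j).trans ?_, h2, h3⟩
      exact Nat.pow_le_pow_right hX0 (Nat.pow_le_pow_right (by omega)
        (Nat.add_le_add_left (Nat.mul_le_mul_right _ (by omega)) _))
    obtain ⟨i₀, hi₀, hmax⟩ := Finset.exists_max_image Vᶜ
      (fun j => m.toSyn (Finsupp.single j 1)) hne
    rw [Finset.mem_compl] at hi₀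
    let Cs : ℕ → Finset (Fin n) := fun r => Vᶜ.filter fun j =>
      m.toSyn (Finsupp.single i₀ 1) ≤ m.toSyn (Finsupp.single j (B ^ r))
    have hmono : Monotone Cs := monotone_nat_of_le_succ fun r j hj => by
      simp only [Cs, Finset.mem_filter] at hj ⊢
      refine ⟨hj.1, hj.2.trans (m.toSyn_monotone ?_)⟩
      rw [Finsupp.single_le_single]
      exact Nat.pow_le_pow_right hB (by omega)
    obtain ⟨r, hr, hCs⟩ := exists_eq_succ_of_monotone hmono
    let C := Cs r
    have hC0 : i₀ ∈ C := by
      simp only [C, Cs, Finset.mem_filter, Finset.mem_compl]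
      refine ⟨hi₀, m.toSyn_monotone ?_⟩
      rw [Finsupp.single_le_single]
      exact Nat.one_le_pow _ _ hB
    have hCV : ∀ j ∈ C, j ∉ V := fun j hj => by
      simp only [C, Cs, Finset.mem_filter, Finset.mem_compl] at hj
      exact hj.1
    have hCr : ∀ j ∈ C, m.toSyn (Finsupp.single i₀ 1) ≤ m.toSyn (Finsupp.single j (B ^ r)) :=
      fun j hj => by
        simp only [C, Cs, Finset.mem_filter] at hj
        exact hj.2
    have hCmax : ∀ j ∈ C, m.toSyn (Finsupp.single j 1) ≤ m.toSyn (Finsupp.single i₀ 1) :=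
      fun j hj => hmax j (Finset.mem_compl.2 (hCV j hj))
    have hV' : ∀ i ∉ V ∪ C, ∀ j ∈ V ∪ C,
        m.toSyn (Finsupp.single i B) < m.toSyn (Finsupp.single j 1) := by
      intro i hi j hj
      rw [Finset.notMem_union] at hi
      rcases Finset.mem_union.1 hj with hj | hj
      · exact hV i hi.1 j hj
      · have h1 : i ∉ Cs (r + 1) := by rw [← hCs]; exact hi.2
        simp only [Cs, Finset.mem_filter, Finset.mem_compl, not_and, not_le] at h1
        have h2 := (h1 hi.1).trans_le (hCr j hj)
        by_contra! h3
        rw [pow_succ, m.toSyn_single_mul, m.toSyn_single j (B ^ r)] at h2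
        exact h2.not_ge (nsmul_le_nsmul_right h3 _)
    have hcard : (V ∪ C)ᶜ.card ≤ c := by
      have : (V ∪ C)ᶜ ⊂ Vᶜ := by
        rw [Finset.compl_ssubset_compl]
        refine ⟨Finset.subset_union_left, fun h => hi₀ (h (Finset.mem_union_right _ hC0))⟩
      have := Finset.card_lt_card this
      omega
    set E := X ^ 2 ^ s with hE
    set L := n * E * B ^ r with hLdef
    have hgrow := box_growth (s := s) (R := B ^ r) hBX hX
      ((Nat.pow_le_pow_left hBX r).trans (Nat.pow_le_pow_right hX0 hr))
    rw [← hE, ← hLdef] at hgrow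
    obtain ⟨T', hT1, hT2, hT3⟩ := ih (V ∪ C) hcard hV' (s + (2 * n + 2))
    set E' := X ^ 2 ^ (s + (2 * n + 2)) with hE'
    have hbig : X ^ 2 ^ (s + (2 * n + 2) + c * (2 * n + 2)) =
        X ^ 2 ^ (s + (c + 1) * (2 * n + 2)) := by
      congr 2
      ring
    have hE'le : E' ≤ X ^ 2 ^ (s + (c + 1) * (2 * n + 2)) := by
      refine Nat.pow_le_pow_right hX0 (Nat.pow_le_pow_right (by omega) ?_)
      rw [add_one_mul]
      omega
    have hBE : B ≤ E' := by
      refine hBX.trans ?_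
      calc X = X ^ 1 := (pow_one X).symm
        _ ≤ E' := Nat.pow_le_pow_right hX0 Nat.one_le_two_pow
    let cp : (Fin n →₀ ℕ) → (Fin n →₀ ℕ) := fun e => e.filter (· ∈ C)
    let S : Finset (Fin n →₀ ℕ) := Finset.Iic (Finsupp.equivFunOnFinite.symm fun _ => L)
    have hScard : S.card ≤ (L + 1) ^ n := by
      rw [Finsupp.card_Iic]
      refine (Finset.prod_le_pow_card _ _ (L + 1) fun i _ => by simp).trans ?_
      refine Nat.pow_le_pow_right (by omega) ?_
      exact (Finset.card_le_univ _).trans (by simp)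
    let N : (Fin n →₀ ℕ) → ℕ := fun e => (S.filter fun p => m.toSyn (cp e) ≤ m.toSyn p).card
    have hN : ∀ e, E + B * N e ≤ E' := fun e =>
      (Nat.add_le_add_left (Nat.mul_le_mul_left _
        ((Finset.card_filter_le _ _).trans hScard)) _).trans hgrow.2
    have hcpL : ∀ e : Fin n →₀ ℕ, m.toSyn (cp e) ≤ m.toSyn (Finsupp.single i₀ (n * E)) →
        ∀ j ∈ C, e j ≤ L := by
      intro e he j hj
      refine m.le_of_toSyn_single_le (i := j) ((m.toSyn_monotone ?_).trans (he.trans ?_))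
      · intro k
        simp only [cp, Finsupp.filter_apply, Finsupp.single_apply]
        split_ifs with h1 h2 h2
        · rw [h1]
        · exact absurd (h1 ▸ hj) h2
        · omega
        · omega
      · rw [m.toSyn_single, hLdef, m.toSyn_single_mul]
        exact nsmul_le_nsmul_right (hCr j hj) _
    let U : Set (Fin n →₀ ℕ) := {e | (∀ j ∈ V, e j < d j) ∧
      m.toSyn (cp e) ≤ m.toSyn (Finsupp.single i₀ (n * E)) ∧ ∀ j ∉ V ∪ C, e j ≤ E + B * N e}
    have hUE : ∀ e ∈ U, ∀ j, e j ≤ E' := by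
      rintro e ⟨h1, h2, h3⟩ j
      by_cases hjV : j ∈ V
      · exact (h1 j hjV).le.trans ((hd j).trans hBE)
      by_cases hjC : j ∈ C
      · exact (hcpL e h2 j hjC).trans hgrow.1
      · exact (h3 j (by simp [hjV, hjC])).trans (hN e)
    refine ⟨U ∪ T', ?_, ?_, ?_⟩
    · rintro e (he | he) j
      · exact (hUE e he j).trans hE'le
      · rw [← hbig]
        exact hT1 e he j
    · intro e h1 h2
      exact .inl ⟨h2, m.toSyn_filter_le C hCmax h1, fun j _ => (h1 j).trans (Nat.le_add_right _ _)⟩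
    · rintro e (he | he)
      · by_cases hred : ∀ j ∈ C, e j < d j
        · have : e ∈ T' := hT2 e (hUE e he) fun j hj => by
            rcases Finset.mem_union.1 hj with hj | hj
            · exact he.1 j hj
            · exact hred j hj
          rcases hT3 e this with h | ⟨i, hi, h⟩
          · exact .inl h
          · exact .inr ⟨i, hi, fun a ha => .inr (h a ha)⟩
        · push Not at hred
          obtain ⟨i, hiC, hi⟩ := hred
          refine .inr ⟨i, hi, fun a ha => .inl ?_⟩
          obtain ⟨h1, h2, h3⟩ := he
          have hai := hA i a ha
          have hiV := hCV i hiC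
          have hcp : m.toSyn (cp (e - Finsupp.single i (d i) + a)) < m.toSyn (cp e) := by
            have e1 : cp e = cp (e - Finsupp.single i (d i)) + Finsupp.single i (d i) := by
              ext k
              simp only [cp, Finsupp.add_apply, Finsupp.filter_apply, Finsupp.tsub_apply,
                Finsupp.single_apply]
              by_cases hk : i = k
              · subst hk
                simp only [hiC, if_true]
                omega
              · simp [hk]
            have e2 : cp (e - Finsupp.single i (d i) + a) =
                cp (e - Finsupp.single i (d i)) + cp a := Finsupp.filter_add
            rw [e1, e2, map_add, map_add]
            refine add_lt_add_right (lt_of_le_of_lt (m.toSyn_monotone ?_) hai) _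
            intro k
            simp only [cp, Finsupp.filter_apply]
            split_ifs <;> omega
          refine ⟨fun j hj => ?_, hcp.le.trans h2, fun j hj => ?_⟩
          · have haj : a j = 0 := by
              by_contra hne
              refine (hV i hiV j hj).not_ge ?_
              refine (m.toSyn_monotone (a := Finsupp.single j 1) (b := a) ?_).trans
                (hai.le.trans (m.toSyn_monotone ?_))
              · rw [Finsupp.single_le_iff]
                omega
              · rw [Finsupp.single_le_single]
                exact hd i
            have := h1 j hj
            simp only [Finsupp.add_apply, Finsupp.tsub_apply, haj]
            omega
          · have h4 := h3 j hj
            have h5 := hAB i a ha j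
            have h6 : N e + 1 ≤ N (e - Finsupp.single i (d i) + a) := by
              refine Finset.card_lt_card ?_
              have hmem : cp (e - Finsupp.single i (d i) + a) ∈ S := by
                rw [Finset.mem_Iic]
                intro k
                simp only [cp, Finsupp.filter_apply, Finsupp.equivFunOnFinite_symm_apply_apply]
                split_ifs with hk
                · exact hcpL _ (hcp.le.trans h2) k hk
                · omega
              refine ⟨fun p hp => ?_, fun h => ?_⟩
              · rw [Finset.mem_filter] at hp ⊢
                exact ⟨hp.1, hcp.le.trans hp.2⟩
              · have := h (Finset.mem_filter.2 ⟨hmem, le_rfl⟩)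
                rw [Finset.mem_filter] at this
                exact hcp.not_ge this.2
            have h7 := Nat.mul_le_mul_left B h6
            rw [Nat.mul_succ] at h7
            simp only [Finsupp.add_apply, Finsupp.tsub_apply]
            omega
      · rcases hT3 e he with h | ⟨i, hi, h⟩
        · exact .inl h
        · exact .inr ⟨i, hi, fun a ha => .inr (h a ha)⟩


section Groebner

variable {n k : ℕ} {m : MonomialOrder (Fin n)} {I : Ideal (MvPolynomial (Fin n) ℤ)}
  {G : List (MvPolynomial (Fin n) ℤ)} {t : Fin k → (Fin n →₀ ℕ)}

/-! ## Leading monomials -/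

theorem MonomialOrder.degree_eq_of_forall_le {f : MvPolynomial (Fin n) ℤ} {e : Fin n →₀ ℕ}
    (h : ∀ a ∈ f.support, m.toSyn a ≤ m.toSyn e) (he : f.coeff e ≠ 0) : m.degree f = e := by
  refine m.toSyn.injective (le_antisymm (m.degree_le_iff.2 h) (m.le_degree ?_))
  rwa [mem_support_iff]

theorem leadingTerm_dvd_leadingTerm {f g : MvPolynomial (Fin n) ℤ} (hf : f ≠ 0) :
    m.leadingTerm g ∣ m.leadingTerm f ↔
      m.degree g ≤ m.degree f ∧ m.leadingCoeff g ∣ m.leadingCoeff f := by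
  rw [MonomialOrder.leadingTerm, MonomialOrder.leadingTerm, monomial_dvd_monomial]
  have := m.leadingCoeff_ne_zero_iff.2 hf
  tauto

/-- Multiplying by a monomial moves the leading monomial. -/
theorem degree_monomial_mul {g : MvPolynomial (Fin n) ℤ} (hg : g ≠ 0) (s : Fin n →₀ ℕ) {c : ℤ}
    (hc : c ≠ 0) : m.degree (monomial s c * g) = s + m.degree g := by
  rw [m.degree_mul (by rwa [Ne, monomial_eq_zero]) hg, m.degree_monomial, if_neg hc]

theorem support_monomial_mul_le (g : MvPolynomial (Fin n) ℤ) (s : Fin n →₀ ℕ) (c : ℤ)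
    {a : Fin n →₀ ℕ} (ha : (monomial s c * g).coeff a ≠ 0) :
    m.toSyn a ≤ m.toSyn (s + m.degree g) := by
  by_cases hg : g = 0
  · simp [hg] at ha
  by_cases hc : c = 0
  · simp [hc] at ha
  rw [← degree_monomial_mul hg s hc]
  exact m.le_degree (mem_support_iff.2 ha)

theorem coeff_monomial_mul_degree (g : MvPolynomial (Fin n) ℤ) (s : Fin n →₀ ℕ) (c : ℤ) :
    (monomial s c * g).coeff (s + m.degree g) = c * m.leadingCoeff g :=
  coeff_monomial_mul ..

theorem monomial_mem_leadingMonomials_of_dvd {g : MvPolynomial (Fin n) ℤ} (hg : g ∈ I)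
    {e : Fin n →₀ ℕ} (he : m.degree g ≤ e) {c : ℤ} (hc : c ≠ 0) (hd : m.leadingCoeff g ∣ c) :
    monomial e c ∈ leadingMonomials m I := by
  obtain ⟨q, rfl⟩ := hd
  have hg0 : g ≠ 0 := by
    rintro rfl
    simp at hc
  have hq : q ≠ 0 := right_ne_zero_of_mul hc
  refine ⟨monomial (e - m.degree g) q * g, I.mul_mem_left _ hg,
    mul_ne_zero (by rwa [Ne, monomial_eq_zero]) hg0, ?_⟩
  have h := degree_monomial_mul (m := m) hg0 (e - m.degree g) hq
  rw [MonomialOrder.leadingTerm, MonomialOrder.leadingCoeff, h, coeff_monomial_mul_degree,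
    tsub_add_cancel_of_le he, mul_comm]

theorem degree_of_leadingTerm_eq {f : MvPolynomial (Fin n) ℤ} {e : Fin n →₀ ℕ} {c : ℤ}
    (hc : c ≠ 0) (h : m.leadingTerm f = monomial e c) :
    m.degree f = e ∧ m.leadingCoeff f = c := by
  rw [MonomialOrder.leadingTerm, monomial_eq_monomial_iff] at h
  tauto

/-- A monomial is a leading monomial of `I` if and only if a leading monomial of `G` divides it. -/
theorem monomial_mem_leadingMonomials_iff (hG : IsStrongGroebnerBasis m I G) {e : Fin n →₀ ℕ}
    {c : ℤ} (hc : c ≠ 0) : monomial e c ∈ leadingMonomials m I ↔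
      ∃ g ∈ G, m.degree g ≤ e ∧ m.leadingCoeff g ∣ c := by
  constructor
  · rintro ⟨f, hf, hf0, h⟩
    obtain ⟨h1, h2⟩ := degree_of_leadingTerm_eq hc h
    obtain ⟨g, hg, hd⟩ := hG.2 f hf hf0
    rw [leadingTerm_dvd_leadingTerm hf0, h1, h2] at hd
    exact ⟨g, hg, hd⟩
  · rintro ⟨g, hg, he, hd⟩
    exact monomial_mem_leadingMonomials_of_dvd (hG.1 g hg) he hc hd

theorem mem_monicLeadingTerms_iff (hG : IsStrongGroebnerBasis m I G) {e : Fin n →₀ ℕ} :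
    e ∈ monicLeadingTerms m I ↔ ∃ g ∈ G, m.degree g ≤ e ∧ |m.leadingCoeff g| = 1 := by
  refine (monomial_mem_leadingMonomials_iff hG one_ne_zero).trans ?_
  simp only [← Int.isUnit_iff_abs_eq, isUnit_iff_dvd_one]

/-- The leading coefficients in `I` at a given term are the multiples of the smallest leading
coefficient among the elements of `G` whose leading term divides that term. -/
theorem leadingCoeff_dvd_of_minimal (hG : IsStrongGroebnerBasis m I G)
    {f g : MvPolynomial (Fin n) ℤ} (hf : f ∈ I) (hg : g ∈ G) (hg0 : g ≠ 0)
    (hle : m.degree g ≤ m.degree f)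
    (hmin : ∀ g' ∈ G, m.degree g' ≤ m.degree f → |m.leadingCoeff g| ≤ |m.leadingCoeff g'|) :
    m.leadingCoeff g ∣ m.leadingCoeff f := by
  by_contra hnd
  have hl : m.leadingCoeff g ≠ 0 := m.leadingCoeff_ne_zero_iff.2 hg0
  set q := m.leadingCoeff f / m.leadingCoeff g
  set r := m.leadingCoeff f % m.leadingCoeff g
  have hr : r ≠ 0 := fun h => hnd (Int.dvd_of_emod_eq_zero h)
  set f' := f - monomial (m.degree f - m.degree g) q * g
  have hs : m.degree f - m.degree g + m.degree g = m.degree f := tsub_add_cancel_of_le hle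
  have hco : f'.coeff (m.degree f) = r := by
    have := coeff_monomial_mul_degree (m := m) g (m.degree f - m.degree g) q
    rw [hs] at this
    rw [coeff_sub, this]
    have h1 := Int.emod_add_mul_ediv (m.leadingCoeff f) (m.leadingCoeff g)
    have h2 : f.coeff (m.degree f) = m.leadingCoeff f := rfl
    rw [h2]
    linarith
  have hdeg : m.degree f' = m.degree f := by
    refine MonomialOrder.degree_eq_of_forall_le (fun a ha => ?_) (by rwa [hco])
    rw [mem_support_iff, coeff_sub] at ha
    by_cases h1 : f.coeff a = 0
    · have h2 : (monomial (m.degree f - m.degree g) q * g).coeff a ≠ 0 := by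
        intro h
        rw [h1, h] at ha
        simp at ha
      have := support_monomial_mul_le (m := m) g _ _ h2
      rwa [hs] at this
    · exact m.le_degree (mem_support_iff.2 h1)
  have hf' : f' ∈ I := I.sub_mem hf (I.mul_mem_left _ (hG.1 g hg))
  have hf0 : f' ≠ 0 := by
    intro h
    rw [h] at hco
    exact hr (by simpa using hco.symm)
  obtain ⟨g', hg', hd⟩ := hG.2 f' hf' hf0
  rw [leadingTerm_dvd_leadingTerm hf0, hdeg] at hd
  have h1 := hmin g' hg' hd.1
  have h2 : m.leadingCoeff f' = r := by rw [MonomialOrder.leadingCoeff, hdeg, hco]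
  rw [h2] at hd
  have h3 : |m.leadingCoeff g'| ≤ |r| := Int.le_of_dvd (abs_pos.2 hr) ((abs_dvd_abs _ _).2 hd.2)
  have h4 : |r| < |m.leadingCoeff g| := by
    rw [abs_of_nonneg (Int.emod_nonneg _ hl)]
    exact Int.emod_lt_abs _ hl
  omega

/-! ## Combinations of terms -/

theorem coeff_combination (t : Fin k → (Fin n →₀ ℕ)) (d : Fin k → ℤ) (e : Fin n →₀ ℕ) :
    (combination t d).coeff e = ∑ i, if t i = e then d i else 0 := by
  simp [combination, coeff_sum, coeff_monomial]

theorem coeff_combination_self (ht : Function.Injective t) (d : Fin k → ℤ) (i : Fin k) :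
    (combination t d).coeff (t i) = d i := by
  simp [coeff_combination, ht.eq_iff]

theorem exists_of_coeff_combination_ne_zero (ht : Function.Injective t) {d : Fin k → ℤ}
    {e : Fin n →₀ ℕ} (h : (combination t d).coeff e ≠ 0) : ∃ i, t i = e ∧ d i ≠ 0 := by
  by_cases he : ∃ i, t i = e
  · obtain ⟨i, rfl⟩ := he
    rw [coeff_combination_self ht] at h
    exact ⟨i, rfl, h⟩
  · push Not at he
    simp [coeff_combination, he] at h

theorem combination_add (t : Fin k → (Fin n →₀ ℕ)) (d d' : Fin k → ℤ) :
    combination t (d + d') = combination t d + combination t d' := by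
  simp [combination, Finset.sum_add_distrib]

theorem combination_smul (t : Fin k → (Fin n →₀ ℕ)) (c : ℤ) (d : Fin k → ℤ) :
    combination t (c • d) = c • combination t d := by
  simp [combination, Finset.smul_sum, smul_monomial]

theorem combination_sub (t : Fin k → (Fin n →₀ ℕ)) (d d' : Fin k → ℤ) :
    combination t (d - d') = combination t d - combination t d' := by
  simp [combination, Finset.sum_sub_distrib]

theorem combination_single (t : Fin k → (Fin n →₀ ℕ)) (i : Fin k) (c : ℤ) :
    combination t (Pi.single i c) = monomial (t i) c := by
  rw [combination, Finset.sum_eq_single i]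
  · simp
  · intro j _ hj
    simp [hj]
  · simp

theorem linearCombination_eq_mk_combination (t : Fin k → (Fin n →₀ ℕ)) (d : Fin k → ℤ) :
    Fintype.linearCombination ℤ (fun i => Ideal.Quotient.mk I (monomial (t i) 1)) d =
      Ideal.Quotient.mk I (combination t d) := by
  rw [Fintype.linearCombination_apply, combination, map_sum]
  refine Finset.sum_congr rfl fun i _ => ?_
  rw [← map_zsmul, smul_monomial, smul_eq_mul, mul_one]

/-- A combination of standard terms with small coefficients is a normal form. -/
theorem isNormalForm_combination (hG : IsStrongGroebnerBasis m I G) (ht : Function.Injective t)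
    {f : MvPolynomial (Fin n) ℤ} {d : Fin k → ℤ} (hf : f - combination t d ∈ I)
    (hd : ∀ i, ∀ g ∈ G, m.degree g ≤ t i → |d i| < |m.leadingCoeff g|) :
    IsNormalForm m I f (combination t d) := by
  refine ⟨hf, fun e he hmem => ?_⟩
  rw [mem_support_iff] at he
  obtain ⟨g, hg, hle, hdvd⟩ := (monomial_mem_leadingMonomials_iff hG he).1 hmem
  obtain ⟨i, rfl, hi⟩ := exists_of_coeff_combination_ne_zero ht he
  rw [coeff_combination_self ht] at hdvd
  have h1 := hd i g hg hle
  have h2 := Int.le_of_dvd (abs_pos.2 hi) ((abs_dvd_abs _ _).2 hdvd)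
  omega

/-! ## Explicit representations -/

/-- The standard terms generate the quotient. -/
theorem span_standardTerms (hr : Set.range t = (monicLeadingTerms m I)ᶜ) :
    Submodule.span ℤ (Set.range fun i => Ideal.Quotient.mk I (monomial (t i) (1 : ℤ))) = ⊤ := by
  set N := Submodule.span ℤ (Set.range fun i => Ideal.Quotient.mk I (monomial (t i) (1 : ℤ)))
  have hpoly : ∀ f : MvPolynomial (Fin n) ℤ,
      (∀ a ∈ f.support, Ideal.Quotient.mk I (monomial a (1 : ℤ)) ∈ N) →
      Ideal.Quotient.mk I f ∈ N := by
    intro f hf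
    rw [f.as_sum, map_sum]
    refine N.sum_mem fun a ha => ?_
    have : monomial a (f.coeff a) = f.coeff a • monomial a (1 : ℤ) := by
      rw [smul_monomial, smul_eq_mul, mul_one]
    rw [this, map_zsmul]
    exact N.smul_mem _ (hf a ha)
  have key : ∀ x : m.syn, ∀ a, m.toSyn a = x →
      Ideal.Quotient.mk I (monomial a (1 : ℤ)) ∈ N := by
    intro x
    induction x using WellFoundedLT.induction with
    | ind x ih =>
      rintro a rfl
      by_cases ha : a ∈ monicLeadingTerms m I
      · obtain ⟨f, hf, -, h⟩ := ha
        obtain ⟨h1, h2⟩ := degree_of_leadingTerm_eq one_ne_zero h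
        have : Ideal.Quotient.mk I (monomial a (1 : ℤ)) =
            Ideal.Quotient.mk I (monomial a (1 : ℤ) - f) := by
          rw [map_sub, Ideal.Quotient.eq_zero_iff_mem.2 hf, sub_zero]
        rw [this]
        refine hpoly _ fun b hb => ih (m.toSyn b) (lt_of_le_of_ne ?_ fun hne => ?_) b rfl
        · rw [mem_support_iff, coeff_sub, coeff_monomial] at hb
          by_cases hab : a = b
          · rw [hab]
          · rw [if_neg hab, zero_sub, neg_ne_zero] at hb
            rw [← h1]
            exact m.le_degree (mem_support_iff.2 hb)
        · have hba : b = a := m.toSyn.injective hne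
          have h3 : f.coeff a = 1 := by rw [← h2, ← h1]; rfl
          rw [mem_support_iff, hba, coeff_sub, coeff_monomial, if_pos rfl, h3] at hb
          exact hb rfl
      · have : a ∈ Set.range t := by rw [hr]; exact ha
        obtain ⟨i, rfl⟩ := this
        exact Submodule.subset_span ⟨i, rfl⟩
  rw [eq_top_iff]
  rintro y -
  obtain ⟨f, rfl⟩ := Ideal.Quotient.mk_surjective y
  exact hpoly f fun a _ => key _ a rfl

theorem ModulePresentationRun.spec {O : Finset (Fin k)} {U : List (Fin k → ℤ)}
    (h : ModulePresentationRun m I G t O U) :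
    (∀ u ∈ U, combination t u ∈ I) ∧ ∀ i ∈ O, ∀ l, IsLeast (torsionCoefficients m G (t i)) l →
      ∃ d, Pi.single i l - d ∈ U ∧ IsNormalForm m I (monomial (t i) l) (combination t d) := by
  induction h with
  | done => simp
  | @skip i O U hi hempty _ ih =>
    refine ⟨ih.1, fun j hj l hl => ?_⟩
    by_cases hji : j = i
    · subst hji
      rw [hempty] at hl
      exact absurd hl.1 (Set.notMem_empty l)
    · exact ih.2 j (Finset.mem_erase.2 ⟨hji, hj⟩) l hl
  | @append i O U l d hi hl hd _ ih =>
    constructor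
    · intro u hu
      rcases List.mem_cons.1 hu with rfl | hu
      · rw [combination_sub, combination_single]
        exact hd.1
      · exact ih.1 u hu
    · intro j hj l' hl'
      by_cases hji : j = i
      · subst hji
        obtain rfl := hl.unique hl'
        exact ⟨d, List.mem_cons_self, hd⟩
      · obtain ⟨d', h1, h2⟩ := ih.2 j (Finset.mem_erase.2 ⟨hji, hj⟩) l' hl'
        exact ⟨d', List.mem_cons_of_mem _ h1, h2⟩

theorem exists_isLeast_torsionCoefficients {e : Fin n →₀ ℕ}
    (h : (torsionCoefficients m G e).Nonempty) :
    ∃ l, IsLeast (torsionCoefficients m G e) l := by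
  obtain ⟨l, hl, hmin⟩ := Int.exists_least_of_bdd (P := fun z => z ∈ torsionCoefficients m G e)
    ⟨1, fun z hz => hz.1.le⟩ h
  exact ⟨l, hl, hmin⟩

/-- At a standard term, the smallest torsion coefficient divides the leading coefficients. -/
theorem dvd_leadingCoeff_of_isLeast (hG : IsStrongGroebnerBasis m I G) (hG0 : ∀ g ∈ G, g ≠ 0)
    {f : MvPolynomial (Fin n) ℤ} (hf : f ∈ I) (he : m.degree f ∉ monicLeadingTerms m I) {l : ℤ}
    (hl : IsLeast (torsionCoefficients m G (m.degree f)) l) : l ∣ m.leadingCoeff f := by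
  obtain ⟨h1, g, hg, hle, rfl⟩ := hl.1
  rw [abs_dvd]
  refine leadingCoeff_dvd_of_minimal hG hf hg (hG0 g hg) hle fun g' hg' hle' => hl.2 ⟨?_, g', hg',
    hle', rfl⟩
  have h2 : m.leadingCoeff g' ≠ 0 := m.leadingCoeff_ne_zero_iff.2 (hG0 g' hg')
  have h3 : |m.leadingCoeff g'| ≠ 1 := fun h =>
    he ((mem_monicLeadingTerms_iff hG).2 ⟨g', hg', hle', h⟩)
  have := abs_pos.2 h2
  omega

/-- The normal form of a torsion multiple of a standard term involves only smaller terms. -/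
theorem lt_of_isNormalForm (hG : IsStrongGroebnerBasis m I G) (hG0 : ∀ g ∈ G, g ≠ 0)
    (ht : Function.Injective t) (hr : Set.range t = (monicLeadingTerms m I)ᶜ) {i : Fin k} {l : ℤ}
    (hl : IsLeast (torsionCoefficients m G (t i)) l) {d : Fin k → ℤ}
    (hd : IsNormalForm m I (monomial (t i) l) (combination t d)) {j : Fin k} (hj : d j ≠ 0) :
    m.toSyn (t j) < m.toSyn (t i) := by
  have hti : t i ∉ monicLeadingTerms m I := by
    have : t i ∈ Set.range t := ⟨i, rfl⟩
    rwa [hr] at this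
  have hc0 : combination t d ≠ 0 := fun h => hj (by rw [← coeff_combination_self ht d j, h]; simp)
  have hjd : m.toSyn (t j) ≤ m.toSyn (m.degree (combination t d)) :=
    m.le_degree (by rwa [mem_support_iff, coeff_combination_self ht])
  have hmem := m.degree_mem_support hc0
  have hnot := hd.2 _ hmem
  rw [mem_support_iff] at hmem
  refine hjd.trans_lt ?_
  by_contra! hle
  rcases hle.lt_or_eq with hlt | heq
  · refine hnot ⟨combination t d - monomial (t i) l, ?_, ?_, ?_⟩
    · rw [← neg_sub]
      exact I.neg_mem hd.1
    all_goals
      have h1 : m.toSyn (m.degree (monomial (t i) l)) < m.toSyn (m.degree (combination t d)) :=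
        lt_of_le_of_lt (m.degree_monomial_le l) hlt
    · intro h
      rw [sub_eq_zero] at h
      rw [h] at h1
      exact lt_irrefl _ h1
    · rw [MonomialOrder.leadingTerm, m.degree_sub_of_lt h1, m.leadingCoeff_sub_of_lt h1]
      rfl
  · have heq := m.toSyn.injective heq
    rw [← heq, coeff_combination_self ht] at hnot hmem
    obtain ⟨h1, g, hg, hle, hgl⟩ := hl.1
    refine hnot (monomial_mem_leadingMonomials_of_dvd (hG.1 g hg) hle hmem ?_)
    rw [← abs_dvd, hgl]
    by_cases hli : l = d i
    · rw [hli]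
    set f := monomial (t i) l - combination t d
    have hfc : f.coeff (t i) = l - d i := by
      rw [coeff_sub, coeff_monomial, if_pos rfl, coeff_combination_self ht]
    have hfd : m.degree f = t i := by
      refine MonomialOrder.degree_eq_of_forall_le (fun a ha => ?_)
        (by rw [hfc]; exact sub_ne_zero.2 hli)
      rw [mem_support_iff, coeff_sub, coeff_monomial] at ha
      by_cases hia : t i = a
      · rw [hia]
      · rw [if_neg hia, zero_sub, neg_ne_zero] at ha
        rw [heq]
        exact m.le_degree (mem_support_iff.2 ha)
    have := dvd_leadingCoeff_of_isLeast hG hG0 hd.1 (by rwa [hfd]) (by rwa [hfd])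
    rw [MonomialOrder.leadingCoeff, hfd, hfc] at this
    exact (dvd_sub_right (dvd_refl l)).1 this

/-- The vectors that the procedure returns generate all relations. -/
theorem ModulePresentationRun.span_eq (hG : IsStrongGroebnerBasis m I G) (hG0 : ∀ g ∈ G, g ≠ 0)
    (ht : Function.Injective t) (hr : Set.range t = (monicLeadingTerms m I)ᶜ)
    {U : List (Fin k → ℤ)} (h : ModulePresentationRun m I G t Finset.univ U) :
    Submodule.span ℤ {u | u ∈ U} = LinearMap.ker (Fintype.linearCombination ℤ
      fun i => Ideal.Quotient.mk I (monomial (t i) (1 : ℤ))) := by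
  obtain ⟨h1, h2⟩ := h.spec
  have hker : ∀ u, u ∈ LinearMap.ker (Fintype.linearCombination ℤ
      fun i => Ideal.Quotient.mk I (monomial (t i) (1 : ℤ))) ↔ combination t u ∈ I := fun u => by
    rw [LinearMap.mem_ker, linearCombination_eq_mk_combination, Ideal.Quotient.eq_zero_iff_mem]
  refine le_antisymm (Submodule.span_le.2 fun u hu => (hker u).2 (h1 u hu)) fun u hu => ?_
  rw [hker] at hu
  suffices ∀ x : m.syn, ∀ u, combination t u ∈ I →
      m.toSyn (m.degree (combination t u)) = x → u ∈ Submodule.span ℤ {u | u ∈ U} from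
    this _ u hu rfl
  intro x
  induction x using WellFoundedLT.induction with
  | ind x ih =>
    rintro u hu rfl
    by_cases hu0 : u = 0
    · rw [hu0]
      exact Submodule.zero_mem _
    have hc0 : combination t u ≠ 0 := fun h0 => hu0 (funext fun j => by
      rw [← coeff_combination_self ht u j, h0]
      simp)
    have hmem := m.degree_mem_support hc0
    rw [mem_support_iff] at hmem
    obtain ⟨i, hi, hui⟩ := exists_of_coeff_combination_ne_zero ht hmem
    have hti : t i ∉ monicLeadingTerms m I := by
      have : t i ∈ Set.range t := ⟨i, rfl⟩
      rwa [hr] at this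
    obtain ⟨g, hg, hd⟩ := hG.2 _ hu hc0
    rw [leadingTerm_dvd_leadingTerm hc0, ← hi] at hd
    obtain ⟨l, hl⟩ := exists_isLeast_torsionCoefficients (m := m) (G := G) (e := t i)
      ⟨|m.leadingCoeff g|, by
        have h3 : m.leadingCoeff g ≠ 0 := m.leadingCoeff_ne_zero_iff.2 (hG0 g hg)
        have h4 : |m.leadingCoeff g| ≠ 1 := fun h =>
          hti ((mem_monicLeadingTerms_iff hG).2 ⟨g, hg, hd.1, h⟩)
        have := abs_pos.2 h3
        omega, g, hg, hd.1, rfl⟩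
    obtain ⟨d, hdU, hdN⟩ := h2 i (Finset.mem_univ i) l hl
    have hdvd := dvd_leadingCoeff_of_isLeast hG hG0 hu (by rwa [← hi]) (by rwa [← hi])
    rw [MonomialOrder.leadingCoeff, ← hi, coeff_combination_self ht] at hdvd
    obtain ⟨q, hq⟩ := hdvd
    set u' := u - q • (Pi.single i l - d) with hu'
    have hlow : ∀ j, u' j ≠ 0 → m.toSyn (t j) < m.toSyn (t i) := by
      intro j hj
      by_cases hdj : d j = 0
      · by_cases hji : j = i
        · subst hji
          refine absurd ?_ hj
          simp only [hu', Pi.sub_apply, Pi.smul_apply, Pi.single_eq_same, hdj, sub_zero,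
            smul_eq_mul, hq]
          ring
        · have : u j ≠ 0 := by
            simpa [hu', hji, hdj] using hj
          refine lt_of_le_of_ne ?_ fun h => hji (ht (m.toSyn.injective h))
          rw [hi]
          exact m.le_degree (by rwa [mem_support_iff, coeff_combination_self ht])
      · exact lt_of_isNormalForm hG hG0 ht hr hl hdN hdj
    have hu'I : combination t u' ∈ I := by
      rw [hu', combination_sub, combination_smul]
      exact I.sub_mem hu (zsmul_mem (h1 _ hdU) q)
    have hu'm : u' ∈ Submodule.span ℤ {u | u ∈ U} := by
      by_cases hu'0 : combination t u' = 0
      · have : u' = 0 := funext fun j => by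
          rw [← coeff_combination_self ht u' j, hu'0]
          simp
        rw [this]
        exact Submodule.zero_mem _
      · refine ih _ ?_ u' hu'I rfl
        have := m.degree_mem_support hu'0
        rw [mem_support_iff] at this
        obtain ⟨j, hj, hj0⟩ := exists_of_coeff_combination_ne_zero ht this
        rw [← hj, ← hi]
        exact hlow j hj0
    have : u = u' + q • (Pi.single i l - d) := by rw [hu']; abel
    rw [this]
    exact Submodule.add_mem _ hu'm (Submodule.smul_mem _ _ (Submodule.subset_span hdU))

theorem isExplicitRepresentation_of_run (hG : IsStrongGroebnerBasis m I G) (hG0 : ∀ g ∈ G, g ≠ 0)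
    (ht : Function.Injective t) (hr : Set.range t = (monicLeadingTerms m I)ᶜ)
    {U : List (Fin k → ℤ)} (h : ModulePresentationRun m I G t Finset.univ U)
    {c : Fin k → Fin k → Fin k → ℤ}
    (hc : ∀ i j, IsNormalForm m I (monomial (t i + t j) 1) (combination t (c i j))) :
    IsExplicitRepresentation (fun i => Ideal.Quotient.mk I (monomial (t i) (1 : ℤ))) U c where
  generators := span_standardTerms hr
  relations := h.span_eq hG hG0 ht hr
  products i j := by
    have h1 := (Ideal.Quotient.eq (I := I)).2 (hc i j).1
    rw [← map_mul, monomial_mul, mul_one, h1, ← linearCombination_eq_mk_combination,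
      Fintype.linearCombination_apply]

/-- The procedure can process the terms in the order of a list. -/
theorem modulePresentationRun_filterMap {f : Fin k → Option (Fin k → ℤ)}
    (hnone : ∀ i, f i = none → torsionCoefficients m G (t i) = ∅)
    (hsome : ∀ i u, f i = some u → ∃ l d, IsLeast (torsionCoefficients m G (t i)) l ∧
      IsNormalForm m I (monomial (t i) l) (combination t d) ∧ u = Pi.single i l - d)
    {L : List (Fin k)} (hL : L.Nodup) :
    ModulePresentationRun m I G t L.toFinset (L.filterMap f) := by
  induction L with
  | nil => exact .done
  | cons i L ih =>
    rw [List.nodup_cons] at hL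
    have hi : i ∈ (i :: L).toFinset := by simp
    have he : (i :: L).toFinset.erase i = L.toFinset := by
      rw [List.toFinset_cons, Finset.erase_insert (by simpa using hL.1)]
    have ih := ih hL.2
    rw [← he] at ih
    cases hf : f i with
    | none =>
      rw [List.filterMap_cons_none hf]
      exact .skip hi (hnone i hf) ih
    | some u =>
      rw [List.filterMap_cons_some hf]
      obtain ⟨l, d, h1, h2, rfl⟩ := hsome i u hf
      exact .append hi h1 h2 ih

/-- If the quotient is finitely generated, then `G` contains a monic polynomial whose leading term
is a power of the given indeterminate. -/
theorem exists_monic_power (hG : IsStrongGroebnerBasis m I G)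
    (hI : Module.Finite ℤ (MvPolynomial (Fin n) ℤ ⧸ I)) (i : Fin n) :
    ∃ g ∈ G, |m.leadingCoeff g| = 1 ∧ ∃ d, m.degree g = Finsupp.single i d := by
  obtain ⟨p, hp, hp0⟩ := Algebra.IsIntegral.isIntegral (R := ℤ) (Ideal.Quotient.mk I (X i))
  set f : MvPolynomial (Fin n) ℤ := Polynomial.aeval (X i) p
  have hfI : f ∈ I := by
    rw [← Ideal.Quotient.eq_zero_iff_mem, ← hp0]
    have := Polynomial.hom_eval₂ p (algebraMap ℤ (MvPolynomial (Fin n) ℤ)) (Ideal.Quotient.mk I)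
      (X i)
    exact this
  have hsum : f = ∑ a ∈ p.support, monomial (Finsupp.single i a) (p.coeff a) := by
    simp only [f, Polynomial.aeval_def, Polynomial.eval₂_eq_sum, Polynomial.sum]
    refine Finset.sum_congr rfl fun a _ => ?_
    rw [X_pow_eq_monomial, algebraMap_eq, C_mul_monomial, mul_one]
  have hco : f.coeff (Finsupp.single i p.natDegree) = 1 := by
    rw [hsum, coeff_sum, Finset.sum_eq_single p.natDegree]
    · rw [coeff_monomial, if_pos rfl]
      exact hp
    · intro a _ ha
      rw [coeff_monomial, if_neg]
      exact fun h => ha (Finsupp.single_injective i h)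
    · intro h
      rw [Polynomial.notMem_support_iff] at h
      simp [h]
  have hdeg : m.degree f = Finsupp.single i p.natDegree := by
    refine MonomialOrder.degree_eq_of_forall_le (fun b hb => ?_) (by rw [hco]; exact one_ne_zero)
    rw [mem_support_iff, hsum, coeff_sum] at hb
    obtain ⟨a, ha, hab⟩ := Finset.exists_ne_zero_of_sum_ne_zero hb
    rw [coeff_monomial, ne_eq, ite_eq_right_iff, Classical.not_imp] at hab
    rw [← hab.1]
    refine m.toSyn_monotone ?_
    rw [Finsupp.single_le_single]
    exact Polynomial.le_natDegree_of_mem_supp a ha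
  have hf0 : f ≠ 0 := by
    intro h
    rw [h] at hco
    simp at hco
  obtain ⟨g, hg, hd⟩ := hG.2 f hfI hf0
  rw [leadingTerm_dvd_leadingTerm hf0, hdeg, MonomialOrder.leadingCoeff, MonomialOrder.leadingCoeff,
    hdeg, hco] at hd
  refine ⟨g, hg, Int.isUnit_iff_abs_eq.1 (isUnit_of_dvd_one hd.2), m.degree g i, ?_⟩
  ext j
  have := hd.1 j
  rw [Finsupp.single_apply] at this ⊢
  split_ifs at this ⊢ with h
  · rw [h]
  · omega

end Groebner


namespace PolyTime
open Enc (enc)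

/-! ## Lists of values of functions -/

section OfFn

variable {n k : ℕ}

theorem zipWith_ofFn {X Y Z : Type} (f : X → Y → Z) (u : Fin n → X) (v : Fin n → Y) :
    List.zipWith f (List.ofFn u) (List.ofFn v) = List.ofFn fun i => f (u i) (v i) := by
  apply List.ext_getElem <;> simp

theorem tle_ofFn (u v : Fin n →₀ ℕ) : tle (List.ofFn u) (List.ofFn v) = true ↔ u ≤ v := by
  have : (List.ofFn u).zip (List.ofFn v) = List.ofFn fun i => (u i, v i) := zipWith_ofFn _ _ _
  rw [tle, this, List.all_eq_true]
  simp only [List.mem_ofFn, forall_exists_index, forall_apply_eq_imp_iff,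
    decide_eq_true_eq]
  rfl

theorem teq_ofFn (u v : Fin n →₀ ℕ) : teq (List.ofFn u) (List.ofFn v) = true ↔ u = v := by
  rw [teq, Bool.and_eq_true, tle_ofFn, tle_ofFn, le_antisymm_iff]

theorem tadd_ofFn (u v : Fin n →₀ ℕ) :
    tadd (List.ofFn u) (List.ofFn v) = List.ofFn ⇑(u + v) :=
  zipWith_ofFn _ _ _

theorem tsub_ofFn (u v : Fin n →₀ ℕ) :
    tsub (List.ofFn u) (List.ofFn v) = List.ofFn ⇑(u - v) :=
  zipWith_ofFn _ _ _

theorem vadd_ofFn (u v : Fin k → ℤ) : vadd (List.ofFn u) (List.ofFn v) = List.ofFn (u + v) :=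
  zipWith_ofFn _ _ _

theorem vsmul_ofFn (c : ℤ) (v : Fin k → ℤ) : vsmul c (List.ofFn v) = List.ofFn (c • v) := by
  simp only [vsmul, List.map_ofFn]
  rfl

theorem dot_ofFn_single (v : Fin k → ℤ) (i : Fin k) :
    dot (List.ofFn v) (List.ofFn (Pi.single i 1)) = v i := by
  rw [dot, zipWith_ofFn, List.sum_ofFn, Finset.sum_eq_single i]
  · simp
  · intro j _ hj
    simp [hj]
  · simp

theorem ofFn_term_injective : Function.Injective fun e : Fin n →₀ ℕ => List.ofFn e :=
  fun _ _ h => DFunLike.coe_injective (List.ofFn_injective h)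

theorem exists_ofFn_term {u : List ℕ} (hu : u.length = n) : ∃ e : Fin n →₀ ℕ, u = List.ofFn e := by
  subst hu
  exact ⟨Finsupp.equivFunOnFinite.symm u.get, (List.ofFn_get u).symm⟩

/-- The terms `t` as lists. -/
def termLists (t : Fin k → (Fin n →₀ ℕ)) : List (List ℕ) := List.ofFn fun i => List.ofFn (t i)

theorem unitVec_ofFn {t : Fin k → (Fin n →₀ ℕ)} (ht : Function.Injective t) (i : Fin k) :
    unitVec (termLists t) (List.ofFn (t i)) = List.ofFn (Pi.single i 1) := by
  rw [unitVec, termLists, List.map_ofFn]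
  congr 1
  funext j
  simp only [Function.comp, teq_ofFn, ht.eq_iff, Pi.single_apply]

theorem zeroVec_ofFn (t : Fin k → (Fin n →₀ ℕ)) :
    zeroVec (termLists t) = List.ofFn (0 : Fin k → ℤ) := by
  rw [zeroVec, termLists, List.map_ofFn]
  rfl

theorem mem_box {n M : ℕ} {u : List ℕ} :
    u ∈ box n M ↔ u.length = n ∧ ∀ x ∈ u, x ≤ M := by
  induction n generalizing u with
  | zero =>
    simp only [box, List.range_zero, List.foldl_nil, List.mem_singleton, List.length_eq_zero_iff]
    constructor
    · rintro rfl
      simp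
    · exact fun h => h.1
  | succ n ih =>
    have : box (n + 1) M =
        (box n M).flatMap fun v => (List.range (M + 1)).map fun i => i :: v := by
      simp only [box, List.range_succ (n := n), List.foldl_append, List.foldl_cons, List.foldl_nil]
    rw [this]
    simp only [List.mem_flatMap, List.mem_map, List.mem_range, ih]
    constructor
    · rintro ⟨v, ⟨h1, h2⟩, i, hi, rfl⟩
      refine ⟨by simp [h1], fun x hx => ?_⟩
      rcases List.mem_cons.1 hx with rfl | hx
      · omega
      · exact h2 x hx
    · rcases u with _ | ⟨i, v⟩
      · simp
      · rintro ⟨h1, h2⟩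
        exact ⟨v, ⟨by simpa using h1, fun x hx => h2 x (by simp [hx])⟩, i,
          Nat.lt_succ_of_le (h2 i (by simp)), rfl⟩

theorem nodup_box (n M : ℕ) : (box n M).Nodup := by
  induction n with
  | zero => simp [box]
  | succ n ih =>
    have : box (n + 1) M =
        (box n M).flatMap fun v => (List.range (M + 1)).map fun i => i :: v := by
      simp only [box, List.range_succ (n := n), List.foldl_append, List.foldl_cons, List.foldl_nil]
    rw [this, List.nodup_flatMap]
    refine ⟨fun v _ => List.nodup_range.map fun i j h => (List.cons.inj h).1, ?_⟩
    refine ih.imp fun {v w} hvw u hu hu' => hvw ?_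
    obtain ⟨i, _, rfl⟩ := List.mem_map.1 hu
    obtain ⟨j, _, h⟩ := List.mem_map.1 hu'
    exact (List.cons.inj h).2.symm

theorem ofFn_mem_box {M : ℕ} {e : Fin n →₀ ℕ} : List.ofFn e ∈ box n M ↔ ∀ i, e i ≤ M := by
  simp [mem_box]

end OfFn

/-! ## Polynomials as lists -/

section Raw

variable {n : ℕ} (m : MonomialOrder (Fin n))

/-- The list that represents a polynomial. -/
noncomputable def rawPoly (f : MvPolynomial (Fin n) ℤ) : RawPoly :=
  (sortedTerms m f).map fun e => (f.coeff e, List.ofFn e)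

theorem mem_sortedTerms {f : MvPolynomial (Fin n) ℤ} {e : Fin n →₀ ℕ} :
    e ∈ sortedTerms m f ↔ e ∈ f.support := by
  simp only [sortedTerms, List.mem_map, Finset.mem_sort, Finset.mem_map_equiv, mem_support_iff]
  constructor
  · rintro ⟨a, ha, rfl⟩
    exact ha
  · exact fun h => ⟨m.toSyn e, by simpa using h, by simp⟩

theorem nodup_sortedTerms (f : MvPolynomial (Fin n) ℤ) : (sortedTerms m f).Nodup :=
  (Finset.sort_nodup _ _).map m.toSyn.symm.injective

theorem sum_sortedTerms {N : Type*} [AddCommMonoid N] (f : MvPolynomial (Fin n) ℤ)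
    (F : (Fin n →₀ ℕ) → N) : ((sortedTerms m f).map F).sum = ∑ e ∈ f.support, F e := by
  rw [← List.sum_toFinset F (nodup_sortedTerms m f)]
  congr 1
  ext e
  rw [List.mem_toFinset, mem_sortedTerms]

theorem sortedTerms_eq_cons {f : MvPolynomial (Fin n) ℤ} (hf : f ≠ 0) :
    ∃ l, sortedTerms m f = m.degree f :: l ∧
      ∀ a ∈ l, a ∈ f.support ∧ m.toSyn a < m.toSyn (m.degree f) := by
  have hmem : m.degree f ∈ sortedTerms m f := (mem_sortedTerms m).2 (m.degree_mem_support hf)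
  have hsort : (sortedTerms m f).Pairwise fun a b => m.toSyn b ≤ m.toSyn a := by
    rw [sortedTerms, List.pairwise_map]
    refine (Finset.pairwise_sort _ _).imp fun {a b} h => ?_
    simpa using h
  have hnd := nodup_sortedTerms m f
  have hsupp := fun e => mem_sortedTerms m (f := f) (e := e)
  rcases hs : sortedTerms m f with _ | ⟨b, l⟩
  · simp [hs] at hmem
  · rw [hs] at hmem hsort hnd hsupp
    rw [List.pairwise_cons] at hsort
    rw [List.nodup_cons] at hnd
    have hb : b = m.degree f := by
      refine m.toSyn.injective (le_antisymm (m.le_degree ((hsupp b).1 (by simp))) ?_)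
      rcases List.mem_cons.1 hmem with h | h
      · rw [h]
      · exact hsort.1 _ h
    subst hb
    refine ⟨l, rfl, fun a ha => ?_⟩
    have h1 := (hsupp a).1 (by simp [ha])
    refine ⟨h1, lt_of_le_of_ne (m.le_degree h1) fun h => hnd.1 ?_⟩
    rw [← m.toSyn.injective h]
    exact ha

/-- The terms of a polynomial other than its leading term. -/
noncomputable def tailTerms (f : MvPolynomial (Fin n) ℤ) : List (Fin n →₀ ℕ) :=
  (sortedTerms m f).tail

variable {m} {f : MvPolynomial (Fin n) ℤ}

theorem tailTerms_spec (hf : f ≠ 0) {a : Fin n →₀ ℕ} (ha : a ∈ tailTerms m f) :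
    a ∈ f.support ∧ m.toSyn a < m.toSyn (m.degree f) := by
  obtain ⟨l, h1, h2⟩ := sortedTerms_eq_cons m hf
  rw [tailTerms, h1] at ha
  exact h2 a ha

theorem rawPoly_eq_cons (hf : f ≠ 0) :
    rawPoly m f = (m.leadingCoeff f, List.ofFn (m.degree f)) ::
      (tailTerms m f).map fun e => (f.coeff e, List.ofFn e) := by
  obtain ⟨l, h1, h2⟩ := sortedTerms_eq_cons m hf
  rw [rawPoly, tailTerms, h1]
  rfl

theorem lcoeff_rawPoly (hf : f ≠ 0) : lcoeff (rawPoly m f) = m.leadingCoeff f := by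
  rw [rawPoly_eq_cons hf]
  rfl

theorem lterm_rawPoly (hf : f ≠ 0) : lterm (rawPoly m f) = List.ofFn (m.degree f) := by
  rw [rawPoly_eq_cons hf]
  rfl

theorem tail_rawPoly (hf : f ≠ 0) :
    (rawPoly m f).tail = (tailTerms m f).map fun e => (f.coeff e, List.ofFn e) := by
  rw [rawPoly_eq_cons hf]
  rfl

/-- The product of a monomial with a polynomial, with the leading monomial split off. -/
theorem monomial_mul_eq (hf : f ≠ 0) (s : Fin n →₀ ℕ) (c : ℤ) :
    monomial s c * f = monomial (s + m.degree f) (c * m.leadingCoeff f) +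
      c • ((tailTerms m f).map fun a => monomial (s + a) (f.coeff a)).sum := by
  have h := sum_sortedTerms m f fun a => monomial (s + a) (f.coeff a)
  obtain ⟨l, h1, h2⟩ := sortedTerms_eq_cons m hf
  have h3 : monomial s c * f = c • ∑ a ∈ f.support, monomial (s + a) (f.coeff a) := by
    conv_lhs => rw [f.as_sum]
    rw [Finset.mul_sum, Finset.smul_sum]
    refine Finset.sum_congr rfl fun a _ => ?_
    rw [monomial_mul, smul_monomial, smul_eq_mul]
  rw [h3, ← h, tailTerms, h1, List.map_cons, List.sum_cons, smul_add, smul_monomial, smul_eq_mul]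
  rfl

/-! ## The length of the input -/

theorem encInput_eq (G : List (MvPolynomial (Fin n) ℤ)) :
    encInput m G = enc (n, G.map (rawPoly m)) := by
  have h1 : ∀ e : Fin n →₀ ℕ, encTerm e = enc (List.ofFn e) := fun e => by
    simp only [encTerm, enc, List.map_ofFn]
    rfl
  have h2 : ∀ f, encPoly m f = enc (rawPoly m f) := fun f => by
    simp only [encPoly, rawPoly, enc, List.map_map]
    congr 1
    refine List.map_congr_left fun e _ => ?_
    rw [h1]
    rfl
  simp only [encInput, enc, List.map_map]
  congr 2
  exact List.map_congr_left fun f _ => h2 f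

theorem size_list {τ : Type} [Enc τ] (l : List τ) :
    (enc l).size = 1 + (l.map fun x => 1 + (enc x).size).sum := by
  induction l with
  | nil => simp [size_nil]
  | cons x l ih =>
    rw [size_cons, ih, List.map_cons, List.sum_cons]
    omega

/-- The bit complexity of one polynomial. -/
noncomputable def polyComplexity (f : MvPolynomial (Fin n) ℤ) : ℕ :=
  ∑ e ∈ f.support, (1 + Nat.size (f.coeff e).natAbs + ∑ i, e i)

theorem size_rawPoly_le (f : MvPolynomial (Fin n) ℤ) :
    (enc (rawPoly m f)).size ≤ 1 + (2 * n + 5) * polyComplexity f := by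
  rw [size_list, rawPoly, List.map_map, sum_sortedTerms, polyComplexity, Finset.mul_sum]
  refine Nat.add_le_add_left (Finset.sum_le_sum fun e _ => ?_) _
  have h1 : (enc (List.ofFn e)).size ≤ 1 + (2 * n + ∑ i, e i) := by
    rw [size_list, List.map_ofFn, List.sum_ofFn]
    have h2 : ∑ i : Fin n, (2 + e i) = 2 * n + ∑ i, e i := by
      rw [Finset.sum_add_distrib]
      simp [mul_comm]
    rw [← h2]
    refine Nat.add_le_add_left (Finset.sum_le_sum fun i _ => ?_) _
    have := natSize_le_self (e i)
    simp only [Function.comp, enc, Val.size, Int.natAbs_natCast]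
    omega
  have h3 : (enc (f.coeff e)).size = 1 + Nat.size (f.coeff e).natAbs := rfl
  simp only [Function.comp, size_prod, h3]
  generalize Nat.size (f.coeff e).natAbs = x at *
  generalize ∑ i, e i = y at *
  have h4 : (2 * n + 5) * (1 + x + y) = 2 * n + 5 + (2 * n + 5) * (x + y) := by ring
  have h5 : 1 * (x + y) ≤ (2 * n + 5) * (x + y) := Nat.mul_le_mul_right _ (by omega)
  omega

theorem expBound_eq (G : List (MvPolynomial (Fin n) ℤ)) :
    expBound n (G.map (rawPoly m)) =
      n + 2 + (G.map fun f => ∑ e ∈ f.support, ∑ i, e i).sum := by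
  rw [expBound]
  congr 1
  induction G with
  | nil => simp
  | cons f G ih =>
    rw [List.map_cons, List.flatten_cons, List.flatMap_append, List.sum_append, ih, List.map_cons,
      List.sum_cons]
    congr 1
    rw [List.flatMap_def, List.sum_flatten, rawPoly, List.map_map, List.map_map, sum_sortedTerms]
    refine Finset.sum_congr rfl fun e _ => ?_
    simp [List.sum_ofFn]

theorem inputLength_le {G : List (MvPolynomial (Fin n) ℤ)} (hG : ∀ g ∈ G, g ≠ 0) :
    (enc (n, G.map (rawPoly m))).size + expBound n (G.map (rawPoly m)) + 2 ≤
      (2 * n + 8) * (bitComplexity G + 1) := by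
  have hb : bitComplexity G = (G.map polyComplexity).sum := rfl
  have h1 : (G.map fun f => ∑ e ∈ f.support, ∑ i, e i).sum ≤ bitComplexity G := by
    rw [hb]
    refine List.sum_le_sum fun f _ => Finset.sum_le_sum fun e _ => by omega
  have h2 : (enc (G.map (rawPoly m))).size ≤ 1 + (2 * n + 7) * bitComplexity G := by
    rw [size_list, List.map_map, hb, ← List.sum_map_mul_left]
    refine Nat.add_le_add_left (List.sum_le_sum fun f hf => ?_) _
    have h3 := size_rawPoly_le (m := m) f
    have h4 : 1 ≤ polyComplexity f := by
      obtain ⟨e, he⟩ := support_nonempty.2 (hG f hf)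
      refine le_trans ?_ (Finset.single_le_sum (fun _ _ => Nat.zero_le _) he)
      omega
    have h5 : (2 * n + 7) * polyComplexity f =
      (2 * n + 5) * polyComplexity f + 2 * polyComplexity f := by ring
    simp only [Function.comp]
    omega
  have h6 := natSize_le_self n
  have h7 : (enc n).size = 1 + Nat.size n := rfl
  rw [size_prod, expBound_eq, h7]
  have h8 : (2 * n + 8) * (bitComplexity G + 1) =
    (2 * n + 7) * bitComplexity G + bitComplexity G + (2 * n + 8) := by ring
  rw [h8]
  dsimp only
  omega

end Raw

end PolyTime


namespace PolyTime

section Table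

variable {n k : ℕ} {m : MonomialOrder (Fin n)} {I : Ideal (MvPolynomial (Fin n) ℤ)}
  {G : List (MvPolynomial (Fin n) ℤ)} {t : Fin k → (Fin n →₀ ℕ)}

/-! ## Correctness of the table -/

/-- The vector `d` represents the term `e` modulo `I`, by terms that are not larger. -/
def Represents (m : MonomialOrder (Fin n)) (I : Ideal (MvPolynomial (Fin n) ℤ))
    (t : Fin k → (Fin n →₀ ℕ)) (e : Fin n →₀ ℕ) (d : Fin k → ℤ) : Prop :=
  monomial e 1 - combination t d ∈ I ∧ ∀ j, d j ≠ 0 → m.toSyn (t j) ≤ m.toSyn e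

/-- All entries of the table represent their terms. -/
def GoodTable (m : MonomialOrder (Fin n)) (I : Ideal (MvPolynomial (Fin n) ℤ))
    (t : Fin k → (Fin n →₀ ℕ)) (tbl : Table) : Prop :=
  ∀ p ∈ tbl, ∃ (e : Fin n →₀ ℕ) (d : Fin k → ℤ), p = (List.ofFn ⇑e, List.ofFn d) ∧ Represents m I t e d

theorem known_mono {tbl tbl' : Table} (h : ∀ p ∈ tbl, p ∈ tbl') {u : List ℕ}
    (hu : known tbl u = true) : known tbl' u = true := by
  rw [known, List.any_eq_true] at hu ⊢
  obtain ⟨p, hp, hpu⟩ := hu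
  exact ⟨p, h p hp, hpu⟩

theorem known_of_mem {tbl : Table} {e : Fin n →₀ ℕ} {v : List ℤ} (h : (List.ofFn ⇑e, v) ∈ tbl) :
    known tbl (List.ofFn e) = true := by
  rw [known, List.any_eq_true]
  exact ⟨_, h, (teq_ofFn e e).2 rfl⟩

theorem lookup_of_known {P : List ℤ → Prop} {z : List ℤ} {tbl : Table} {u : List ℕ}
    (hu : known tbl u = true) (h : ∀ p ∈ tbl, teq p.1 u = true → P p.2) :
    P (lookup z tbl u) := by
  suffices ∀ z, P z ∨ known tbl u = true → P (lookup z tbl u) from this z (.inr hu)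
  clear hu
  induction tbl with
  | nil =>
    intro z hz
    rcases hz with hz | hz
    · exact hz
    · simp [known] at hz
  | cons p tbl ih =>
    intro z hz
    rw [lookup, List.foldl_cons]
    refine ih (fun q hq => h q (List.mem_cons_of_mem _ hq)) _ ?_
    by_cases hp : teq p.1 u = true
    · rw [if_pos hp]
      exact .inl (h p List.mem_cons_self hp)
    · rw [if_neg hp]
      refine hz.imp_right fun hz => ?_
      rw [known, List.any_cons, Bool.or_eq_true] at hz
      exact hz.resolve_left hp

theorem lookup_spec {tbl : Table} (hT : GoodTable m I t tbl) (z : List ℤ) {e : Fin n →₀ ℕ}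
    (he : known tbl (List.ofFn e) = true) :
    ∃ d, lookup z tbl (List.ofFn e) = List.ofFn d ∧ Represents m I t e d := by
  refine lookup_of_known (P := fun v => ∃ d, v = List.ofFn d ∧ Represents m I t e d) he
    fun p hp hpe => ?_
  obtain ⟨e', d, rfl, hd⟩ := hT p hp
  rw [teq_ofFn] at hpe
  subst hpe
  exact ⟨d, rfl, hd⟩

theorem evalTable_spec {tbl : Table} (hT : GoodTable m I t tbl) (s : Fin n →₀ ℕ)
    (c : (Fin n →₀ ℕ) → ℤ) {qs : List (Fin n →₀ ℕ)}
    (hqs : ∀ a ∈ qs, known tbl (List.ofFn ⇑(s + a)) = true) :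
    ∃ d, evalTable (zeroVec (termLists t)) tbl (List.ofFn s)
        (qs.map fun a => (c a, List.ofFn ⇑a)) = List.ofFn d ∧
      (qs.map fun a => monomial (s + a) (c a)).sum - combination t d ∈ I ∧
      ∀ j, d j ≠ 0 → ∃ a ∈ qs, m.toSyn (t j) ≤ m.toSyn (s + a) := by
  rw [zeroVec_ofFn, evalTable]
  suffices ∀ (z : List ℤ) (d₀ : Fin k → ℤ), ∃ d : Fin k → ℤ, (qs.map fun a => (c a, List.ofFn ⇑a)).foldl
        (fun acc μ => vadd acc (vsmul μ.1 (lookup z tbl (tadd (List.ofFn s) μ.2))))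
        (List.ofFn d₀) = List.ofFn (d₀ + d) ∧
      (qs.map fun a => monomial (s + a) (c a)).sum - combination t d ∈ I ∧
      ∀ j, d j ≠ 0 → ∃ a ∈ qs, m.toSyn (t j) ≤ m.toSyn (s + a) by
    obtain ⟨d, h⟩ := this (List.ofFn (0 : Fin k → ℤ)) 0
    rw [zero_add] at h
    exact ⟨d, h⟩
  intro z
  induction qs with
  | nil => exact fun d₀ => ⟨0, by simp, by simp [combination], by simp⟩
  | cons a qs ih =>
    intro d₀
    obtain ⟨d₁, h1, h2, h3⟩ := lookup_spec hT z (hqs a List.mem_cons_self)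
    obtain ⟨d, h4, h5, h6⟩ := ih (fun b hb => hqs b (List.mem_cons_of_mem _ hb)) (d₀ + c a • d₁)
    refine ⟨c a • d₁ + d, ?_, ?_, fun j hj => ?_⟩
    · rw [List.map_cons, List.foldl_cons, tadd_ofFn, h1, vsmul_ofFn, vadd_ofFn, h4, add_assoc]
    · have h7 : (monomial (s + a) (c a) : MvPolynomial (Fin n) ℤ) =
          c a • monomial (s + a) (1 : ℤ) := by
        rw [smul_monomial, smul_eq_mul, mul_one]
      have h8 := I.add_mem (zsmul_mem h2 (c a)) h5
      rw [List.map_cons, List.sum_cons, combination_add, combination_smul, h7]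
      convert h8 using 1
      rw [smul_sub]
      abel
    · by_cases hj' : d j = 0
      · refine ⟨a, List.mem_cons_self, h3 j fun h => hj ?_⟩
        simp [h, hj']
      · obtain ⟨b, hb, hb'⟩ := h6 j hj'
        exact ⟨b, List.mem_cons_of_mem _ hb, hb'⟩

theorem mem_tableStep {z : List ℤ} {tbl : Table} {q : List ℕ × RawPoly}
    {p : List ℕ × List ℤ} (hp : p ∈ tbl) : p ∈ tableStep z tbl q := by
  rw [tableStep]
  split_ifs
  · exact List.mem_cons_of_mem _ hp
  · exact hp

theorem mem_foldl_tableStep {z : List ℤ} (L : List (List ℕ × RawPoly)) {tbl : Table}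
    {p : List ℕ × List ℤ} (hp : p ∈ tbl) : p ∈ L.foldl (tableStep z) tbl := by
  induction L generalizing tbl with
  | nil => exact hp
  | cons q L ih => exact ih (mem_tableStep hp)

theorem tableStep_condition_iff {tbl : Table} {e : Fin n →₀ ℕ} {g : MvPolynomial (Fin n) ℤ}
    (hg : g ≠ 0) : (decide (|lcoeff (rawPoly m g)| = 1) &&
      tle (lterm (rawPoly m g)) (List.ofFn e) && (rawPoly m g).tail.all
        (fun μ => known tbl (tadd (tsub (List.ofFn e) (lterm (rawPoly m g))) μ.2))) = true ↔
      |m.leadingCoeff g| = 1 ∧ m.degree g ≤ e ∧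
        ∀ a ∈ tailTerms m g, known tbl (List.ofFn ⇑(e - m.degree g + a)) = true := by
  rw [lcoeff_rawPoly hg, lterm_rawPoly hg, tail_rawPoly hg, Bool.and_eq_true, Bool.and_eq_true,
    decide_eq_true_eq, tle_ofFn, tsub_ofFn, List.all_map, List.all_eq_true, and_assoc]
  simp only [Function.comp, tadd_ofFn]

theorem GoodTable.step (hG : ∀ g ∈ G, g ∈ I) {tbl : Table} (hT : GoodTable m I t tbl)
    (e : Fin n →₀ ℕ) {g : MvPolynomial (Fin n) ℤ} (hg : g ∈ G) (hg0 : g ≠ 0) :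
    GoodTable m I t (tableStep (zeroVec (termLists t)) tbl (List.ofFn ⇑e, rawPoly m g)) := by
  rw [tableStep]
  split_ifs with hc
  · dsimp only at hc
    rw [tableStep_condition_iff hg0] at hc
    obtain ⟨h1, h2, h3⟩ := hc
    intro p hp
    rcases List.mem_cons.1 hp with rfl | hp
    · obtain ⟨d, h4, h5, h6⟩ := evalTable_spec hT (e - m.degree g) (fun a => g.coeff a) h3
      refine ⟨e, -m.leadingCoeff g • d, ?_, ?_, fun j hj => ?_⟩
      · dsimp only
        rw [lcoeff_rawPoly hg0, lterm_rawPoly hg0, tail_rawPoly hg0, tsub_ofFn, h4, vsmul_ofFn]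
      · have h7 := I.mul_mem_left (monomial (e - m.degree g) (m.leadingCoeff g)) (hG g hg)
        have h8 : m.leadingCoeff g * m.leadingCoeff g = 1 := by
          rw [← abs_mul_abs_self, h1, one_mul]
        rw [monomial_mul_eq hg0, tsub_add_cancel_of_le h2, h8] at h7
        have h9 := I.sub_mem h7 (zsmul_mem h5 (m.leadingCoeff g))
        rw [combination_smul]
        convert h9 using 1
        rw [smul_sub, neg_smul]
        abel
      · obtain ⟨a, ha, hja⟩ := h6 j fun h => hj (by simp [h])
        refine hja.trans ?_
        conv_rhs => rw [← tsub_add_cancel_of_le h2]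
        rw [map_add, map_add]
        exact add_le_add_right (tailTerms_spec hg0 ha).2.le _
    · exact hT p hp
  · exact hT

theorem GoodTable.foldl (hG : ∀ g ∈ G, g ∈ I) (hG0 : ∀ g ∈ G, g ≠ 0)
    {L : List (List ℕ × RawPoly)}
    (hL : ∀ q ∈ L, ∃ e : Fin n →₀ ℕ, ∃ g ∈ G, q = (List.ofFn ⇑e, rawPoly m g)) {tbl : Table}
    (hT : GoodTable m I t tbl) :
    GoodTable m I t (L.foldl (tableStep (zeroVec (termLists t))) tbl) := by
  induction L generalizing tbl with
  | nil => exact hT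
  | cons q L ih =>
    obtain ⟨e, g, hg, rfl⟩ := hL q List.mem_cons_self
    exact ih (fun q hq => hL q (List.mem_cons_of_mem _ hq)) (hT.step hG e hg (hG0 g hg))

theorem known_foldl_of_mem {z : List ℤ} {L : List (List ℕ × RawPoly)} {e : Fin n →₀ ℕ}
    {g : MvPolynomial (Fin n) ℤ} (hg0 : g ≠ 0) (hL : (List.ofFn ⇑e, rawPoly m g) ∈ L)
    {tbl : Table} (h1 : |m.leadingCoeff g| = 1) (h2 : m.degree g ≤ e)
    (h3 : ∀ a ∈ tailTerms m g, known tbl (List.ofFn ⇑(e - m.degree g + a)) = true) :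
    known (L.foldl (tableStep z) tbl) (List.ofFn e) = true := by
  obtain ⟨L₁, L₂, rfl⟩ := List.append_of_mem hL
  rw [List.foldl_append, List.foldl_cons]
  refine known_mono (fun p hp => mem_foldl_tableStep L₂ hp) ?_
  rw [tableStep, if_pos]
  · exact known_of_mem List.mem_cons_self
  · dsimp only
    rw [tableStep_condition_iff hg0]
    exact ⟨h1, h2, fun a ha => known_mono (fun p hp => mem_foldl_tableStep L₁ hp) (h3 a ha)⟩

/-- A set of terms such that each member outside the range of `t` can be reduced, by a monic element
of `G`, to members of the set. -/
def ReductionClosed (m : MonomialOrder (Fin n)) (G : List (MvPolynomial (Fin n) ℤ))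
    (t : Fin k → (Fin n →₀ ℕ)) (T : Set (Fin n →₀ ℕ)) : Prop :=
  ∀ e ∈ T, e ∉ Set.range t → ∃ g ∈ G, |m.leadingCoeff g| = 1 ∧ m.degree g ≤ e ∧
    ∀ a ∈ tailTerms m g, e - m.degree g + a ∈ T

theorem table_spec (hG : ∀ g ∈ G, g ∈ I) (hG0 : ∀ g ∈ G, g ≠ 0)
    (ht : Function.Injective t) {M : ℕ} {T : Set (Fin n →₀ ℕ)} (hT : ReductionClosed m G t T)
    (hTM : ∀ e ∈ T, ∀ j, e j ≤ M) :
    GoodTable m I t (table (G.map (rawPoly m)) (box n M) (termLists t)) ∧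
    ∀ e ∈ T, known (table (G.map (rawPoly m)) (box n M) (termLists t)) (List.ofFn e) = true := by
  classical
  set B := box n M with hB
  set tbl₀ : Table := (termLists t).map fun u => (u, unitVec (termLists t) u) with htbl₀
  set W : List (List ℕ × RawPoly) :=
    B.flatMap fun u => (G.map (rawPoly m)).map fun g => (u, g) with hW
  set z := zeroVec (termLists t) with hz
  have hW1 : ∀ q ∈ W, ∃ e : Fin n →₀ ℕ, ∃ g ∈ G, q = (List.ofFn ⇑e, rawPoly m g) := by
    intro q hq
    simp only [hW, List.mem_flatMap, List.mem_map] at hq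
    obtain ⟨u, hu, p, ⟨g, hg, rfl⟩, rfl⟩ := hq
    obtain ⟨e, rfl⟩ := exists_ofFn_term (mem_box.1 hu).1
    exact ⟨e, g, hg, rfl⟩
  have hW2 : ∀ e ∈ T, ∀ g ∈ G, (List.ofFn ⇑e, rawPoly m g) ∈ W := by
    intro e he g hg
    simp only [hW, List.mem_flatMap, List.mem_map]
    exact ⟨_, ofFn_mem_box.2 (hTM e he), _, ⟨g, hg, rfl⟩, rfl⟩
  have h0 : ∀ i, (List.ofFn ⇑(t i), List.ofFn (Pi.single i (1 : ℤ))) ∈ tbl₀ := by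
    intro i
    rw [htbl₀, List.mem_map]
    refine ⟨List.ofFn (t i), ?_, by rw [unitVec_ofFn ht]⟩
    rw [termLists, List.mem_ofFn]
    exact ⟨i, rfl⟩
  have hgood0 : GoodTable m I t tbl₀ := by
    intro p hp
    rw [htbl₀, List.mem_map] at hp
    obtain ⟨u, hu, rfl⟩ := hp
    rw [termLists, List.mem_ofFn] at hu
    obtain ⟨i, rfl⟩ := hu
    refine ⟨t i, Pi.single i 1, by rw [unitVec_ofFn ht], by simp [combination_single], ?_⟩
    intro j hj
    have : j = i := by
      by_contra hne
      exact hj (by simp [hne])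
    rw [this]
  have htable : table (G.map (rawPoly m)) B (termLists t) =
      (B.flatMap fun _ => W).foldl (tableStep z) tbl₀ := rfl
  rw [htable]
  refine ⟨hgood0.foldl hG hG0 fun q hq => ?_, ?_⟩
  · obtain ⟨_, _, hq⟩ := List.mem_flatMap.1 hq
    exact hW1 q hq
  have hTfin : T.Finite := by
    refine (Set.finite_Iic (Finsupp.equivFunOnFinite.symm fun _ : Fin n => M)).subset ?_
    intro e he i
    exact hTM e he i
  set S := hTfin.toFinset with hS
  let rank : (Fin n →₀ ℕ) → ℕ := fun e => (S.filter fun a => m.toSyn a < m.toSyn e).card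
  have hround : ∀ (L : List (List ℕ)) (r : ℕ) (tbl : Table), (∀ p ∈ tbl₀, p ∈ tbl) →
      (∀ e ∈ T, rank e < r → known tbl (List.ofFn e) = true) →
      ∀ e ∈ T, rank e < r + L.length →
        known ((L.flatMap fun _ => W).foldl (tableStep z) tbl) (List.ofFn e) = true := by
    intro L
    induction L with
    | nil => exact fun r tbl _ h => h
    | cons _ L ih =>
      intro r tbl htbl h
      rw [List.flatMap_cons, List.foldl_append, List.length_cons, ← add_assoc, add_right_comm]
      refine ih (r + 1) _ (fun p hp => mem_foldl_tableStep W (htbl p hp)) fun e he her => ?_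
      by_cases het : e ∈ Set.range t
      · obtain ⟨i, rfl⟩ := het
        exact known_of_mem (mem_foldl_tableStep W (htbl _ (h0 i)))
      · obtain ⟨g, hg, h1, h2, h3⟩ := hT e he het
        refine known_foldl_of_mem (hG0 g hg) (hW2 e he g hg) h1 h2 fun a ha => h _ (h3 a ha) ?_
        have hlt : m.toSyn (e - m.degree g + a) < m.toSyn e := by
          conv_rhs => rw [← tsub_add_cancel_of_le h2]
          rw [map_add, map_add]
          exact add_lt_add_right (tailTerms_spec (hG0 g hg) ha).2 _
        have : rank (e - m.degree g + a) < rank e := by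
          refine Finset.card_lt_card ⟨fun b hb => ?_, fun hsub => ?_⟩
          · rw [Finset.mem_filter] at hb ⊢
            exact ⟨hb.1, hb.2.trans hlt⟩
          · have := hsub (Finset.mem_filter.2 ⟨hTfin.mem_toFinset.2 (h3 a ha), hlt⟩)
            rw [Finset.mem_filter] at this
            exact lt_irrefl _ this.2
        omega
  intro e he
  refine hround B 0 tbl₀ (fun p hp => hp) (fun e _ h => absurd h (by omega)) e he ?_
  rw [zero_add]
  calc rank e < S.card := by
        refine Finset.card_lt_card ⟨Finset.filter_subset _ _, fun hsub => ?_⟩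
        have := hsub (hTfin.mem_toFinset.2 he)
        rw [Finset.mem_filter] at this
        exact lt_irrefl _ this.2
    _ ≤ B.toFinset.card := by
        refine Finset.card_le_card_of_injOn (fun e => List.ofFn ⇑e) (fun e he => ?_)
          (ofFn_term_injective.injOn)
        rw [Finset.mem_coe, List.mem_toFinset]
        exact ofFn_mem_box.2 (hTM e (hTfin.mem_toFinset.1 he))
    _ ≤ B.length := B.toFinset_card_le

theorem exponent_le_expBound {g : MvPolynomial (Fin n) ℤ} (hg : g ∈ G) {e : Fin n →₀ ℕ}
    (he : e ∈ g.support) (j : Fin n) : e j + n + 2 ≤ expBound n (G.map (rawPoly m)) := by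
  rw [expBound_eq]
  have h1 : e j ≤ ∑ i, e i := Finset.single_le_sum (fun _ _ => Nat.zero_le _) (Finset.mem_univ j)
  have h2 : ∑ i, e i ≤ ∑ e ∈ g.support, ∑ i, e i :=
    Finset.single_le_sum (f := fun e : Fin n →₀ ℕ => ∑ i, e i) (fun _ _ => Nat.zero_le _) he
  have h3 : ∑ e ∈ g.support, ∑ i, e i ≤ (G.map fun f => ∑ e ∈ f.support, ∑ i, e i).sum :=
    List.single_le_sum (by simp) _ (List.mem_map_of_mem hg)
  omega

/-- The box of the algorithm contains a set of terms that is closed under reductions and contains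
all products of two standard terms, and all terms that occur in the reduction rules. -/
theorem exists_reductionClosed (hG : IsStrongGroebnerBasis m I G) (hG0 : ∀ g ∈ G, g ≠ 0)
    (hI : Module.Finite ℤ (MvPolynomial (Fin n) ℤ ⧸ I)) {X : ℕ}
    (hX : X = expBound n (G.map (rawPoly m))) :
    (∀ e ∉ monicLeadingTerms m I, ∀ i, e i ≤ X) ∧
    ∃ T : Set (Fin n →₀ ℕ), (∀ e ∈ T, ∀ j, e j ≤ boxBound n (G.map (rawPoly m))) ∧
      (∀ e, (∀ j, e j ≤ 2 * X) → e ∈ T) ∧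
      ∀ t : Fin k → (Fin n →₀ ℕ), Set.range t = (monicLeadingTerms m I)ᶜ →
        ReductionClosed m G t T := by
  choose γ hγG hγ1 d hγd using exists_monic_power hG hI
  have hXn : n + 2 ≤ X := by
    rw [hX, expBound]
    omega
  have hexp : ∀ g ∈ G, ∀ e ∈ g.support, ∀ j, e j ≤ X := fun g hg e he j => by
    have := exponent_le_expBound (m := m) hg he j
    omega
  have hd : ∀ i, d i ≤ X := fun i => by
    have := hexp _ (hγG i) _ (m.degree_mem_support (hG0 _ (hγG i))) i
    rwa [hγd, Finsupp.single_eq_same] at this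
  have hstd : ∀ e ∉ monicLeadingTerms m I, ∀ i, e i < d i := by
    intro e he i
    by_contra! hle
    refine he ((mem_monicLeadingTerms_iff hG).2 ⟨γ i, hγG i, ?_, hγ1 i⟩)
    rw [hγd, Finsupp.single_le_iff]
    exact hle
  refine ⟨fun e he i => (hstd e he i).le.trans (hd i), ?_⟩
  obtain ⟨T, hT1, hT2, hT3⟩ := exists_closed_set m (B := X) (X := X) (by omega) le_rfl hXn hd
    (A := fun i => {a | a ∈ tailTerms m (γ i)})
    (fun i a ha => by
      rw [← hγd]
      exact (tailTerms_spec (hG0 _ (hγG i)) ha).2)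
    (fun i a ha => hexp _ (hγG i) a (tailTerms_spec (hG0 _ (hγG i)) ha).1)
    n ∅ (by simp) (by simp) 1
  have hbox : ∀ e : Fin n →₀ ℕ, (∀ j, e j ≤ 2 * X) → e ∈ T := fun e he =>
    hT2 e (fun j => (he j).trans (by rw [pow_one, pow_two]; exact Nat.mul_le_mul_right _ (by omega)))
      (by simp)
  refine ⟨T, ?_, hbox, fun t hr e he het => ?_⟩
  · rw [PTime.boxBound_eq, ← hX]
    exact hT1
  · rcases hT3 e he with hred | ⟨i, hi, h⟩
    · have : e ∈ monicLeadingTerms m I := by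
        rw [hr] at het
        simpa using het
      obtain ⟨g, hg, hle, hg1⟩ := (mem_monicLeadingTerms_iff hG).1 this
      refine ⟨g, hg, hg1, hle, fun a ha => hbox _ fun j => ?_⟩
      have h1 := (hred j).le.trans (hd j)
      have h2 := hexp g hg a (tailTerms_spec (hG0 g hg) ha).1 j
      simp only [Finsupp.add_apply, Finsupp.tsub_apply]
      omega
    · refine ⟨γ i, hγG i, hγ1 i, ?_, fun a ha => ?_⟩
      · rw [hγd, Finsupp.single_le_iff]
        exact hi
      · rw [hγd]
        exact h a ha

/-- The standard terms that the algorithm finds. -/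
theorem exists_standardTerms (hG : IsStrongGroebnerBasis m I G) (hG0 : ∀ g ∈ G, g ≠ 0) {M : ℕ}
    (hM : ∀ e ∉ monicLeadingTerms m I, ∀ i, e i ≤ M) :
    ∃ (k : ℕ) (t : Fin k → (Fin n →₀ ℕ)), Function.Injective t ∧
      Set.range t = (monicLeadingTerms m I)ᶜ ∧
      standardTerms (G.map (rawPoly m)) (box n M) = termLists t := by
  set l := standardTerms (G.map (rawPoly m)) (box n M) with hl
  have hlen : ∀ i : Fin l.length, ∃ e : Fin n →₀ ℕ, l.get i = List.ofFn e := fun i =>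
    exists_ofFn_term (mem_box.1 (List.mem_filter.1 (l.get_mem i)).1).1
  choose t ht using hlen
  have hlt : l = termLists t := by
    rw [termLists]
    conv_lhs => rw [← List.ofFn_get l]
    exact congrArg _ (funext ht)
  have hnd : l.Nodup := (nodup_box n M).filter _
  refine ⟨l.length, t, ?_, ?_, hlt⟩
  · intro i j hij
    exact hnd.injective_get (by rw [ht, ht, hij])
  · ext e
    have h1 : e ∈ Set.range t ↔ List.ofFn ⇑e ∈ l := by
      rw [congrArg (fun l' => List.ofFn ⇑e ∈ l') hlt, termLists, List.mem_ofFn]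
      exact ⟨fun ⟨i, hi⟩ => ⟨i, by rw [hi]⟩, fun ⟨i, hi⟩ => ⟨i, ofFn_term_injective hi⟩⟩
    have h2 : (List.any (G.map (rawPoly m))
        fun g => decide (|lcoeff g| = 1) && tle (lterm g) (List.ofFn e)) = true ↔
        e ∈ monicLeadingTerms m I := by
      rw [mem_monicLeadingTerms_iff hG, List.any_map, List.any_eq_true]
      refine exists_congr fun g => and_congr_right fun hg => ?_
      rw [Function.comp, lcoeff_rawPoly (hG0 g hg), lterm_rawPoly (hG0 g hg), Bool.and_eq_true,
        decide_eq_true_eq, tle_ofFn, and_comm]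
    rw [h1, hl, standardTerms, List.mem_filter, ofFn_mem_box, Bool.not_eq_true',
      ← Bool.not_eq_true, h2, Set.mem_compl_iff]
    exact ⟨fun h => h.2, fun h => ⟨hM e h, h⟩⟩

end Table

end PolyTime


namespace PolyTime
open Enc (enc)

section Reduction

variable {n k : ℕ} {m : MonomialOrder (Fin n)} {I : Ideal (MvPolynomial (Fin n) ℤ)}
  {G : List (MvPolynomial (Fin n) ℤ)} {t : Fin k → (Fin n →₀ ℕ)}

/-! ## Correctness of the reduction -/

theorem bestPoly_spec {G : List (MvPolynomial (Fin n) ℤ)} (hG0 : ∀ g ∈ G, g ≠ 0)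
    (e : Fin n →₀ ℕ) :
    (bestPoly (G.map (rawPoly m)) (List.ofFn e) = [] ∧ ∀ g ∈ G, ¬ m.degree g ≤ e) ∨
    ∃ g ∈ G, bestPoly (G.map (rawPoly m)) (List.ofFn e) = rawPoly m g ∧ m.degree g ≤ e ∧
      ∀ g' ∈ G, m.degree g' ≤ e → |m.leadingCoeff g| ≤ |m.leadingCoeff g'| := by
  induction G using List.reverseRecOn with
  | nil => exact .inl ⟨rfl, by simp⟩
  | append_singleton G g ih =>
    have hg0 : g ≠ 0 := hG0 g (by simp)
    have ih := ih fun g' hg' => hG0 g' (by simp [hg'])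
    have hstep : bestPoly ((G ++ [g]).map (rawPoly m)) (List.ofFn e) =
        if tle (lterm (rawPoly m g)) (List.ofFn e) &&
          (decide (lcoeff (bestPoly (G.map (rawPoly m)) (List.ofFn e)) = 0) ||
            decide (|lcoeff (rawPoly m g)| <
              |lcoeff (bestPoly (G.map (rawPoly m)) (List.ofFn e))|))
        then rawPoly m g else bestPoly (G.map (rawPoly m)) (List.ofFn e) := by
      rw [bestPoly, List.map_append, List.foldl_append]
      rfl
    have hcond : (tle (lterm (rawPoly m g)) (List.ofFn e) &&
          (decide (lcoeff (bestPoly (G.map (rawPoly m)) (List.ofFn e)) = 0) ||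
            decide (|lcoeff (rawPoly m g)| <
              |lcoeff (bestPoly (G.map (rawPoly m)) (List.ofFn e))|))) = true ↔
        m.degree g ≤ e ∧ (lcoeff (bestPoly (G.map (rawPoly m)) (List.ofFn e)) = 0 ∨
          |m.leadingCoeff g| < |lcoeff (bestPoly (G.map (rawPoly m)) (List.ofFn e))|) := by
      rw [lterm_rawPoly hg0, lcoeff_rawPoly hg0, Bool.and_eq_true, Bool.or_eq_true,
        decide_eq_true_eq, decide_eq_true_eq, tle_ofFn]
    rw [hstep]
    rcases ih with ⟨h1, h2⟩ | ⟨b, hb, h1, h2, h3⟩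
    · by_cases hle : m.degree g ≤ e
      · rw [if_pos (hcond.2 ⟨hle, .inl (by rw [h1]; rfl)⟩)]
        refine .inr ⟨g, by simp, rfl, hle, fun g' hg' hle' => ?_⟩
        rcases List.mem_append.1 hg' with hg' | hg'
        · exact absurd hle' (h2 g' hg')
        · rw [List.mem_singleton.1 hg']
      · rw [if_neg fun h => hle (hcond.1 h).1]
        refine .inl ⟨h1, fun g' hg' => ?_⟩
        rcases List.mem_append.1 hg' with hg' | hg'
        · exact h2 g' hg'
        · rwa [List.mem_singleton.1 hg']
    · have hb0 : b ≠ 0 := hG0 b (by simp [hb])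
      rw [h1, lcoeff_rawPoly hb0] at hcond
      rw [h1, lcoeff_rawPoly hb0]
      split_ifs with hc
      · obtain ⟨hle, hlt⟩ := hcond.1 hc
        have hlt := hlt.resolve_left (m.leadingCoeff_ne_zero_iff.2 hb0)
        refine .inr ⟨g, by simp, rfl, hle, fun g' hg' hle' => ?_⟩
        rcases List.mem_append.1 hg' with hg' | hg'
        · exact hlt.le.trans (h3 g' hg' hle')
        · rw [List.mem_singleton.1 hg']
      · refine .inr ⟨b, by simp [hb], rfl, h2, fun g' hg' hle' => ?_⟩
        rcases List.mem_append.1 hg' with hg' | hg'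
        · exact h3 g' hg' hle'
        · rw [List.mem_singleton.1 hg'] at hle' ⊢
          by_contra! hlt
          exact hc (hcond.2 ⟨hle', .inr hlt⟩)

/-- A reduction rule `w` for the term `t i`, with coefficient `c`. -/
structure IsReductionRule (m : MonomialOrder (Fin n)) (I : Ideal (MvPolynomial (Fin n) ℤ))
    (G : List (MvPolynomial (Fin n) ℤ)) (t : Fin k → (Fin n →₀ ℕ)) (i : Fin k) (c : ℤ)
    (w : Fin k → ℤ) : Prop where
  mem : combination t w ∈ I
  self : w i = c
  lower : ∀ j, j ≠ i → w j ≠ 0 → m.toSyn (t j) < m.toSyn (t i)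
  minimal : ∀ g ∈ G, m.degree g ≤ t i → c ≠ 0 ∧ |c| ≤ |m.leadingCoeff g|
  attained : c ≠ 0 → ∃ g ∈ G, m.degree g ≤ t i ∧ |m.leadingCoeff g| = |c|

theorem exists_reductionRule (hG : ∀ g ∈ G, g ∈ I) (hG0 : ∀ g ∈ G, g ≠ 0)
    (ht : Function.Injective t) {tbl : Table} (hT : GoodTable m I t tbl) {i : Fin k}
    (hk : ∀ g ∈ G, m.degree g ≤ t i → ∀ a ∈ tailTerms m g,
      known tbl (List.ofFn ⇑(t i - m.degree g + a)) = true) :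
    ∃ c w, reductionRow (G.map (rawPoly m)) (termLists t) tbl (List.ofFn (t i)) =
      (List.ofFn (Pi.single i 1), c, List.ofFn w) ∧ IsReductionRule m I G t i c w := by
  rcases bestPoly_spec (m := m) hG0 (t i) with ⟨h1, h2⟩ | ⟨g, hg, h1, h2, h3⟩
  · refine ⟨0, 0, ?_, by simp [combination], rfl, by simp, fun g hg hle => absurd hle (h2 g hg),
      by simp⟩
    rw [reductionRow, h1, unitVec_ofFn ht]
    have h3 : evalTable (zeroVec (termLists t)) tbl (tsub (List.ofFn (t i)) (lterm []))
        (List.tail []) = List.ofFn (0 : Fin k → ℤ) := zeroVec_ofFn t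
    have h4 : lcoeff [] = 0 := rfl
    rw [h3, h4, vsmul_ofFn, vadd_ofFn, zero_smul, zero_add]
  · have hg0 := hG0 g hg
    obtain ⟨d, h4, h5, h6⟩ := evalTable_spec hT (t i - m.degree g) (fun a => g.coeff a) (hk g hg h2)
    have hlow : ∀ j, d j ≠ 0 → m.toSyn (t j) < m.toSyn (t i) := by
      intro j hj
      obtain ⟨a, ha, hja⟩ := h6 j hj
      refine hja.trans_lt ?_
      conv_rhs => rw [← tsub_add_cancel_of_le h2]
      rw [map_add, map_add]
      exact add_lt_add_right (tailTerms_spec hg0 ha).2 _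
    have hdi : d i = 0 := by
      by_contra h
      exact lt_irrefl _ (hlow i h)
    refine ⟨m.leadingCoeff g, m.leadingCoeff g • Pi.single i 1 + d, ?_, ?_, ?_, ?_, ?_, ?_⟩
    · rw [reductionRow, h1, unitVec_ofFn ht, lcoeff_rawPoly hg0, lterm_rawPoly hg0,
        tail_rawPoly hg0, tsub_ofFn, h4, vsmul_ofFn, vadd_ofFn]
    · have h7 := I.mul_mem_left (monomial (t i - m.degree g) 1) (hG g hg)
      rw [monomial_mul_eq hg0, tsub_add_cancel_of_le h2, one_mul, one_smul] at h7
      have h9 := I.sub_mem h7 h5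
      rw [combination_add, combination_smul, combination_single, smul_monomial, smul_eq_mul,
        mul_one]
      convert h9 using 1
      abel
    · simp [hdi]
    · intro j hji hj
      refine hlow j fun h => hj ?_
      simp [hji, h]
    · exact fun g' hg' hle' => ⟨m.leadingCoeff_ne_zero_iff.2 hg0, h3 g' hg' hle'⟩
    · exact fun _ => ⟨g, hg, h2, rfl⟩

/-- One step of the reduction, on vectors given as functions. -/
def reduceAt (c : Fin k → ℤ) (w : Fin k → Fin k → ℤ) (v : Fin k → ℤ) (i : Fin k) : Fin k → ℤ :=
  v - (v i / c i) • w i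

/-- The coefficient of `v` at `i` is reduced modulo `c i`. -/
def ReducedAt (c : Fin k → ℤ) (v : Fin k → ℤ) (i : Fin k) : Prop :=
  c i ≠ 0 → 0 ≤ v i ∧ v i < |c i|

variable {c : Fin k → ℤ} {w : Fin k → Fin k → ℤ}

theorem reducedAt_reduceAt (hw : ∀ i, IsReductionRule m I G t i (c i) (w i)) (v : Fin k → ℤ)
    (i : Fin k) : ReducedAt c (reduceAt c w v i) i := by
  intro hc
  have h := Int.emod_add_mul_ediv (v i) (c i)
  have : reduceAt c w v i i = v i % c i := by
    simp only [reduceAt, Pi.sub_apply, Pi.smul_apply, smul_eq_mul, (hw i).self]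
    linarith
  rw [this]
  exact ⟨Int.emod_nonneg _ hc, Int.emod_lt_abs _ hc⟩

/-- Reduction steps do not destroy what has been achieved for an upper set of terms. -/
theorem reduceAt_of_upper (hw : ∀ i, IsReductionRule m I G t i (c i) (w i)) {P : Fin k → Prop}
    (hP : ∀ i j, P i → m.toSyn (t i) < m.toSyn (t j) → P j) {v : Fin k → ℤ}
    (hv : ∀ i, P i → ReducedAt c v i) (j : Fin k) :
    ∀ i, P i → ReducedAt c (reduceAt c w v j) i := by
  intro i hi
  by_cases hj : P j
  · have : v j / c j = 0 := by
      by_cases hc : c j = 0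
      · simp [hc]
      · exact Int.ediv_eq_zero_of_lt_abs (hv j hj hc).1 (hv j hj hc).2
    rw [reduceAt, this, zero_smul, sub_zero]
    exact hv i hi
  · have : w j i = 0 := by
      by_contra h
      have hij : i ≠ j := fun h => hj (h ▸ hi)
      exact hj (hP i j hi ((hw j).lower i hij h))
    intro hc
    have h := hv i hi hc
    simpa [reduceAt, this] using h

theorem foldl_reduceAt_of_upper (hw : ∀ i, IsReductionRule m I G t i (c i) (w i))
    {P : Fin k → Prop} (hP : ∀ i j, P i → m.toSyn (t i) < m.toSyn (t j) → P j)
    (L : List (Fin k)) {v : Fin k → ℤ} (hv : ∀ i, P i → ReducedAt c v i) :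
    ∀ i, P i → ReducedAt c (L.foldl (reduceAt c w) v) i := by
  induction L generalizing v with
  | nil => exact hv
  | cons j L ih => exact ih (reduceAt_of_upper hw hP hv j)

theorem foldl_reduceAt_mem (hw : ∀ i, IsReductionRule m I G t i (c i) (w i)) (L : List (Fin k))
    (v : Fin k → ℤ) : combination t v - combination t (L.foldl (reduceAt c w) v) ∈ I := by
  induction L generalizing v with
  | nil => simp
  | cons j L ih =>
    have h1 := ih (reduceAt c w v j)
    have h2 : combination t v - combination t (reduceAt c w v j) ∈ I := by
      rw [reduceAt, combination_sub, combination_smul, sub_sub_cancel]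
      exact zsmul_mem (hw j).mem _
    have := I.add_mem h2 h1
    rwa [sub_add_sub_cancel] at this

theorem rounds_reducedAt (ht : Function.Injective t)
    (hw : ∀ i, IsReductionRule m I G t i (c i) (w i)) (v : Fin k → ℤ) (i : Fin k) :
    ReducedAt c (((List.finRange k).flatMap fun _ => List.finRange k).foldl (reduceAt c w) v) i := by
  let rank : Fin k → ℕ := fun i => (Finset.univ.filter fun j => m.toSyn (t i) < m.toSyn (t j)).card
  have hrank : ∀ i j, m.toSyn (t i) < m.toSyn (t j) → rank j < rank i := by
    intro i j hij
    refine Finset.card_lt_card ⟨fun b hb => ?_, fun hsub => ?_⟩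
    · rw [Finset.mem_filter] at hb ⊢
      exact ⟨hb.1, hij.trans hb.2⟩
    · have := hsub (Finset.mem_filter.2 ⟨Finset.mem_univ j, hij⟩)
      rw [Finset.mem_filter] at this
      exact lt_irrefl _ this.2
  have hround : ∀ (L : List (Fin k)) (r : ℕ) (v : Fin k → ℤ), (∀ i, rank i < r → ReducedAt c v i) →
      ∀ i, rank i < r + L.length →
        ReducedAt c ((L.flatMap fun _ => List.finRange k).foldl (reduceAt c w) v) i := by
    intro L
    induction L with
    | nil => exact fun r v h => h
    | cons _ L ih =>
      intro r v h
      rw [List.flatMap_cons, List.foldl_append, List.length_cons, ← add_assoc, add_right_comm]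
      refine ih (r + 1) _ fun i hi => ?_
      obtain ⟨L₁, L₂, hL⟩ := List.append_of_mem (List.mem_finRange i)
      rw [hL, List.foldl_append, List.foldl_cons]
      have h1 := foldl_reduceAt_of_upper hw (P := fun j => m.toSyn (t i) < m.toSyn (t j))
        (fun _ _ h h' => h.trans h') L₁ (v := v) (fun j hj => h j (by have := hrank i j hj; omega))
      have h2 := reduceAt_of_upper hw (P := fun j => m.toSyn (t i) < m.toSyn (t j))
        (fun _ _ h h' => h.trans h') h1 i
      refine foldl_reduceAt_of_upper hw (P := fun j => m.toSyn (t i) ≤ m.toSyn (t j))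
        (fun _ _ h h' => h.trans h'.le) L₂ (fun j hj => ?_) i le_rfl
      rcases hj.lt_or_eq with hj | hj
      · exact h2 j hj
      · rw [← ht (m.toSyn.injective hj)]
        exact reducedAt_reduceAt hw _ i
  refine hround _ 0 v (fun i hi => absurd hi (by omega)) i ?_
  rw [zero_add, List.length_finRange]
  have : rank i < (Finset.univ : Finset (Fin k)).card := by
    refine Finset.card_lt_card ⟨Finset.filter_subset _ _, fun hsub => ?_⟩
    have := hsub (Finset.mem_univ i)
    rw [Finset.mem_filter] at this
    exact lt_irrefl _ this.2
  simpa using this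

/-- All reduction rules as the algorithm stores them. -/
def ruleLists (c : Fin k → ℤ) (w : Fin k → Fin k → ℤ) : List (List ℤ × ℤ × List ℤ) :=
  (List.finRange k).map fun i => (List.ofFn (Pi.single i (1 : ℤ)), c i, List.ofFn (w i))

theorem reduce_ofFn (t : Fin k → (Fin n →₀ ℕ)) (c : Fin k → ℤ) (w : Fin k → Fin k → ℤ)
    (v : Fin k → ℤ) : reduce (termLists t) (ruleLists c w) (List.ofFn v) =
      List.ofFn (((List.finRange k).flatMap fun _ => List.finRange k).foldl (reduceAt c w) v) := by
  have h1 : (termLists t).flatMap (fun _ => ruleLists c w) =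
      ((List.finRange k).flatMap fun _ => List.finRange k).map
        fun i => (List.ofFn (Pi.single i (1 : ℤ)), c i, List.ofFn (w i)) := by
    rw [List.map_flatMap, termLists, List.ofFn_eq_map, List.flatMap_map]
    rfl
  rw [reduce, h1, List.foldl_map]
  generalize (List.finRange k).flatMap (fun _ => List.finRange k) = L
  induction L generalizing v with
  | nil => rfl
  | cons i L ih =>
    have : reduceStep (List.ofFn v) (List.ofFn (Pi.single i (1 : ℤ)), c i, List.ofFn (w i)) =
        List.ofFn (reduceAt c w v i) := by
      rw [reduceStep, dot_ofFn_single, vsmul_ofFn, vadd_ofFn, reduceAt, neg_smul, sub_eq_add_neg]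
    rw [List.foldl_cons, List.foldl_cons, this, ih]

/-- The result of the reduction of a vector. -/
def reduced (c : Fin k → ℤ) (w : Fin k → Fin k → ℤ) (v : Fin k → ℤ) : Fin k → ℤ :=
  ((List.finRange k).flatMap fun _ => List.finRange k).foldl (reduceAt c w) v

theorem isNormalForm_reduced (hG : IsStrongGroebnerBasis m I G) (ht : Function.Injective t)
    (hw : ∀ i, IsReductionRule m I G t i (c i) (w i)) {f : MvPolynomial (Fin n) ℤ}
    {v : Fin k → ℤ} (hf : f - combination t v ∈ I) :
    IsNormalForm m I f (combination t (reduced c w v)) := by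
  refine isNormalForm_combination hG ht ?_ fun i g hg hle => ?_
  · have := I.add_mem hf (foldl_reduceAt_mem hw
      ((List.finRange k).flatMap fun _ => List.finRange k) v)
    rwa [sub_add_sub_cancel] at this
  · obtain ⟨h1, h2⟩ := (hw i).minimal g hg hle
    obtain ⟨h3, h4⟩ := rounds_reducedAt ht hw v i h1
    rw [reduced, abs_of_nonneg h3]
    exact h4.trans_le h2

/-- The relation that belongs to the `i`-th reduction rule. -/
def relationAt (c : Fin k → ℤ) (w : Fin k → Fin k → ℤ) (i : Fin k) : Option (Fin k → ℤ) :=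
  if c i = 0 then none else some (Pi.single i |c i| - reduced c w (Pi.single i |c i|))

theorem run_relationAt (hG : IsStrongGroebnerBasis m I G) (ht : Function.Injective t)
    (hr : Set.range t = (monicLeadingTerms m I)ᶜ)
    (hw : ∀ i, IsReductionRule m I G t i (c i) (w i)) :
    ModulePresentationRun m I G t Finset.univ ((List.finRange k).filterMap (relationAt c w)) := by
  have huniv : (Finset.univ : Finset (Fin k)) = (List.finRange k).toFinset := by
    ext i
    simp
  rw [huniv]
  refine modulePresentationRun_filterMap (fun i hi => ?_) (fun i u hi => ?_)
    (List.nodup_finRange k)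
  · rw [Set.eq_empty_iff_forall_notMem]
    rintro l ⟨-, g, hg, hle, -⟩
    rw [relationAt, if_neg ((hw i).minimal g hg hle).1] at hi
    simp at hi
  · by_cases hc : c i = 0
    · rw [relationAt, if_pos hc] at hi
      simp at hi
    rw [relationAt, if_neg hc, Option.some.injEq] at hi
    refine ⟨|c i|, _, ⟨?_, ?_⟩, isNormalForm_reduced hG ht hw ?_, hi.symm⟩
    · obtain ⟨g, hg, hle, hgc⟩ := (hw i).attained hc
      refine ⟨?_, g, hg, hle, hgc⟩
      have h1 : |c i| ≠ 1 := fun h => by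
        have : t i ∈ Set.range t := ⟨i, rfl⟩
        rw [hr] at this
        exact this ((mem_monicLeadingTerms_iff hG).2 ⟨g, hg, hle, hgc.trans h⟩)
      have := abs_pos.2 hc
      omega
    · rintro l ⟨-, g, hg, hle, rfl⟩
      exact ((hw i).minimal g hg hle).2
    · rw [combination_single, sub_self]
      exact I.zero_mem

theorem relations_eq (t : Fin k → (Fin n →₀ ℕ)) (c : Fin k → ℤ) (w : Fin k → Fin k → ℤ) :
    ((ruleLists c w).filter fun r => !decide (r.2.1 = 0)).map
      (relation (termLists t) (ruleLists c w)) =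
    ((List.finRange k).filterMap (relationAt c w)).map fun u => List.ofFn u := by
  have hrel : ∀ i, c i ≠ 0 → relation (termLists t) (ruleLists c w)
      (List.ofFn (Pi.single i (1 : ℤ)), c i, List.ofFn (w i)) =
      List.ofFn (Pi.single i |c i| - reduced c w (Pi.single i |c i|)) := fun i _ => by
    have hs : |c i| • (Pi.single i (1 : ℤ) : Fin k → ℤ) = Pi.single i |c i| := by
      rw [← Pi.single_smul, smul_eq_mul, mul_one]
    rw [relation]
    dsimp only
    rw [vsmul_ofFn, hs, reduce_ofFn, vsmul_ofFn, vadd_ofFn, neg_one_smul, ← sub_eq_add_neg]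
    rfl
  generalize relation (termLists t) (ruleLists c w) = F at hrel ⊢
  rw [ruleLists, List.filter_map, List.map_map, List.map_filterMap]
  generalize List.finRange k = L
  induction L with
  | nil => rfl
  | cons i L ih =>
    by_cases hc : c i = 0
    · rw [List.filter_cons_of_neg (by simp [hc]), List.filterMap_cons_none
        (by simp [relationAt, hc]), ih]
    · rw [List.filter_cons_of_pos (by simp [hc]), List.map_cons, ih]
      refine (List.filterMap_cons_some ?_).symm
      simp only [relationAt, if_neg hc, Option.map_some, Function.comp, hrel i hc]

/-! ## Correctness of the algorithm -/

theorem encOutput_eq (t : Fin k → (Fin n →₀ ℕ)) (U : List (Fin k → ℤ))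
    (c : Fin k → Fin k → Fin k → ℤ) :
    encOutput t U c = enc (termLists t, U.map (fun u => List.ofFn u),
      List.ofFn fun i => List.ofFn fun j => List.ofFn (c i j)) := by
  have h1 : ∀ e : Fin n →₀ ℕ, encTerm e = enc (List.ofFn e) := fun e => by
    simp only [encTerm, enc, List.map_ofFn]
    rfl
  have h2 : ∀ u : Fin k → ℤ, encVec u = enc (List.ofFn u) := fun u => by
    simp only [encVec, enc, List.map_ofFn]
    rfl
  have h3 : ∀ {τ : Type} [Enc τ] {l : ℕ} (F : Fin l → τ),
      enc (List.ofFn F) = .ofList (List.ofFn fun i => enc (F i)) := fun F => by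
    simp only [enc, List.map_ofFn]
    rfl
  have h4 : enc (U.map fun u => List.ofFn u) = .ofList (U.map encVec) := by
    simp only [enc, List.map_map]
    congr 1
    exact List.map_congr_left fun u _ => (h2 u).symm
  have h5 : ∀ {τ σ : Type} [Enc τ] [Enc σ] (x : τ) (y : σ), enc (x, y) = .pair (enc x) (enc y) :=
    fun _ _ => rfl
  rw [encOutput, h5, h5, h4, termLists, h3, h3]
  simp only [h1, h2, h3 (τ := List ℤ)]

theorem algorithm_spec (hG : IsStrongGroebnerBasis m I G) (hG0 : ∀ g ∈ G, g ≠ 0)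
    (hI : Module.Finite ℤ (MvPolynomial (Fin n) ℤ ⧸ I)) :
    ∃ (k : ℕ) (t : Fin k → (Fin n →₀ ℕ)) (U : List (Fin k → ℤ)) (s : Fin k → Fin k → Fin k → ℤ),
      enc (algorithm (n, G.map (rawPoly m))) = encOutput t U s ∧
      (Function.Injective t ∧ Set.range t = (monicLeadingTerms m I)ᶜ) ∧
      ModulePresentationRun m I G t Finset.univ U ∧
      ∀ i j, IsNormalForm m I (monomial (t i + t j) 1) (combination t (s i j)) := by
  set M := boxBound n (G.map (rawPoly m)) with hM
  have hXM : expBound n (G.map (rawPoly m)) ≤ M := by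
    rw [hM, PTime.boxBound_eq]
    exact Nat.le_self_pow (by positivity) _
  obtain ⟨hstd, -⟩ := exists_reductionClosed (k := 0) hG hG0 hI rfl
  obtain ⟨k, t, ht, hr, hO⟩ := exists_standardTerms hG hG0
    (M := M) fun e he i => (hstd e he i).trans hXM
  obtain ⟨-, T, hT1, hT2, hT3⟩ := exists_reductionClosed (k := k) hG hG0 hI rfl
  obtain ⟨hgood, hknown⟩ := table_spec hG.1 hG0 ht (hT3 t hr) hT1
  set tbl := table (G.map (rawPoly m)) (box n M) (termLists t) with htbl
  have hti : ∀ i j, t i j ≤ expBound n (G.map (rawPoly m)) := fun i =>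
    hstd (t i) (by
      have : t i ∈ Set.range t := ⟨i, rfl⟩
      rwa [hr] at this)
  have hrule := fun i => exists_reductionRule hG.1 hG0 ht hgood (i := i) fun g hg _ a ha =>
    hknown _ (hT2 _ fun j => by
      have h1 := hti i j
      have h2 := exponent_le_expBound (m := m) hg (tailTerms_spec (hG0 g hg) ha).1 j
      simp only [Finsupp.add_apply, Finsupp.tsub_apply]
      omega)
  choose c w hcw hw using hrule
  have hprod := fun i j => lookup_spec hgood (zeroVec (termLists t)) (hknown (t i + t j)
    (hT2 _ fun l => by
      have h1 := hti i l
      have h2 := hti j l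
      simp only [Finsupp.add_apply]
      omega))
  choose p hp1 hp2 using hprod
  refine ⟨k, t, (List.finRange k).filterMap (relationAt c w), fun i j => reduced c w (p i j), ?_,
    ⟨ht, hr⟩, run_relationAt hG ht hr hw, fun i j => isNormalForm_reduced hG ht hw (hp2 i j).1⟩
  have hrows : (termLists t).map (reductionRow (G.map (rawPoly m)) (termLists t) tbl) =
      ruleLists c w := by
    generalize hF : reductionRow (G.map (rawPoly m)) (termLists t) tbl = F at hcw
    rw [termLists, List.ofFn_eq_map, List.map_map]
    exact List.map_congr_left fun i _ => hcw i
  rw [encOutput_eq, algorithm, presentation]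
  dsimp only
  rw [← hM, hO, ← htbl, hrows, relations_eq]
  congr 3
  conv_lhs => rw [termLists, List.map_ofFn]
  congr 1
  funext i
  simp only [Function.comp, List.map_ofFn]
  congr 1
  funext j
  simp only [Function.comp, tadd_ofFn]
  rw [← termLists, hp1, reduce_ofFn]
  rfl

end Reduction

end PolyTime

/-- One program computes explicit representations from minimal strong Gröbner bases; in each
polynomial ring `ℤ[x₁, …, xₙ]` its running time is bounded by a polynomial in the bit complexity
of the basis. -/
theorem mainTheorem8 :
    ∃ prog : Prog, ∀ n : ℕ, ∃ p : Polynomial ℕ,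
      ∀ (m : MonomialOrder (Fin n)) (I : Ideal (MvPolynomial (Fin n) ℤ))
        (G : List (MvPolynomial (Fin n) ℤ)),
        Module.Finite ℤ (MvPolynomial (Fin n) ℤ ⧸ I) →
        IsMinimalStrongGroebnerBasis m I G →
        ∃ (k : ℕ) (t : Fin k → (Fin n →₀ ℕ)) (U : List (Fin k → ℤ))
          (c : Fin k → Fin k → Fin k → ℤ) (time : ℕ),
          Runs prog (encInput m G) (encOutput t U c) time ∧
          time ≤ p.eval (bitComplexity G) ∧
          (Function.Injective t ∧ Set.range t = (monicLeadingTerms m I)ᶜ) ∧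
          ModulePresentationRun m I G t Finset.univ U ∧
          (∀ i j, IsNormalForm m I (monomial (t i + t j) 1) (combination t (c i j))) ∧
          IsExplicitRepresentation
            (fun i => Ideal.Quotient.mk I (monomial (t i) 1)) U c := by
  obtain ⟨prog, hprog⟩ := PolyTime.exists_prog
  refine ⟨prog, fun n => ?_⟩
  obtain ⟨d, hd⟩ := hprog n
  refine ⟨(Polynomial.C (2 * n + 8) * (Polynomial.X + 1)) ^ d, fun m I G hI hG => ?_⟩
  obtain ⟨hG, hG0, -⟩ := hG
  obtain ⟨time, htime, hrun⟩ := hd (G.map (PolyTime.rawPoly m))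
  obtain ⟨k, t, U, c, henc, ht, hU, hc⟩ := PolyTime.algorithm_spec hG hG0 hI
  refine ⟨k, t, U, c, time, ?_, ?_, ht, hU, hc,
    isExplicitRepresentation_of_run hG hG0 ht.1 ht.2 hU hc⟩
  · rwa [PolyTime.encInput_eq, ← henc]
  · refine htime.trans ?_
    simp only [Polynomial.eval_pow, Polynomial.eval_mul, Polynomial.eval_C, Polynomial.eval_add,
      Polynomial.eval_X, Polynomial.eval_one]
    exact Nat.pow_le_pow_left (PolyTime.inputLength_le hG0) d
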